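/- Theorem 1.4. Let $n\ge 2$. A convex body in $\mathbb{R}^n$ is a compact convex set with non-empty interior, and $B^n$ is the Euclidean unit ball. For convex bodies $K,M$ let $$\delta_{\rm BM}(K,M)=\min\{\lambda\ge 1:\ K-x\subset\Phi(M-y)\subset\lambda(K-x)\ \text{for some }\Phi\in{\rm GL}(n),\ x,y\in\mathbb{R}^n\}.$$ The Steiner symmetral of $K$ with respect to a hyperplane $H$ is obtained by translating, for each line $l$ orthogonal to $H$ that meets $K$, the segment $l\cap K$ along $l$ so that its midpoint lies in $H$, and taking the union of the translated segments. A convex body $C$ is $o$-symmetric if $C=-C$, and it has axial rotational symmetry if there is a unit vector $u$ such that $C$ is invariant under every linear isometry of $\mathbb{R}^n$ fixing $u$. We say that $C$ results from $K$ as a limit of subsequent Steiner symmetrizations and affine transformations if there is a sequence $K=K_0,K_1,K_2,\dots$ converging to $C$ in the Hausdorff metric such that each $K_{m+1}$ is either the Steiner symmetral of $K_m$ with respect to some hyperplane or the image of $K_m$ under some invertible affine transformation. There is a constant $\gamma>0$ depending only on $n$ such that the following holds for every $\varepsilon>0$ and every convex body $K$ in $\mathbb{R}^n$ with $\delta_{\rm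 BM}(K,B^n)>1+\varepsilon$. There is an $o$-symmetric convex body $C$ with axial rotational symmetry that results from $K$ as a limit of subsequent Steiner symmetrizations and affine transformations and satisfies $$\delta_{\rm BM}(C,B^n)>1+\gamma\varepsilon^2 .$$ If moreover $K$ is $o$-symmetric, then there is such a $C$ with $\delta_{\rm BM}(C,B^n)>1+\gamma\varepsilon$. -/

import Mathlib

open Set Filter Topology
open scoped Pointwise RealInnerProductSpace

/-- Euclidean space `ℝⁿ` with its standard scalar product. -/
abbrev Eucl (n : ℕ) : Type := EuclideanSpace ℝ (Fin n)

/-- A convex body in the sense of convex geometry: Mathlib's `ConvexBody` (a nonempty compact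
convex set) with non-empty interior. -/
def HasInterior {n : ℕ} (K : ConvexBody (Eucl n)) : Prop :=
  (interior (K : Set (Eucl n))).Nonempty

/-- The Banach-Mazur distance of `K` and `M`: the least `lam ≥ 1` such that
`K - x ⊆ Φ (M - y) ⊆ lam (K - x)` for some `Φ ∈ GL(n)` and `x, y ∈ ℝⁿ`.
For convex bodies the set is non-empty and the infimum is attained. -/
noncomputable def bmDist {n : ℕ} (K M : Set (Eucl n)) : ℝ :=
  sInf {lam : ℝ | 1 ≤ lam ∧ ∃ (Φ : Eucl n ≃ₗ[ℝ] Eucl n) (x y : Eucl n),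
    (fun z => z - x) '' K ⊆ Φ '' ((fun z => z - y) '' M) ∧
    Φ '' ((fun z => z - y) '' M) ⊆ lam • ((fun z => z - x) '' K)}

/-- The Euclidean unit ball `Bⁿ`. -/
def unitBall (n : ℕ) : Set (Eucl n) := Metric.closedBall 0 1

/-- `C = -C`. -/
def OSymmetric {n : ℕ} (C : Set (Eucl n)) : Prop := -C = C

/-- Rotational symmetry around a line `ℝ u` through the origin: `C` is invariant under every
linear isometry fixing `u`. (In the plane this is the reflection symmetry in the line `ℝ u`.) -/
def AxialSymmetric {n : ℕ} (C : Set (Eucl n)) : Prop :=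
  ∃ u : Eucl n, ‖u‖ = 1 ∧ ∀ g : Eucl n ≃ₗᵢ[ℝ] Eucl n, g u = u → g '' C = C

/-- The Steiner symmetral of `K` with respect to the hyperplane `H = {y | ⟪u, y⟫ = t}`, where `u`
is a unit vector. For each `y ∈ H` whose normal line `y + ℝ u` meets `K`, in the segment from
`y + a u` to `y + b u`, that segment is translated along the line by `-((a + b) / 2) u`, so that
its midpoint becomes `y`; the symmetral is the union of the translated segments. -/
def steinerSymmetral {n : ℕ} (u : Eucl n) (t : ℝ) (K : Set (Eucl n)) : Set (Eucl n) :=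
  {z | ∃ (y : Eucl n) (a b : ℝ), ⟪u, y⟫ = t ∧ {s : ℝ | y + s • u ∈ K} = Icc a b ∧
    ∃ s ∈ Icc a b, z = y + (s - (a + b) / 2) • u}

/-- `L` is the Steiner symmetral of `K` with respect to some (affine) hyperplane. -/
def IsSteinerStep {n : ℕ} (K L : ConvexBody (Eucl n)) : Prop :=
  ∃ (u : Eucl n) (t : ℝ), ‖u‖ = 1 ∧ (L : Set (Eucl n)) = steinerSymmetral u t K

/-- `L` is the image of `K` under some invertible affine transformation. -/
def IsAffineStep {n : ℕ} (K L : ConvexBody (Eucl n)) : Prop :=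
  ∃ A : Eucl n ≃ᵃ[ℝ] Eucl n, (L : Set (Eucl n)) = A '' (K : Set (Eucl n))

/-- `C` results from `K` as a limit (in the Hausdorff metric, which is the metric of
`ConvexBody`) of subsequent Steiner symmetrizations and affine transformations. As the identity
is an affine transformation, finite chains are included. -/
def IsSteinerAffineLimit {n : ℕ} (K C : ConvexBody (Eucl n)) : Prop :=
  ∃ S : ℕ → ConvexBody (Eucl n), S 0 = K ∧
    (∀ m, IsSteinerStep (S m) (S (m + 1)) ∨ IsAffineStep (S m) (S (m + 1))) ∧
    Tendsto S atTop (𝓝 C)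

/-! Write h for the support function and V for the volume. For a centred ellipsoid E the quotient
∫_E ⟪u, x⟫² / (h_E(u)² V(E)) is a constant c that depends neither on E nor on u
(`exists_ellipsoid_moment`). Conversely, if a body containing 0 has this quotient close to c in
every direction, then h² is nearly proportional to the quadratic form u ↦ ∫ ⟪u, x⟫², so the body is
nearly an ellipsoid (`bmDist_le_of_moment`, `bmDist_le_of_suppFn`). Symmetrization along a direction
v ⊥ u changes neither h(u), nor V, nor the second moment in direction u. Hence the quotient of a
body in direction u can be read off from a symmetral.

Symmetric case. Symmetrizing K along directions orthogonal to u in a greedy order, each step nearly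
maximising the decrease of ∫ ‖x‖², converges to a body with axis ℝu (`exists_symmetrization_limit`,
`exists_axial_limit`). If all these limits, for all u, were within 1 + γε of ellipsoids, the
quotient of K would be c up to a factor 1 + O(ε) in every direction, and K would be within 1 + ε of
an ellipsoid.

General case. It suffices to reach an o-symmetric body U at distance more than 1 + aε² and to apply
the symmetric case to U. The candidates are the symmetrals, with respect to all coordinate
hyperplanes, of the affine images of K. Suppose that all of them are within 1 + η of ellipsoids;
then K is within 1 + C√η of one (`bmDist_le_of_allNearEllipsoid`). The main point is that K is
nearly centrally symmetric (`exists_center`), that is, the odd part of h_K is nearly linear. By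
homogeneity it is enough to have near additivity on pairs of vectors (`exists_linear_approx`), which
concerns only the projections Q of K to planes. All linear images of Q have nearly elliptic double
symmetrals (`exists_isNearEllipse`).

In the plane let D = (Q - Q)/2. Width and chord bounds for a suitable linear image of Q bound all
determinants of pairs of points of D by λ² V(Q)/π. A symmetric plane body has area at most π times
its largest determinant (`area_le_of_planeDet_le`), so V(D) ≤ λ² V(Q). The double symmetral of Q
lies in a symmetral of D and almost fills it, so D inherits its moment quotient and is nearly an
ellipse, without loss of generality a disc. Rectangles inscribed in the double symmetral now yield
parallelograms in Q whose diagonals are almost diameters in two prescribed directions. With one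
direction fixed, all their centres nearly coincide, because the midpoint of a nearly longest chord
of given direction is almost determined (`norm_midpoint_sub_le`). This step costs the square root
that turns ε into ε². The common centre is a near centre of symmetry of Q.

Finally, when K - p is close to its half-difference body D, the symmetrals of K and D are
comparable. As D is o-symmetric, the symmetrization along the first coordinate is superfluous for D,
so the moment quotient of D is visible in the symmetral. Hence D, and with it K, is nearly an
ellipsoid (`bmDist_le_of_center`). -/

/-! ### Steiner symmetrization in hyperplanes through the origin: convexity, compactness,
symmetries. -/

section SteinerSet

variable {n : ℕ}

/-- The orthogonal projection onto the hyperplane `u⊥`, for a unit vector `u`. -/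
noncomputable def hproj (u z : Eucl n) : Eucl n := z - ⟪u, z⟫ • u

/-- The reflection in the hyperplane `u⊥`, for a unit vector `u`. -/
noncomputable def hrefl (u z : Eucl n) : Eucl n := z - (2 * ⟪u, z⟫) • u

/-- The Steiner symmetral with respect to `u⊥`, described without reference to endpoints. -/
def steinerSet (u : Eucl n) (K : Set (Eucl n)) : Set (Eucl n) :=
  {z | ∃ s₁ s₂ : ℝ, hproj u z + s₁ • u ∈ K ∧ hproj u z + s₂ • u ∈ K ∧
    2 * |⟪u, z⟫| ≤ s₂ - s₁}

lemma inner_self_of_unit {u : Eucl n} (hu : ‖u‖ = 1) : ⟪u, u⟫ = 1 := by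
  rw [real_inner_self_eq_norm_sq, hu]; norm_num

lemma hproj_add (u x y : Eucl n) : hproj u (x + y) = hproj u x + hproj u y := by
  simp only [hproj, inner_add_right, add_smul]; abel

lemma hproj_smul (u : Eucl n) (c : ℝ) (x : Eucl n) : hproj u (c • x) = c • hproj u x := by
  simp only [hproj, inner_smul_right, smul_sub, smul_smul]

lemma continuous_hproj (u : Eucl n) : Continuous (hproj u) := by unfold hproj; fun_prop

lemma hproj_add_smul_self (u z : Eucl n) : hproj u z + ⟪u, z⟫ • u = z := by
  simp [hproj]

lemma inner_hproj_self {u : Eucl n} (hu : ‖u‖ = 1) (z : Eucl n) : ⟪u, hproj u z⟫ = 0 := by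
  simp [hproj, inner_sub_right, inner_smul_right, hu]

lemma hproj_of_inner_eq_zero {u y : Eucl n} (h : ⟪u, y⟫ = 0) : hproj u y = y := by
  simp [hproj, h]

lemma hproj_line {u y : Eucl n} (hu : ‖u‖ = 1) (h : ⟪u, y⟫ = 0) (t : ℝ) :
    hproj u (y + t • u) = y := by
  simp [hproj, inner_add_right, h, inner_smul_right, hu]

lemma inner_line {u y : Eucl n} (hu : ‖u‖ = 1) (h : ⟪u, y⟫ = 0) (t : ℝ) :
    ⟪u, y + t • u⟫ = t := by
  simp [inner_add_right, h, inner_smul_right, hu]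

lemma norm_sq_line {u y : Eucl n} (hu : ‖u‖ = 1) (h : ⟪u, y⟫ = 0) (t : ℝ) :
    ‖y + t • u‖ ^ 2 = ‖y‖ ^ 2 + t ^ 2 := by
  rw [norm_add_sq_real, inner_smul_right, real_inner_comm, h, norm_smul, hu]; simp

lemma mem_line_steinerSet {u y : Eucl n} (hu : ‖u‖ = 1) (h : ⟪u, y⟫ = 0) (t : ℝ)
    (K : Set (Eucl n)) : y + t • u ∈ steinerSet u K ↔
      ∃ s₁ s₂ : ℝ, y + s₁ • u ∈ K ∧ y + s₂ • u ∈ K ∧ 2 * |t| ≤ s₂ - s₁ := by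
  simp only [steinerSet, mem_ofPred_eq, hproj_line hu h, inner_line hu h]

lemma steinerSet_mono (u : Eucl n) {K L : Set (Eucl n)} (h : K ⊆ L) :
    steinerSet u K ⊆ steinerSet u L :=
  fun _ ⟨s₁, s₂, h₁, h₂, h₃⟩ => ⟨s₁, s₂, h h₁, h h₂, h₃⟩

lemma steinerSet_smul_subset (u : Eucl n) {c : ℝ} (hc : 0 < c) (K : Set (Eucl n)) :
    steinerSet u (c • K) ⊆ c • steinerSet u K := by
  rintro z ⟨s₁, s₂, h₁, h₂, h₃⟩
  rw [mem_smul_set_iff_inv_smul_mem₀ hc.ne'] at *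
  refine ⟨c⁻¹ * s₁, c⁻¹ * s₂, ?_, ?_, ?_⟩
  · simpa [hproj_smul, smul_add, smul_smul] using h₁
  · simpa [hproj_smul, smul_add, smul_smul] using h₂
  · rw [inner_smul_right, abs_mul, abs_of_pos (inv_pos.2 hc), ← mul_sub, mul_left_comm]
    gcongr

/-- Monotonicity and homogeneity combined: a sandwich between dilates about 0 survives
symmetrization. All stability arguments below rest on this, in place of continuity in the Hausdorff
metric. -/
lemma steinerSet_subset_smul (u : Eucl n) {c : ℝ} (hc : 0 < c) {K L : Set (Eucl n)}
    (h : K ⊆ c • L) : steinerSet u K ⊆ c • steinerSet u L :=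
  (steinerSet_mono u h).trans (steinerSet_smul_subset u hc L)

lemma Convex.steinerSet {K : Set (Eucl n)} (hK : Convex ℝ K) (u : Eucl n) :
    Convex ℝ (steinerSet u K) := by
  rintro x ⟨s₁, s₂, h₁, h₂, h₃⟩ y ⟨t₁, t₂, k₁, k₂, k₃⟩ a b ha hb hab
  refine ⟨a * s₁ + b * t₁, a * s₂ + b * t₂, ?_, ?_, ?_⟩
  · convert hK h₁ k₁ ha hb hab using 1
    rw [hproj_add, hproj_smul, hproj_smul]; module
  · convert hK h₂ k₂ ha hb hab using 1
    rw [hproj_add, hproj_smul, hproj_smul]; module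
  · rw [inner_add_right, inner_smul_right, inner_smul_right]
    calc 2 * |a * ⟪u, x⟫ + b * ⟪u, y⟫| ≤ 2 * (a * |⟪u, x⟫| + b * |⟪u, y⟫|) := by
          gcongr
          exact (abs_add_le _ _).trans (by simp [abs_mul, abs_of_nonneg ha, abs_of_nonneg hb])
      _ = a * (2 * |⟪u, x⟫|) + b * (2 * |⟪u, y⟫|) := by ring
      _ ≤ a * (s₂ - s₁) + b * (t₂ - t₁) := by gcongr
      _ = _ := by ring

/-- Parametrises the symmetral by two points of K on a common line and a relative position in [-1,
1]; as a continuous image of a compact set it is compact. -/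
lemma steinerSet_eq_image {u : Eucl n} (hu : ‖u‖ = 1) (K : Set (Eucl n)) :
    steinerSet u K = (fun p : (Eucl n × Eucl n) × ℝ =>
        hproj u p.1.1 + (p.2 * ⟪u, p.1.2 - p.1.1⟫ / 2) • u) ''
      (((K ×ˢ K) ∩ {p | hproj u p.1 = hproj u p.2}) ×ˢ Icc (-1 : ℝ) 1) := by
  ext z
  constructor
  · rintro ⟨s₁, s₂, h₁, h₂, h₃⟩
    have hz := inner_hproj_self hu z
    have hnn : 0 ≤ s₂ - s₁ := le_trans (by positivity) h₃
    have hle := abs_le.1 (by linarith : |⟪u, z⟫| ≤ (s₂ - s₁) / 2)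
    -- If s₁ = s₂ the quotient is 0 by convention, and the bound on ⟪u, z⟫ forces ⟪u, z⟫ = 0 as
    -- well.
    refine ⟨((hproj u z + s₁ • u, hproj u z + s₂ • u), 2 * ⟪u, z⟫ / (s₂ - s₁)),
      ⟨⟨⟨h₁, h₂⟩, ?_⟩, ?_⟩, ?_⟩
    · simp [hproj_line hu hz]
    · rcases hnn.eq_or_lt with h0 | h0
      · simp [← h0]
      · constructor
        · rw [le_div_iff₀ h0]; linarith
        · rw [div_le_iff₀ h0]; linarith
    · simp only [hproj_line hu hz, inner_sub_right, inner_line hu hz]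
      rcases hnn.eq_or_lt with h0 | h0
      · have : ⟪u, z⟫ = 0 := by linarith [hle.1, hle.2]
        simp [hproj, this]
      · rw [div_mul_cancel₀ _ h0.ne', mul_div_cancel_left₀ _ two_ne_zero, hproj_add_smul_self]
  · rintro ⟨⟨⟨x, y⟩, t⟩, ⟨⟨⟨hx, hy⟩, hxy⟩, ht⟩, rfl⟩
    simp only [mem_ofPred_eq] at hx hy hxy ht ⊢
    rw [mem_line_steinerSet hu (inner_hproj_self hu x)]
    have hx' := hproj_add_smul_self u x
    have hy' := hproj_add_smul_self u y
    rw [← hxy] at hy'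
    have habs : |t| ≤ 1 := abs_le.2 ht
    rcases le_total ⟪u, x⟫ ⟪u, y⟫ with h | h
    · refine ⟨⟪u, x⟫, ⟪u, y⟫, by rwa [hx'], by rwa [hy'], ?_⟩
      rw [inner_sub_right, abs_div, abs_mul, abs_of_nonneg (sub_nonneg.2 h), abs_two]
      nlinarith [sub_nonneg.2 h]
    · refine ⟨⟪u, y⟫, ⟪u, x⟫, by rwa [hy'], by rwa [hx'], ?_⟩
      rw [inner_sub_right, abs_div, abs_mul, abs_of_nonpos (sub_nonpos.2 h), abs_two]
      nlinarith [sub_nonneg.2 h]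

lemma IsCompact.steinerSet {K : Set (Eucl n)} (hK : IsCompact K) {u : Eucl n} (hu : ‖u‖ = 1) :
    IsCompact (steinerSet u K) := by
  rw [steinerSet_eq_image hu]
  refine IsCompact.image (IsCompact.prod ?_ isCompact_Icc) ?_
  · refine (hK.prod hK).inter_right (isClosed_eq ?_ ?_)
    · exact (continuous_hproj u).comp continuous_fst
    · exact (continuous_hproj u).comp continuous_snd
  · have := continuous_hproj u
    fun_prop

lemma hproj_mem_steinerSet {u : Eucl n} (hu : ‖u‖ = 1) {K : Set (Eucl n)} {x : Eucl n}
    (hx : x ∈ K) : hproj u x ∈ steinerSet u K := by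
  have hz := inner_hproj_self hu x
  refine ⟨⟪u, x⟫, ⟪u, x⟫, ?_, ?_, ?_⟩
  · rwa [hproj_of_inner_eq_zero hz, hproj_add_smul_self]
  · rwa [hproj_of_inner_eq_zero hz, hproj_add_smul_self]
  · simp [hz]

/-- The Steiner symmetral as a convex body. -/
def steinerBody (u : Eucl n) (hu : ‖u‖ = 1) (K : ConvexBody (Eucl n)) : ConvexBody (Eucl n) where
  carrier := steinerSet u K
  convex' := K.convex.steinerSet u
  isCompact' := K.isCompact.steinerSet hu
  nonempty' := K.nonempty.imp' _ fun _ hx => hproj_mem_steinerSet hu hx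

@[simp] lemma coe_steinerBody (u : Eucl n) (hu : ‖u‖ = 1) (K : ConvexBody (Eucl n)) :
    (steinerBody u hu K : Set (Eucl n)) = steinerSet u K := rfl

lemma convex_fiber {K : Set (Eucl n)} (hK : Convex ℝ K) (y u : Eucl n) :
    Convex ℝ {s : ℝ | y + s • u ∈ K} := by
  intro s hs t ht a b ha hb hab
  have := hK hs ht ha hb hab
  simp only [mem_ofPred_eq]
  convert this using 1
  calc y + (a • s + b • t) • u = (a + b) • y + (a * s + b * t) • u := by
        rw [hab, one_smul]; rfl
    _ = _ := by module

lemma fiber_eq_Icc (K : ConvexBody (Eucl n)) {u : Eucl n} (hu : ‖u‖ = 1) (y : Eucl n)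
    (h : {s : ℝ | y + s • u ∈ K}.Nonempty) :
    ∃ a b : ℝ, a ≤ b ∧ {s : ℝ | y + s • u ∈ K} = Icc a b := by
  set S := {s : ℝ | y + s • u ∈ K} with hS
  have hc : Convex ℝ S := convex_fiber K.convex y u
  have hcont : Continuous fun s : ℝ => y + s • u := by fun_prop
  have hcl : IsClosed S := K.isClosed.preimage hcont
  have hbd : Bornology.IsBounded S := by
    obtain ⟨R, hR⟩ := K.isBounded.exists_norm_le
    refine (Metric.isBounded_closedBall (x := (0 : ℝ)) (r := R + ‖y‖)).subset fun s hs => ?_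
    have h1 := hR _ hs
    have h2 : ‖s • u‖ ≤ ‖y + s • u‖ + ‖y‖ := by
      calc ‖s • u‖ = ‖(y + s • u) - y‖ := by simp
        _ ≤ _ := norm_sub_le _ _
    rw [norm_smul, hu, mul_one] at h2
    simp only [Metric.mem_closedBall, dist_zero_right]; linarith
  have hcomp : IsCompact S := Metric.isCompact_of_isClosed_isBounded hcl hbd
  have hconn : IsConnected S := ⟨h, hc.isPreconnected⟩
  have := eq_Icc_of_connected_compact hconn hcomp
  refine ⟨_, _, ?_, this⟩
  rw [this] at h
  exact nonempty_Icc.1 h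

lemma steinerSymmetral_eq (K : ConvexBody (Eucl n)) {u : Eucl n} (hu : ‖u‖ = 1) :
    steinerSymmetral u 0 (K : Set (Eucl n)) = steinerSet u K := by
  ext z
  constructor
  · rintro ⟨y, a, b, hy, hab, s, hs, rfl⟩
    rw [mem_line_steinerSet hu hy]
    have hle : a ≤ b := hs.1.trans hs.2
    refine ⟨a, b, ?_, ?_, ?_⟩
    · have : a ∈ {s : ℝ | y + s • u ∈ (K : Set (Eucl n))} := by rw [hab]; exact ⟨le_rfl, hle⟩
      exact this
    · have : b ∈ {s : ℝ | y + s • u ∈ (K : Set (Eucl n))} := by rw [hab]; exact ⟨hle, le_rfl⟩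
      exact this
    · have : |s - (a + b) / 2| ≤ (b - a) / 2 := abs_le.2 ⟨by linarith [hs.1], by linarith [hs.2]⟩
      linarith
  · rintro ⟨s₁, s₂, h₁, h₂, h₃⟩
    obtain ⟨a, b, hle, hab⟩ := fiber_eq_Icc K hu (hproj u z) ⟨s₁, h₁⟩
    refine ⟨hproj u z, a, b, inner_hproj_self hu z, hab, ⟪u, z⟫ + (a + b) / 2, ?_, ?_⟩
    · have m₁ : s₁ ∈ Icc a b := by rw [← hab]; exact h₁
      have m₂ : s₂ ∈ Icc a b := by rw [← hab]; exact h₂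
      have := abs_le.1 (by linarith [m₁.1, m₂.2] : |⟪u, z⟫| ≤ (b - a) / 2)
      exact ⟨by linarith [this.1], by linarith [this.2]⟩
    · rw [add_sub_cancel_right, hproj_add_smul_self]

lemma isSteinerStep_steinerBody (K : ConvexBody (Eucl n)) {u : Eucl n} (hu : ‖u‖ = 1) :
    IsSteinerStep K (steinerBody u hu K) :=
  ⟨u, 0, hu, (steinerSymmetral_eq K hu).symm⟩

lemma norm_sq_eq_hproj {u : Eucl n} (hu : ‖u‖ = 1) (z : Eucl n) :
    ‖z‖ ^ 2 = ‖hproj u z‖ ^ 2 + ⟪u, z⟫ ^ 2 := by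
  conv_lhs => rw [← hproj_add_smul_self u z]
  exact norm_sq_line hu (inner_hproj_self hu z) _

lemma closedBall_subset_steinerSet {u : Eucl n} (hu : ‖u‖ = 1) {r : ℝ} {K : Set (Eucl n)}
    (h : Metric.closedBall 0 r ⊆ K) : Metric.closedBall 0 r ⊆ steinerSet u K := by
  intro z hz
  rw [mem_closedBall_zero_iff] at hz
  have key : ∀ s : ℝ, s ^ 2 = ⟪u, z⟫ ^ 2 → hproj u z + s • u ∈ K := by
    intro s hs
    apply h
    rw [mem_closedBall_zero_iff]
    refine le_trans (le_of_eq ?_) hz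
    rw [← sq_eq_sq₀ (norm_nonneg _) (norm_nonneg _), norm_sq_line hu (inner_hproj_self hu z),
      hs, ← norm_sq_eq_hproj hu]
  exact ⟨-|⟪u, z⟫|, |⟪u, z⟫|, key _ (by simp), key _ (by simp), by linarith⟩

lemma steinerSet_subset_closedBall {u : Eucl n} (hu : ‖u‖ = 1) {r : ℝ} {K : Set (Eucl n)}
    (h : K ⊆ Metric.closedBall 0 r) : steinerSet u K ⊆ Metric.closedBall 0 r := by
  rintro z ⟨s₁, s₂, h₁, h₂, h₃⟩
  have k₁ := mem_closedBall_zero_iff.1 (h h₁)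
  have k₂ := mem_closedBall_zero_iff.1 (h h₂)
  have hr : 0 ≤ r := (norm_nonneg _).trans k₁
  have hz := inner_hproj_self hu z
  have q₁ := pow_le_pow_left₀ (norm_nonneg _) k₁ 2
  have q₂ := pow_le_pow_left₀ (norm_nonneg _) k₂ 2
  rw [norm_sq_line hu hz] at q₁ q₂
  rw [mem_closedBall_zero_iff]
  refine le_of_sq_le_sq ?_ hr
  rw [norm_sq_eq_hproj hu, ← sq_abs ⟪u, z⟫]
  have hnn := abs_nonneg ⟪u, z⟫
  -- From 2|⟪u, z⟫| ≤ s₂ - s₁ follows ⟪u, z⟫² ≤ (s₁² + s₂²)/2, so the average of `q₁` and `q₂`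
  -- suffices.
  nlinarith [sq_nonneg (s₁ + s₂), mul_self_nonneg (s₂ - s₁ - 2 * |⟪u, z⟫|)]

lemma inner_hrefl_self {u : Eucl n} (hu : ‖u‖ = 1) (z : Eucl n) : ⟪u, hrefl u z⟫ = -⟪u, z⟫ := by
  simp only [hrefl, inner_sub_right, inner_smul_right, inner_self_of_unit hu]; ring

lemma hproj_hrefl_self {u : Eucl n} (hu : ‖u‖ = 1) (z : Eucl n) :
    hproj u (hrefl u z) = hproj u z := by
  rw [hproj, inner_hrefl_self hu, hrefl, hproj]; module

lemma hrefl_mem_steinerSet {u : Eucl n} (hu : ‖u‖ = 1) {K : Set (Eucl n)} {z : Eucl n}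
    (hz : z ∈ steinerSet u K) : hrefl u z ∈ steinerSet u K := by
  obtain ⟨s₁, s₂, h₁, h₂, h₃⟩ := hz
  refine ⟨s₁, s₂, ?_, ?_, ?_⟩
  · rwa [hproj_hrefl_self hu]
  · rwa [hproj_hrefl_self hu]
  · rwa [inner_hrefl_self hu, abs_neg]

/-- Linear maps that fix `u` and preserve the functional `⟪u, ·⟫` commute with symmetrization. -/
lemma map_mem_steinerSet {u : Eucl n} {K : Set (Eucl n)} (f : Eucl n → Eucl n)
    (hf : ∀ z (s : ℝ), f (hproj u z + s • u) = hproj u (f z) + s • u)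
    (hfu : ∀ z, ⟪u, f z⟫ = ⟪u, z⟫) (hK : ∀ z ∈ K, f z ∈ K) :
    ∀ z ∈ steinerSet u K, f z ∈ steinerSet u K := by
  rintro z ⟨s₁, s₂, h₁, h₂, h₃⟩
  exact ⟨s₁, s₂, hf z s₁ ▸ hK _ h₁, hf z s₂ ▸ hK _ h₂, by rwa [hfu]⟩

lemma hrefl_mem_steinerSet_of_orthogonal {u v : Eucl n} (huv : ⟪u, v⟫ = 0) {K : Set (Eucl n)}
    (hK : ∀ z ∈ K, hrefl v z ∈ K) : ∀ z ∈ steinerSet u K, hrefl v z ∈ steinerSet u K := by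
  refine map_mem_steinerSet _ (fun z s => ?_) (fun z => ?_) hK
  · simp only [hrefl, hproj, inner_add_right, inner_sub_right, inner_smul_right, huv,
      real_inner_comm u v ▸ huv]
    simp; module
  · simp [hrefl, inner_sub_right, inner_smul_right, huv]

lemma neg_mem_steinerSet {u : Eucl n} {K : Set (Eucl n)} (hK : ∀ z ∈ K, -z ∈ K) :
    ∀ z ∈ steinerSet u K, -z ∈ steinerSet u K := by
  rintro z ⟨s₁, s₂, h₁, h₂, h₃⟩
  refine ⟨-s₂, -s₁, ?_, ?_, ?_⟩
  · convert hK _ h₂ using 1; simp only [hproj, inner_neg_right]; module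
  · convert hK _ h₁ using 1; simp only [hproj, inner_neg_right]; module
  · rw [inner_neg_right, abs_neg]; linarith

lemma line_mem_of_convex {K : Set (Eucl n)} (hK : Convex ℝ K) {y u : Eucl n} {s t r : ℝ}
    (hs : y + s • u ∈ K) (ht : y + t • u ∈ K) (hr : r ∈ Icc s t)   : y + r • u ∈ K :=
  (convex_fiber hK y u).ordConnected.out hs ht hr

lemma steinerSet_eq_self {u : Eucl n} (hu : ‖u‖ = 1) {K : Set (Eucl n)} (hK : Convex ℝ K)
    (h : ∀ z ∈ K, hrefl u z ∈ K) : steinerSet u K = K := by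
  have refl : ∀ z (s : ℝ), hproj u z + s • u ∈ K → hproj u z + (-s) • u ∈ K := by
    intro z s hs
    have := h _ hs
    have hz := inner_hproj_self hu z
    rw [hrefl, inner_line hu hz] at this
    convert this using 1; module
  refine Subset.antisymm ?_ ?_
  · rintro z ⟨s₁, s₂, h₁, h₂, h₃⟩
    rw [← hproj_add_smul_self u z]
    -- By the reflection symmetry one of the two endpoints spans, with its mirror image, a centred
    -- chord of length at least s₂ - s₁.
    rcases le_total (-s₁) s₂ with hc | hc
    · refine line_mem_of_convex hK (refl _ _ h₂) h₂ (abs_le.1 ?_); linarith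
    · refine line_mem_of_convex hK h₁ (refl _ _ h₁) ?_
      have := abs_le.1 (by linarith : |⟪u, z⟫| ≤ -s₁)
      exact ⟨by linarith [this.1], this.2⟩
  · intro z hz
    have h0 : hproj u z + ⟪u, z⟫ • u ∈ K := by rwa [hproj_add_smul_self]
    rcases le_total 0 ⟪u, z⟫ with hc | hc
    · refine ⟨-⟪u, z⟫, ⟪u, z⟫, refl _ _ h0, h0, ?_⟩
      rw [abs_of_nonneg hc]; linarith
    · refine ⟨⟪u, z⟫, -⟪u, z⟫, h0, refl _ _ h0, ?_⟩
      rw [abs_of_nonpos hc]; linarith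

lemma exists_mem_steinerSet_inner_eq {u v : Eucl n} (hu : ‖u‖ = 1) (huv : ⟪u, v⟫ = 0)
    {K : Set (Eucl n)} {x : Eucl n} (hx : x ∈ K) : ∃ z ∈ steinerSet u K, ⟪v, z⟫ = ⟪v, x⟫ := by
  refine ⟨hproj u x, hproj_mem_steinerSet hu hx, ?_⟩
  simp [hproj, inner_sub_right, inner_smul_right, real_inner_comm u v ▸ huv]

lemma exists_mem_inner_eq_of_mem_steinerSet {u v : Eucl n} (huv : ⟪u, v⟫ = 0)
    {K : Set (Eucl n)} {z : Eucl n} (hz : z ∈ steinerSet u K) : ∃ x ∈ K, ⟪v, x⟫ = ⟪v, z⟫ := by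
  obtain ⟨s₁, s₂, h₁, h₂, h₃⟩ := hz
  refine ⟨_, h₁, ?_⟩
  simp [hproj, inner_add_right, inner_sub_right, inner_smul_right, real_inner_comm u v ▸ huv]

end SteinerSet

/-! ### Fubini along lines: what symmetrization does to volume and moments. -/

section SteinerMeasure

open MeasureTheory
open scoped ENNReal

variable {n : ℕ}

/-- The orthogonal splitting into ℝu and its complement is an isometry, so Lebesgue measure is the
product of the two; chords can be treated one at a time. -/
lemma measurePreserving_line {u : Eucl n} (hu : ‖u‖ = 1) :
    MeasurePreserving (fun p : ((ℝ ∙ u)ᗮ : Submodule ℝ (Eucl n)) × ℝ => (p.1 : Eucl n) + p.2 • u)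
      (volume.prod volume) volume := by
  have h0 := (LinearIsometryEquiv.toSpanUnitSingleton u hu).measurePreserving
  have h1 := h0.prod
    (MeasurePreserving.id (volume : Measure ((ℝ ∙ u)ᗮ : Submodule ℝ (Eucl n))))
  have h2 := WithLp.volume_preserving_toLp (ℝ ∙ u : Submodule ℝ (Eucl n)) (ℝ ∙ u)ᗮ
  have h3 := (ℝ ∙ u : Submodule ℝ (Eucl n)).orthogonalDecomposition.symm.measurePreserving
  have h4 := (h3.comp (h2.comp h1)).comp (Measure.measurePreserving_swap
    (μ := (volume : Measure ((ℝ ∙ u)ᗮ : Submodule ℝ (Eucl n)))) (ν := (volume : Measure ℝ)))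
  have h5 : (fun p : ((ℝ ∙ u)ᗮ : Submodule ℝ (Eucl n)) × ℝ => (p.1 : Eucl n) + p.2 • u) =
      (((ℝ ∙ u : Submodule ℝ (Eucl n)).orthogonalDecomposition.symm ∘ WithLp.toLp 2 ∘
        Prod.map (LinearIsometryEquiv.toSpanUnitSingleton u hu) id) ∘ Prod.swap) := by
    funext p
    simp [Submodule.orthogonalDecomposition_symm_apply, add_comm]
  rw [h5]
  exact h4

lemma lintegral_line {u : Eucl n} (hu : ‖u‖ = 1) {f : Eucl n → ℝ≥0∞} (hf : Measurable f) :
    ∫⁻ x, f x = ∫⁻ y : ((ℝ ∙ u)ᗮ : Submodule ℝ (Eucl n)), ∫⁻ t : ℝ, f ((y : Eucl n) + t • u) := by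
  rw [← (measurePreserving_line hu).lintegral_comp hf, lintegral_prod]
  exact (hf.comp (measurePreserving_line hu).measurable).aemeasurable

lemma inner_orthogonal_eq_zero {u : Eucl n} (y : ((ℝ ∙ u)ᗮ : Submodule ℝ (Eucl n))) :
    ⟪u, (y : Eucl n)⟫ = 0 :=
  Submodule.mem_orthogonal_singleton_iff_inner_right.1 y.2

lemma volume_line {u : Eucl n} (hu : ‖u‖ = 1) {s : Set (Eucl n)} (hs : MeasurableSet s) :
    volume s = ∫⁻ y : ((ℝ ∙ u)ᗮ : Submodule ℝ (Eucl n)),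
      volume {t : ℝ | (y : Eucl n) + t • u ∈ s} := by
  rw [← lintegral_indicator_one hs, lintegral_line hu (measurable_one.indicator hs)]
  refine lintegral_congr fun y => ?_
  have hm : MeasurableSet {t : ℝ | (y : Eucl n) + t • u ∈ s} :=
    hs.preimage (by fun_prop : Measurable fun t : ℝ => (y : Eucl n) + t • u)
  rw [← lintegral_indicator_one hm]
  rfl

lemma fiber_steinerSet {u : Eucl n} (hu : ‖u‖ = 1) {y : Eucl n} (hy : ⟪u, y⟫ = 0)
    {K : Set (Eucl n)} {a b : ℝ} (hle : a ≤ b) (hab : {s : ℝ | y + s • u ∈ K} = Icc a b) :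
    {s : ℝ | y + s • u ∈ steinerSet u K} = Icc (-((b - a) / 2)) ((b - a) / 2) := by
  ext t
  have hK : ∀ s, y + s • u ∈ K ↔ s ∈ Icc a b := fun s => by rw [← hab]; rfl
  simp only [mem_ofPred_eq, mem_line_steinerSet hu hy, hK]
  constructor
  · rintro ⟨s₁, s₂, h₁, h₂, h₃⟩
    exact abs_le.1 (by linarith [h₁.1, h₂.2])
  · intro h
    exact ⟨a, b, ⟨le_rfl, hle⟩, ⟨hle, le_rfl⟩, by linarith [abs_le.2 h]⟩

lemma fiber_steinerSet_of_empty {u : Eucl n} (hu : ‖u‖ = 1) {y : Eucl n} (hy : ⟪u, y⟫ = 0)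
    {K : Set (Eucl n)} (hab : {s : ℝ | y + s • u ∈ K} = ∅) :
    {s : ℝ | y + s • u ∈ steinerSet u K} = ∅ := by
  ext t
  simp only [mem_ofPred_eq, mem_line_steinerSet hu hy, mem_empty_iff_false, iff_false]
  rintro ⟨s₁, s₂, h₁, h₂, h₃⟩
  have : s₁ ∈ {s : ℝ | y + s • u ∈ K} := h₁
  rw [hab] at this
  exact this

/-- Corresponding chords of the body and of its symmetral have equal length, so both bodies cast the
same measure on the hyperplane. This contains the invariance of volume and of moments orthogonal to
u. -/
lemma map_hproj_restrict_steinerBody {u : Eucl n} (hu : ‖u‖ = 1) (K : ConvexBody (Eucl n)) :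
    Measure.map (hproj u) (volume.restrict (steinerSet u K)) =
      Measure.map (hproj u) (volume.restrict (K : Set (Eucl n))) := by
  have hm := (continuous_hproj u).measurable
  have hK := K.isCompact.measurableSet
  have hS := (K.isCompact.steinerSet hu).measurableSet
  ext s hs
  rw [Measure.map_apply hm hs, Measure.map_apply hm hs, Measure.restrict_apply (hm hs),
    Measure.restrict_apply (hm hs), volume_line hu ((hm hs).inter hS),
    volume_line hu ((hm hs).inter hK)]
  refine lintegral_congr fun y => ?_
  have hy := inner_orthogonal_eq_zero y
  simp only [mem_inter_iff, mem_preimage, hproj_line hu hy]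
  by_cases hys : (y : Eucl n) ∈ s
  · simp only [hys, true_and]
    rcases {s : ℝ | (y : Eucl n) + s • u ∈ K}.eq_empty_or_nonempty with h | h
    · rw [fiber_steinerSet_of_empty hu hy h]
      exact congrArg _ h.symm
    · obtain ⟨a, b, hle, hab⟩ := fiber_eq_Icc K hu y h
      rw [fiber_steinerSet hu hy hle hab]
      have h2 : {s : ℝ | (y : Eucl n) + s • u ∈ (K : Set (Eucl n))} = Icc a b := hab
      rw [h2, Real.volume_Icc, Real.volume_Icc]
      congr 1; ring
  · simp [hys]

/-- Integrals of functions that are constant along `u` do not change under symmetrization. -/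
lemma setIntegral_steinerBody {u : Eucl n} (hu : ‖u‖ = 1) (K : ConvexBody (Eucl n))
    {φ : Eucl n → ℝ} (hφ : Continuous φ) (h : ∀ x, φ (hproj u x) = φ x) :
    ∫ x in steinerSet u K, φ x = ∫ x in (K : Set (Eucl n)), φ x := by
  have key : ∀ S : Set (Eucl n), ∫ x in S, φ x =
      ∫ y, φ y ∂(Measure.map (hproj u) (volume.restrict S)) := by
    intro S
    rw [integral_map (continuous_hproj u).aemeasurable hφ.aestronglyMeasurable]
    simp only [h]
  rw [key, key, map_hproj_restrict_steinerBody hu K]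

/-- Centring the interval lowers the integral by exactly (b - a)(a + b)²/4, which vanishes only for
a degenerate or an already centred interval. -/
lemma lintegral_Icc_sq_le {a b c : ℝ} (hab : a ≤ b) (hc : 0 ≤ c) :
    ∫⁻ t in Icc (-((b - a) / 2)) ((b - a) / 2), ENNReal.ofReal (c + t ^ 2) ≤
      ∫⁻ t in Icc a b, ENNReal.ofReal (c + t ^ 2) ∧
    (∫⁻ t in Icc (-((b - a) / 2)) ((b - a) / 2), ENNReal.ofReal (c + t ^ 2) =
      ∫⁻ t in Icc a b, ENNReal.ofReal (c + t ^ 2) → a = b ∨ a = -b) := by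
  have key : ∀ a b : ℝ, a ≤ b → ∫⁻ t in Icc a b, ENNReal.ofReal (c + t ^ 2) =
      ENNReal.ofReal (c * (b - a) + (b ^ 3 - a ^ 3) / 3) := by
    intro a b hab
    rw [← ofReal_integral_eq_lintegral_ofReal]
    · rw [integral_Icc_eq_integral_Ioc, ← intervalIntegral.integral_of_le hab,
        intervalIntegral.integral_add (by simp) (by simp)]
      simp; congr 1; ring
    · exact (by fun_prop : Continuous fun t : ℝ => c + t ^ 2).continuousOn.integrableOn_Icc
    · exact ae_of_all _ fun t => by positivity
  have h1 : -((b - a) / 2) ≤ (b - a) / 2 := by linarith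
  rw [key _ _ h1, key _ _ hab]
  have hd : (c * (b - a) + (b ^ 3 - a ^ 3) / 3) - (c * ((b - a) / 2 - -((b - a) / 2)) +
      (((b - a) / 2) ^ 3 - (-((b - a) / 2)) ^ 3) / 3) = (b - a) * (a + b) ^ 2 / 4 := by ring
  have hnn : 0 ≤ (b - a) * (a + b) ^ 2 / 4 := by
    have := sub_nonneg.2 hab; positivity
  have hnn2 : 0 ≤ c * ((b - a) / 2 - -((b - a) / 2)) +
      (((b - a) / 2) ^ 3 - (-((b - a) / 2)) ^ 3) / 3 := by
    have h0 := sub_nonneg.2 hab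
    have : (((b - a) / 2) ^ 3 - (-((b - a) / 2)) ^ 3) / 3 = (b - a) ^ 3 / 12 := by ring
    
    have h2 : c * ((b - a) / 2 - -((b - a) / 2)) = c * (b - a) := by ring
    rw [this, h2]; positivity
  refine ⟨ENNReal.ofReal_le_ofReal (by linarith), fun h => ?_⟩
  rw [ENNReal.ofReal_eq_ofReal_iff hnn2 (by linarith)] at h
  have h0 : (b - a) * (a + b) ^ 2 = 0 := by linarith
  rcases mul_eq_zero.1 h0 with h0 | h0
  · left; linarith
  · right; have := pow_eq_zero_iff (two_ne_zero) |>.1 h0; linarith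

lemma lintegral_norm_sq_line {u : Eucl n} (hu : ‖u‖ = 1) {S : Set (Eucl n)}
    (hS : MeasurableSet S) :
    ∫⁻ x in S, ENNReal.ofReal (‖x‖ ^ 2) = ∫⁻ y : ((ℝ ∙ u)ᗮ : Submodule ℝ (Eucl n)),
      ∫⁻ t in {t : ℝ | (y : Eucl n) + t • u ∈ S}, ENNReal.ofReal (‖(y : Eucl n)‖ ^ 2 + t ^ 2) := by
  have hmeas : Measurable fun x : Eucl n => ENNReal.ofReal (‖x‖ ^ 2) := by fun_prop
  rw [← lintegral_indicator hS, lintegral_line hu (hmeas.indicator hS)]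
  refine lintegral_congr fun y => ?_
  have hm : MeasurableSet {t : ℝ | (y : Eucl n) + t • u ∈ S} :=
    hS.preimage (by fun_prop : Measurable fun t : ℝ => (y : Eucl n) + t • u)
  rw [← lintegral_indicator hm]
  refine lintegral_congr fun t => ?_
  simp only [indicator, mem_ofPred_eq]
  rw [norm_sq_line hu (inner_orthogonal_eq_zero y)]

/-- The one-dimensional comparison is integrated over all chords. In the equality case almost every
chord was centred or a point, so body and symmetral differ by a null set. -/
lemma lintegral_norm_sq_steinerBody {u : Eucl n} (hu : ‖u‖ = 1) (K : ConvexBody (Eucl n)) :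
    ∫⁻ x in steinerSet u K, ENNReal.ofReal (‖x‖ ^ 2) ≤
      ∫⁻ x in (K : Set (Eucl n)), ENNReal.ofReal (‖x‖ ^ 2) ∧
    (∫⁻ x in steinerSet u K, ENNReal.ofReal (‖x‖ ^ 2) =
      ∫⁻ x in (K : Set (Eucl n)), ENNReal.ofReal (‖x‖ ^ 2) →
      volume ((K : Set (Eucl n)) \ steinerSet u K) = 0 ∧
      volume (steinerSet u K \ (K : Set (Eucl n))) = 0) := by
  have hK := K.isCompact.measurableSet
  have hS := (K.isCompact.steinerSet hu).measurableSet
  have hfin : ∫⁻ x in steinerSet u K, ENNReal.ofReal (‖x‖ ^ 2) ≠ ∞ :=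
    ((by fun_prop : Continuous fun x : Eucl n => ‖x‖ ^ 2).continuousOn.integrableOn_compact
      (K.isCompact.steinerSet hu)).lintegral_lt_top.ne
  rw [lintegral_norm_sq_line hu hK] at *
  rw [lintegral_norm_sq_line hu hS] at *
  have hmeas : Measurable fun y : ((ℝ ∙ u)ᗮ : Submodule ℝ (Eucl n)) =>
      ∫⁻ t in {t : ℝ | (y : Eucl n) + t • u ∈ (K : Set (Eucl n))},
        ENNReal.ofReal (‖(y : Eucl n)‖ ^ 2 + t ^ 2) := by
    have hm2 : Measurable fun p : ((ℝ ∙ u)ᗮ : Submodule ℝ (Eucl n)) × ℝ =>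
        (K : Set (Eucl n)).indicator (fun x => ENNReal.ofReal (‖x‖ ^ 2))
          ((p.1 : Eucl n) + p.2 • u) :=
      (Measurable.indicator (by fun_prop) hK).comp (by fun_prop)
    convert hm2.lintegral_prod_right' (ν := (volume : Measure ℝ)) using 2 with y
    have hm : MeasurableSet {t : ℝ | (y : Eucl n) + t • u ∈ (K : Set (Eucl n))} :=
      hK.preimage (by fun_prop : Measurable fun t : ℝ => (y : Eucl n) + t • u)
    rw [← lintegral_indicator hm]
    refine lintegral_congr fun t => ?_
    simp only [indicator, mem_ofPred_eq]
    rw [norm_sq_line hu (inner_orthogonal_eq_zero y)]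
  have hle : ∀ y : ((ℝ ∙ u)ᗮ : Submodule ℝ (Eucl n)),
      ∫⁻ t in {t : ℝ | (y : Eucl n) + t • u ∈ steinerSet u K},
        ENNReal.ofReal (‖(y : Eucl n)‖ ^ 2 + t ^ 2) ≤
      ∫⁻ t in {t : ℝ | (y : Eucl n) + t • u ∈ (K : Set (Eucl n))},
        ENNReal.ofReal (‖(y : Eucl n)‖ ^ 2 + t ^ 2) := by
    intro y
    have hy := inner_orthogonal_eq_zero y
    rcases {s : ℝ | (y : Eucl n) + s • u ∈ K}.eq_empty_or_nonempty with h | h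
    · rw [fiber_steinerSet_of_empty hu hy h]; simp
    · obtain ⟨a, b, hle, hab⟩ := fiber_eq_Icc K hu y h
      rw [fiber_steinerSet hu hy hle hab]
      have h2 : {s : ℝ | (y : Eucl n) + s • u ∈ (K : Set (Eucl n))} = Icc a b := hab
      rw [h2]
      exact (lintegral_Icc_sq_le hle (by positivity)).1
  refine ⟨lintegral_mono hle, fun heq => ?_⟩
  -- Pointwise comparable functions with equal finite integrals agree almost everywhere, so the
  -- equality case applies to almost every chord.
  have hae := ae_eq_of_ae_le_of_lintegral_le (ae_of_all _ hle) hfin hmeas.aemeasurable heq.ge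
  have key : ∀ᵐ y : ((ℝ ∙ u)ᗮ : Submodule ℝ (Eucl n)),
      volume {t : ℝ | (y : Eucl n) + t • u ∈ (K : Set (Eucl n)) \ steinerSet u K} = 0 ∧
      volume {t : ℝ | (y : Eucl n) + t • u ∈ steinerSet u K \ (K : Set (Eucl n))} = 0 := by
    filter_upwards [hae] with y hyeq
    have hy := inner_orthogonal_eq_zero y
    have e1 : {t : ℝ | (y : Eucl n) + t • u ∈ (K : Set (Eucl n)) \ steinerSet u K} =
      {t : ℝ | (y : Eucl n) + t • u ∈ (K : Set (Eucl n))} \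
        {t : ℝ | (y : Eucl n) + t • u ∈ steinerSet u K} := rfl
    have e2 : {t : ℝ | (y : Eucl n) + t • u ∈ steinerSet u K \ (K : Set (Eucl n))} =
      {t : ℝ | (y : Eucl n) + t • u ∈ steinerSet u K} \
        {t : ℝ | (y : Eucl n) + t • u ∈ (K : Set (Eucl n))} := rfl
    rw [e1, e2]
    rcases {s : ℝ | (y : Eucl n) + s • u ∈ K}.eq_empty_or_nonempty with h | h
    · have h2 : {s : ℝ | (y : Eucl n) + s • u ∈ (K : Set (Eucl n))} = ∅ := h
      rw [fiber_steinerSet_of_empty hu hy h, h2]; simp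
    · obtain ⟨a, b, hle, hab⟩ := fiber_eq_Icc K hu y h
      have h2 : {s : ℝ | (y : Eucl n) + s • u ∈ (K : Set (Eucl n))} = Icc a b := hab
      rw [fiber_steinerSet hu hy hle hab, h2] at hyeq ⊢
      rcases (lintegral_Icc_sq_le hle (by positivity)).2 hyeq with h | h
      · subst h
        constructor
        · exact measure_mono_null sdiff_subset (by simp)
        · exact measure_mono_null sdiff_subset (by simp)
      · subst h
        have : (b - -b) / 2 = b := by ring
        simp
  constructor
  · rw [volume_line hu (hK.diff hS)]
    exact (lintegral_congr_ae (key.mono fun y hy => hy.1)).trans lintegral_zero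
  · rw [volume_line hu (hS.diff hK)]
    exact (lintegral_congr_ae (key.mono fun y hy => hy.2)).trans lintegral_zero

end SteinerMeasure

/-! ### Comparison of bodies by dilates, Hausdorff convergence and Blaschke selection. -/

section Sandwich

open MeasureTheory

variable {n : ℕ}

lemma ConvexBody.integrableOn (K : ConvexBody (Eucl n)) {φ : Eucl n → ℝ} (hφ : Continuous φ) :
    IntegrableOn φ (K : Set (Eucl n)) :=
  hφ.continuousOn.integrableOn_compact K.isCompact

lemma setIntegral_smul_set {φ : Eucl n → ℝ} {d : ℕ}
    (hd : ∀ (c : ℝ) (x : Eucl n), φ (c • x) = c ^ d * φ x) {c : ℝ} (hc : 0 < c)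
    (S : Set (Eucl n)) : ∫ x in c • S, φ x = c ^ (n + d) * ∫ x in S, φ x := by
  have h := Measure.setIntegral_comp_smul_of_pos (volume : Measure (Eucl n)) φ S hc
  simp only [hd, finrank_euclideanSpace, Fintype.card_fin, smul_eq_mul] at h
  rw [integral_const_mul] at h
  have hne : c ^ n ≠ 0 := pow_ne_zero _ hc.ne'
  rw [pow_add, mul_assoc, h]
  field_simp

lemma setIntegral_le_of_subset_smul {φ : Eucl n → ℝ} (hφ : Continuous φ) (h0 : ∀ x, 0 ≤ φ x)
    {d : ℕ} (hd : ∀ (c : ℝ) (x : Eucl n), φ (c • x) = c ^ d * φ x) {c : ℝ} (hc : 0 < c)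
    {K L : ConvexBody (Eucl n)} (h : (K : Set (Eucl n)) ⊆ c • (L : Set (Eucl n))) :
    ∫ x in (K : Set (Eucl n)), φ x ≤ c ^ (n + d) * ∫ x in (L : Set (Eucl n)), φ x := by
  rw [← setIntegral_smul_set hd hc]
  exact setIntegral_mono_set ((c • L : ConvexBody (Eucl n)).integrableOn hφ)
    (ae_of_all _ fun x => h0 x) (LE.le.eventuallyLE h)

lemma setIntegral_mono_body {φ : Eucl n → ℝ} (hφ : Continuous φ) (h0 : ∀ x, 0 ≤ φ x)
    {K L : ConvexBody (Eucl n)} (h : (K : Set (Eucl n)) ⊆ L) :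
    ∫ x in (K : Set (Eucl n)), φ x ≤ ∫ x in (L : Set (Eucl n)), φ x :=
  setIntegral_mono_set (L.integrableOn hφ) (ae_of_all _ fun x => h0 x)
    (LE.le.eventuallyLE h)

lemma setIntegral_norm_sq_steinerBody_le {u : Eucl n} (hu : ‖u‖ = 1) (K : ConvexBody (Eucl n)) :
    ∫ x in steinerSet u K, ‖x‖ ^ 2 ≤ ∫ x in (K : Set (Eucl n)), ‖x‖ ^ 2 := by
  have hc : Continuous fun x : Eucl n => ‖x‖ ^ 2 := by fun_prop
  rw [integral_eq_lintegral_of_nonneg_ae (ae_of_all _ fun x => by positivity)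
    hc.aestronglyMeasurable, integral_eq_lintegral_of_nonneg_ae
    (ae_of_all _ fun x => by positivity) hc.aestronglyMeasurable]
  exact ENNReal.toReal_mono (K.integrableOn hc).lintegral_lt_top.ne
    (lintegral_norm_sq_steinerBody hu K).1

/-- A null difference contains no non-empty open set, so the interior of K lies in the closed set S,
and K is the closure of its interior. -/
lemma subset_of_volume_diff_eq_zero {K : ConvexBody (Eucl n)}
    (hK : (interior (K : Set (Eucl n))).Nonempty) {S : Set (Eucl n)} (hS : IsClosed S)
    (h : volume ((K : Set (Eucl n)) \ S) = 0) : (K : Set (Eucl n)) ⊆ S := by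
  have h1 : interior (K : Set (Eucl n)) \ S = ∅ := by
    refine (IsOpen.measure_eq_zero_iff volume (isOpen_interior.sdiff hS)).1 ?_
    exact measure_mono_null (sdiff_subset_sdiff_left interior_subset) h
  have h2 : interior (K : Set (Eucl n)) ⊆ S := sdiff_eq_empty.1 h1
  calc (K : Set (Eucl n)) ⊆ closure (interior (K : Set (Eucl n))) := by
        rw [K.convex.closure_interior_eq_closure_of_nonempty_interior hK]; exact subset_closure
    _ ⊆ S := closure_minimal h2 hS

lemma steinerSet_eq_of_integral_eq {u : Eucl n} (hu : ‖u‖ = 1) {K : ConvexBody (Eucl n)}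
    {r : ℝ} (hr : 0 < r) (hrK : Metric.closedBall 0 r ⊆ (K : Set (Eucl n)))
    (h : ∫ x in steinerSet u K, ‖x‖ ^ 2 = ∫ x in (K : Set (Eucl n)), ‖x‖ ^ 2) :
    steinerSet u K = (K : Set (Eucl n)) := by
  have hc : Continuous fun x : Eucl n => ‖x‖ ^ 2 := by fun_prop
  have hfin : ∫⁻ x in steinerSet u K, ENNReal.ofReal (‖x‖ ^ 2) ≠ ⊤ :=
    ((steinerBody u hu K).integrableOn hc).lintegral_lt_top.ne
  rw [integral_eq_lintegral_of_nonneg_ae (ae_of_all _ fun x => by positivity)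
    hc.aestronglyMeasurable, integral_eq_lintegral_of_nonneg_ae
    (ae_of_all _ fun x => by positivity) hc.aestronglyMeasurable,
    ENNReal.toReal_eq_toReal_iff' hfin (K.integrableOn hc).lintegral_lt_top.ne] at h
  have hint : ∀ {S : Set (Eucl n)}, Metric.closedBall 0 r ⊆ S → (interior S).Nonempty := by
    intro S hS
    refine ⟨0, interior_mono hS ?_⟩
    exact interior_mono Metric.ball_subset_closedBall
      (by rw [Metric.isOpen_ball.interior_eq]; exact Metric.mem_ball_self hr)
  obtain ⟨h1, h2⟩ := (lintegral_norm_sq_steinerBody hu K).2 h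
  refine Subset.antisymm ?_ ?_
  · exact subset_of_volume_diff_eq_zero (K := steinerBody u hu K)
      (hint (closedBall_subset_steinerSet hu hrK)) K.isClosed h2
  · exact subset_of_volume_diff_eq_zero (hint hrK) (steinerBody u hu K).isClosed h1

/-- The error vector has norm below δr, hence lies in δC, and C + δC = (1 + δ)C by convexity. This
turns Hausdorff closeness into a sandwich. -/
lemma mem_smul_of_dist_lt {K C : ConvexBody (Eucl n)} {r δ : ℝ} (hδ : 0 < δ)
    (hC : Metric.closedBall 0 r ⊆ (C : Set (Eucl n))) (h : dist K C < δ * r) :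
    (K : Set (Eucl n)) ⊆ (1 + δ) • (C : Set (Eucl n)) := by
  intro x hx
  obtain ⟨y, hy, hxy⟩ := Metric.exists_dist_lt_of_hausdorffDist_lt hx
    (by exact h) ConvexBody.hausdorffEDist_ne_top
  rw [C.convex.add_smul zero_le_one hδ.le, one_smul]
  refine ⟨y, hy, x - y, ⟨δ⁻¹ • (x - y), hC ?_, by simp [smul_smul, hδ.ne']⟩, by simp⟩
  rw [mem_closedBall_zero_iff, norm_smul, norm_inv, Real.norm_of_nonneg hδ.le,
    inv_mul_le_iff₀ hδ, ← dist_eq_norm]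
  exact hxy.le

lemma dist_le_of_subset_smul {K C : ConvexBody (Eucl n)} {R δ : ℝ} (hδ : 0 ≤ δ)
    (hKR : (K : Set (Eucl n)) ⊆ Metric.closedBall 0 R)
    (hCR : (C : Set (Eucl n)) ⊆ Metric.closedBall 0 R)
    (hKC : (K : Set (Eucl n)) ⊆ (1 + δ) • (C : Set (Eucl n)))
    (hCK : (C : Set (Eucl n)) ⊆ (1 + δ) • (K : Set (Eucl n))) : dist K C ≤ δ * R := by
  have hR : 0 ≤ R := by
    obtain ⟨x, hx⟩ := K.nonempty
    exact (norm_nonneg x).trans (mem_closedBall_zero_iff.1 (hKR hx))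
  have key : ∀ y ∈ Metric.closedBall (0 : Eucl n) R, dist ((1 + δ) • y) y ≤ δ * R := by
    intro y hy
    rw [dist_eq_norm, add_smul, one_smul, add_sub_cancel_left, norm_smul, Real.norm_of_nonneg hδ]
    exact mul_le_mul_of_nonneg_left (mem_closedBall_zero_iff.1 hy) hδ
  refine Metric.hausdorffDist_le_of_mem_dist (by positivity) ?_ ?_
  · intro x hx
    obtain ⟨y, hy, rfl⟩ := hKC hx
    exact ⟨y, hy, key y (hCR hy)⟩
  · intro x hx
    obtain ⟨y, hy, rfl⟩ := hCK hx
    exact ⟨y, hy, key y (hKR hy)⟩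

lemma closure_mem_of_forall_dist {C : ConvexBody (Eucl n)} {x : Eucl n}
    (h : ∀ ε > 0, ∃ y ∈ C, dist x y < ε) : x ∈ C := by
  have : x ∈ closure (C : Set (Eucl n)) := Metric.mem_closure_iff.2 h
  rwa [C.isClosed.closure_eq] at this

/-- Blaschke's selection theorem. -/
lemma exists_subseq_tendsto {R : ℝ} (S : ℕ → ConvexBody (Eucl n))
    (hS : ∀ m, (S m : Set (Eucl n)) ⊆ Metric.closedBall 0 R) :
    ∃ (C : ConvexBody (Eucl n)) (φ : ℕ → ℕ), StrictMono φ ∧ Tendsto (S ∘ φ) atTop (𝓝 C) := by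
  let N : ℕ → TopologicalSpace.NonemptyCompacts (Eucl n) :=
    fun m => ⟨⟨S m, (S m).isCompact⟩, (S m).nonempty⟩
  have hcomp := TopologicalSpace.NonemptyCompacts.isCompact_subsets_of_isCompact
    (isCompact_closedBall (0 : Eucl n) R)
  obtain ⟨L, hL, φ, hφ, hlim⟩ := hcomp.tendsto_subseq (x := N) (fun m => hS m)
  have hd : ∀ ε > 0, ∃ m, Metric.hausdorffDist (S (φ m) : Set (Eucl n)) L < ε := by
    intro ε hε
    obtain ⟨m, hm⟩ := (Metric.tendsto_atTop.1 hlim ε hε)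
    exact ⟨m, hm m le_rfl⟩
  have hne : ∀ m, Metric.hausdorffEDist (S m : Set (Eucl n)) L ≠ ⊤ := fun m =>
    Metric.hausdorffEDist_ne_top_of_nonempty_of_bounded (S m).nonempty L.nonempty
      (S m).isBounded L.isCompact.isBounded
  have hconv : Convex ℝ (L : Set (Eucl n)) := by
    intro x hx y hy a b ha hb hab
    have : a • x + b • y ∈ closure (L : Set (Eucl n)) := by
      refine Metric.mem_closure_iff.2 fun ε hε => ?_
      obtain ⟨m, hm⟩ := hd (ε / 2) (by positivity)
      obtain ⟨x', hx', hxx⟩ := Metric.exists_dist_lt_of_hausdorffDist_lt' hx hm (hne _)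
      obtain ⟨y', hy', hyy⟩ := Metric.exists_dist_lt_of_hausdorffDist_lt' hy hm (hne _)
      obtain ⟨z, hz, hzz⟩ := Metric.exists_dist_lt_of_hausdorffDist_lt
        ((S (φ m)).convex hx' hy' ha hb hab) hm (hne _)
      refine ⟨z, hz, ?_⟩
      have h1 : dist (a • x + b • y) (a • x' + b • y') ≤ ε / 2 := by
        rw [dist_comm] at hxx hyy
        rw [dist_eq_norm] at hxx hyy ⊢
        calc ‖a • x + b • y - (a • x' + b • y')‖ = ‖a • (x - x') + b • (y - y')‖ := by
              congr 1; module
          _ ≤ a * ‖x - x'‖ + b * ‖y - y'‖ := by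
              refine (norm_add_le _ _).trans ?_
              rw [norm_smul, norm_smul, Real.norm_of_nonneg ha, Real.norm_of_nonneg hb]
          _ ≤ a * (ε / 2) + b * (ε / 2) := by
              rw [norm_sub_rev x, norm_sub_rev y]; rw [norm_sub_rev] at hxx hyy; gcongr
          _ = ε / 2 := by rw [← add_mul, hab, one_mul]
      linarith [dist_triangle (a • x + b • y) (a • x' + b • y') z]
    rwa [L.isCompact.isClosed.closure_eq] at this
  refine ⟨⟨L, hconv, L.isCompact, L.nonempty⟩, φ, hφ, ?_⟩
  rw [Metric.tendsto_atTop] at hlim ⊢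
  exact hlim

lemma mem_of_tendsto_bodies {S : ℕ → ConvexBody (Eucl n)} {C : ConvexBody (Eucl n)}
    (h : Tendsto S atTop (𝓝 C)) {x : Eucl n} (hx : ∀ m, x ∈ S m) : x ∈ C := by
  refine closure_mem_of_forall_dist fun ε hε => ?_
  obtain ⟨m, hm⟩ := Metric.tendsto_atTop.1 h ε hε
  exact Metric.exists_dist_lt_of_hausdorffDist_lt (hx m) (hm m le_rfl)
    ConvexBody.hausdorffEDist_ne_top

lemma subset_of_tendsto_bodies {S : ℕ → ConvexBody (Eucl n)} {C : ConvexBody (Eucl n)}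
    (h : Tendsto S atTop (𝓝 C)) {F : Set (Eucl n)} (hF : IsClosed F)
    (hS : ∀ m, (S m : Set (Eucl n)) ⊆ F) : (C : Set (Eucl n)) ⊆ F := by
  intro x hx
  rw [← hF.closure_eq]
  refine Metric.mem_closure_iff.2 fun ε hε => ?_
  obtain ⟨m, hm⟩ := Metric.tendsto_atTop.1 h ε hε
  obtain ⟨y, hy, hyx⟩ := Metric.exists_dist_lt_of_hausdorffDist_lt' hx (hm m le_rfl)
    ConvexBody.hausdorffEDist_ne_top
  exact ⟨y, hS m hy, by rwa [dist_comm]⟩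

lemma eventually_subset_smul {S : ℕ → ConvexBody (Eucl n)} {C : ConvexBody (Eucl n)}
    (h : Tendsto S atTop (𝓝 C)) {r : ℝ} (hr : 0 < r)
    (hS : ∀ m, Metric.closedBall 0 r ⊆ (S m : Set (Eucl n))) {δ : ℝ} (hδ : 0 < δ) :
    ∀ᶠ m in atTop, (S m : Set (Eucl n)) ⊆ (1 + δ) • (C : Set (Eucl n)) ∧
      (C : Set (Eucl n)) ⊆ (1 + δ) • (S m : Set (Eucl n)) := by
  have hC : Metric.closedBall 0 r ⊆ (C : Set (Eucl n)) := fun x hx =>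
    mem_of_tendsto_bodies h fun m => hS m hx
  filter_upwards [Metric.tendsto_nhds.1 h (δ * r) (by positivity)] with m hm
  exact ⟨mem_smul_of_dist_lt hδ hC hm, mem_smul_of_dist_lt hδ (hS m) (by rwa [dist_comm])⟩

lemma le_of_forall_one_add_pow_mul {a b : ℝ} {k : ℕ}
    (h : ∀ δ > 0, a ≤ (1 + δ) ^ k * b) : a ≤ b := by
  have hlim : Tendsto (fun δ : ℝ => (1 + δ) ^ k * b) (𝓝[>] 0) (𝓝 b) := by
    have : Continuous fun δ : ℝ => (1 + δ) ^ k * b := by fun_prop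
    have h2 := this.tendsto 0
    simp only [add_zero, one_pow, one_mul] at h2
    exact h2.mono_left nhdsWithin_le_nhds
  refine ge_of_tendsto hlim ?_
  filter_upwards [self_mem_nhdsWithin] with δ hδ using h δ hδ

lemma setIntegral_eq_of_tendsto {S : ℕ → ConvexBody (Eucl n)} {C : ConvexBody (Eucl n)}
    (h : Tendsto S atTop (𝓝 C)) {r : ℝ} (hr : 0 < r)
    (hS : ∀ m, Metric.closedBall 0 r ⊆ (S m : Set (Eucl n)))
    {φ : Eucl n → ℝ} (hφ : Continuous φ) (h0 : ∀ x, 0 ≤ φ x) {d : ℕ}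
    (hd : ∀ (c : ℝ) (x : Eucl n), φ (c • x) = c ^ d * φ x) {a : ℝ}
    (ha : ∀ m, ∫ x in (S m : Set (Eucl n)), φ x = a) : ∫ x in (C : Set (Eucl n)), φ x = a := by
  refine le_antisymm ?_ ?_
  · refine le_of_forall_one_add_pow_mul (k := n + d) fun δ hδ => ?_
    obtain ⟨m, -, hm⟩ := (eventually_subset_smul h hr hS hδ).exists
    rw [← ha m]
    exact setIntegral_le_of_subset_smul hφ h0 hd (by linarith) hm
  · refine le_of_forall_one_add_pow_mul (k := n + d) fun δ hδ => ?_
    obtain ⟨m, hm, -⟩ := (eventually_subset_smul h hr hS hδ).exists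
    rw [← ha m]
    exact setIntegral_le_of_subset_smul hφ h0 hd (by linarith) hm

end Sandwich

/-! ### Convergence of greedy successive symmetrizations. -/

section SymmetrizationLimit

open MeasureTheory

variable {n : ℕ}

/-- Half of the supremum of the possible decreases is always reached by some direction, so no
compactness of W and no continuity in the direction are needed. -/
lemma exists_almost_optimal_symmetrization {W : Set (Eucl n)} (hne : W.Nonempty)
    (hW : ∀ v ∈ W, ‖v‖ = 1) (K : ConvexBody (Eucl n)) :
    ∃ v ∈ W, ∀ w ∈ W, (∫ x in (K : Set (Eucl n)), ‖x‖ ^ 2) - ∫ x in steinerSet w K, ‖x‖ ^ 2 ≤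
      2 * ((∫ x in (K : Set (Eucl n)), ‖x‖ ^ 2) - ∫ x in steinerSet v K, ‖x‖ ^ 2) := by
  set f : Eucl n → ℝ := fun w =>
    (∫ x in (K : Set (Eucl n)), ‖x‖ ^ 2) - ∫ x in steinerSet w K, ‖x‖ ^ 2 with hf
  have hbdd : BddAbove (f '' W) := by
    refine ⟨∫ x in (K : Set (Eucl n)), ‖x‖ ^ 2, ?_⟩
    rintro _ ⟨w, -, rfl⟩
    have : 0 ≤ ∫ x in steinerSet w K, ‖x‖ ^ 2 := integral_nonneg fun x => by positivity
    simp only [hf]; linarith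
  have hnn : ∀ w ∈ W, 0 ≤ f w := fun w hw =>
    sub_nonneg.2 (setIntegral_norm_sq_steinerBody_le (hW w hw) K)
  have hle : ∀ w ∈ W, f w ≤ sSup (f '' W) := fun w hw => le_csSup hbdd ⟨w, hw, rfl⟩
  obtain ⟨w₀, hw₀⟩ := hne
  rcases ((hnn w₀ hw₀).trans (hle w₀ hw₀)).eq_or_lt with h | h
  · refine ⟨w₀, hw₀, fun w hw => ?_⟩
    have h1 := hle w hw
    have h2 := hnn w₀ hw₀
    change f w ≤ 2 * f w₀
    linarith
  · obtain ⟨_, ⟨v, hv, rfl⟩, hlt⟩ := exists_lt_of_lt_csSup (s := f '' W) ⟨_, w₀, hw₀, rfl⟩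
      (half_lt_self h)
    refine ⟨v, hv, fun w hw => ?_⟩
    have h1 := hle w hw
    change f w ≤ 2 * f v
    linarith

/-- Every body containing a ball around the origin can be transformed by successive Steiner
symmetrizations with directions in `W` into a limit body symmetric with respect to all of them. -/
theorem exists_symmetrization_limit {W : Set (Eucl n)} (hne : W.Nonempty)
    (hW : ∀ v ∈ W, ‖v‖ = 1) (K : ConvexBody (Eucl n)) {r : ℝ} (hr : 0 < r)
    (hrK : Metric.closedBall 0 r ⊆ (K : Set (Eucl n))) :
    ∃ (S : ℕ → ConvexBody (Eucl n)) (C : ConvexBody (Eucl n)), S 0 = K ∧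
      (∀ m, ∃ v ∈ W, (S (m + 1) : Set (Eucl n)) = steinerSet v (S m)) ∧
      (∀ m, Metric.closedBall 0 r ⊆ (S m : Set (Eucl n))) ∧
      Tendsto S atTop (𝓝 C) ∧ ∀ v ∈ W, ∀ z ∈ C, hrefl v z ∈ C := by
  choose v hvW hv using exists_almost_optimal_symmetrization hne hW
  let next : ConvexBody (Eucl n) → ConvexBody (Eucl n) :=
    fun L => steinerBody (v L) (hW _ (hvW L)) L
  let S : ℕ → ConvexBody (Eucl n) := fun m => next^[m] K
  have hS : ∀ m, (S (m + 1) : Set (Eucl n)) = steinerSet (v (S m)) (S m) := by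
    intro m
    simp only [S, Function.iterate_succ_apply']
    rfl
  have hrS : ∀ m, Metric.closedBall 0 r ⊆ (S m : Set (Eucl n)) := by
    intro m
    induction m with
    | zero => exact hrK
    | succ m ih => rw [hS]; exact closedBall_subset_steinerSet (hW _ (hvW _)) ih
  obtain ⟨R, hR⟩ := K.isBounded.subset_closedBall 0
  have hRS : ∀ m, (S m : Set (Eucl n)) ⊆ Metric.closedBall 0 R := by
    intro m
    induction m with
    | zero => exact hR
    | succ m ih => rw [hS]; exact steinerSet_subset_closedBall (hW _ (hvW _)) ih
  obtain ⟨C, φ, hφ, hlim⟩ := exists_subseq_tendsto S hRS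
  have hrC : Metric.closedBall 0 r ⊆ (C : Set (Eucl n)) := fun x hx =>
    mem_of_tendsto_bodies hlim fun m => hrS _ hx
  have hRC : (C : Set (Eucl n)) ⊆ Metric.closedBall 0 R :=
    subset_of_tendsto_bodies hlim Metric.isClosed_closedBall fun m => hRS _
  have hcont : Continuous fun x : Eucl n => ‖x‖ ^ 2 := by fun_prop
  have hhom : ∀ (c : ℝ) (x : Eucl n), ‖c • x‖ ^ 2 = c ^ 2 * ‖x‖ ^ 2 := by
    intro c x; rw [norm_smul, mul_pow, Real.norm_eq_abs, sq_abs]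
  set Ψ : Set (Eucl n) → ℝ := fun L => ∫ x in L, ‖x‖ ^ 2 with hΨ
  have hscale : ∀ {δ : ℝ} {L M : ConvexBody (Eucl n)}, 0 < δ →
      (L : Set (Eucl n)) ⊆ (1 + δ) • (M : Set (Eucl n)) → Ψ L ≤ (1 + δ) ^ (n + 2) * Ψ M :=
    fun hδ h => setIntegral_le_of_subset_smul hcont (fun x => by positivity) hhom (by linarith) h
  have hanti : Antitone fun m => Ψ (S m) := by
    refine antitone_nat_of_succ_le fun m => ?_
    simp only [hΨ, hS]
    exact setIntegral_norm_sq_steinerBody_le (hW _ (hvW _)) _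
  have hΨnn : ∀ L, 0 ≤ Ψ L := fun L => integral_nonneg fun x => by positivity
  obtain ⟨ℓ, hℓ⟩ : ∃ ℓ, Tendsto (fun m => Ψ (S m)) atTop (𝓝 ℓ) :=
    ⟨_, tendsto_atTop_ciInf hanti ⟨0, by rintro _ ⟨m, rfl⟩; exact hΨnn _⟩⟩
  have hdrop : Tendsto (fun m => 2 * (Ψ (S m) - Ψ (S (m + 1)))) atTop (𝓝 0) := by
    have := (hℓ.sub (hℓ.comp (tendsto_add_atTop_nat 1))).const_mul 2
    simpa using this
  have hsymm : ∀ w ∈ W, steinerSet w C = (C : Set (Eucl n)) := by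
    intro w hw
    refine steinerSet_eq_of_integral_eq (hW w hw) hr hrC (le_antisymm
      (setIntegral_norm_sq_steinerBody_le (hW w hw) C) ?_)
    change Ψ C ≤ Ψ (steinerSet w C)
    have hlimC : Tendsto (fun m => Ψ (S (φ m)) - 2 * (Ψ (S (φ m)) - Ψ (S (φ m + 1)))) atTop
        (𝓝 (ℓ - 0)) := (hℓ.sub hdrop).comp hφ.tendsto_atTop
    rw [sub_zero] at hlimC
    have h1 : Ψ C ≤ ℓ := by
      refine le_of_forall_one_add_pow_mul (k := n + 2) fun δ hδ => ?_
      refine ge_of_tendsto ((hℓ.comp hφ.tendsto_atTop).const_mul ((1 + δ) ^ (n + 2))) ?_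
      filter_upwards [eventually_subset_smul hlim hr (fun m => hrS _) hδ] with m hm
      exact hscale hδ hm.2
    -- Along the sequence the decreases tend to 0, and by the greedy choice no `w` would have
    -- decreased the integral by more than twice the actual amount. Passing to the limit,
    -- symmetrizing C along `w` does not decrease its integral either.
    refine h1.trans (le_of_forall_one_add_pow_mul (k := n + 2) fun δ hδ => ?_)
    refine le_of_tendsto hlimC ?_
    filter_upwards [eventually_subset_smul hlim hr (fun m => hrS _) hδ] with m hm
    have h2 : Ψ (steinerSet w (S (φ m))) ≤ (1 + δ) ^ (n + 2) * Ψ (steinerSet w C) :=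
      hscale (L := steinerBody w (hW w hw) (S (φ m))) (M := steinerBody w (hW w hw) C) hδ
        (steinerSet_subset_smul w (by linarith) hm.1)
    have h3 := hv (S (φ m)) w hw
    rw [← hS] at h3
    change Ψ (S (φ m)) - Ψ (steinerSet w (S (φ m))) ≤
      2 * (Ψ (S (φ m)) - Ψ (S (φ m + 1))) at h3
    linarith
  refine ⟨S, C, rfl, fun m => ⟨_, hvW _, hS m⟩, hrS, ?_, ?_⟩
  · rw [Metric.tendsto_atTop]
    intro ε hε
    have hR0 : 0 ≤ R := by
      obtain ⟨x, hx⟩ := C.nonempty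
      exact (norm_nonneg x).trans (mem_closedBall_zero_iff.1 (hRC hx))
    have hδ : 0 < ε / (R + 1) := by positivity
    obtain ⟨m₀, hm₀⟩ := (eventually_subset_smul hlim hr (fun m => hrS _) hδ).exists
    refine ⟨φ m₀, fun m hm => ?_⟩
    -- One index of the subsequence controls all later terms: C is fixed by every symmetrization
    -- used, so its sandwich with `S m` is inherited by `S (m + 1)`. Thus the whole sequence
    -- converges.
    have hsand : (S m : Set (Eucl n)) ⊆ (1 + ε / (R + 1)) • (C : Set (Eucl n)) ∧
        (C : Set (Eucl n)) ⊆ (1 + ε / (R + 1)) • (S m : Set (Eucl n)) := by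
      induction m, hm using Nat.le_induction with
      | base => exact hm₀
      | succ m _ ih =>
        rw [hS]
        have hc : 0 < 1 + ε / (R + 1) := by linarith
        constructor
        · have := steinerSet_subset_smul (v (S m)) hc ih.1
          rwa [hsymm _ (hvW _)] at this
        · have := steinerSet_subset_smul (v (S m)) hc ih.2
          rwa [hsymm _ (hvW _)] at this
    refine (dist_le_of_subset_smul hδ.le (hRS m) hRC hsand.1 hsand.2).trans_lt ?_
    rw [div_mul_eq_mul_div, div_lt_iff₀ (by positivity)]
    nlinarith
  · intro w hw z hz
    have hz' : z ∈ steinerSet w C := by rw [hsymm w hw]; exact hz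
    have := hrefl_mem_steinerSet (hW w hw) hz'
    rw [hsymm w hw] at this
    exact this

lemma hrefl_eq_of_norm_eq {x y : Eucl n} (h : ‖x‖ = ‖y‖) (hxy : x ≠ y) :
    hrefl (‖x - y‖⁻¹ • (x - y)) x = y := by
  have hne : ‖x - y‖ ≠ 0 := norm_ne_zero_iff.2 (sub_ne_zero.2 hxy)
  have h1 : 2 * ⟪x - y, x⟫ = ‖x - y‖ ^ 2 := by
    rw [norm_sub_sq_real, inner_sub_left, real_inner_self_eq_norm_sq, h, real_inner_comm]; ring
  rw [hrefl, inner_smul_left, smul_smul]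
  have : 2 * ((starRingEnd ℝ) ‖x - y‖⁻¹ * ⟪x - y, x⟫) * ‖x - y‖⁻¹ = 1 := by
    simp only [conj_trivial]
    calc _ = (2 * ⟪x - y, x⟫) * (‖x - y‖⁻¹ * ‖x - y‖⁻¹) := by ring
      _ = 1 := by rw [h1]; field_simp
  rw [this]; simp

/-- No generation of the isometry group by reflections is needed: for each single x the reflection
along x - g x maps x to g x, and x - g x ⊥ u because g fixes u. -/
lemma axialSymmetric_of_hrefl {u : Eucl n} (hu : ‖u‖ = 1) {C : Set (Eucl n)}
    (h : ∀ v : Eucl n, ‖v‖ = 1 → ⟪u, v⟫ = 0 → ∀ z ∈ C, hrefl v z ∈ C) : AxialSymmetric C := by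
  have key : ∀ g : Eucl n ≃ₗᵢ[ℝ] Eucl n, g u = u → ∀ x ∈ C, g x ∈ C := by
    intro g hg x hx
    by_cases hxg : x = g x
    · rwa [← hxg]
    · rw [← hrefl_eq_of_norm_eq (g.norm_map x).symm hxg]
      have hne : ‖x - g x‖ ≠ 0 := norm_ne_zero_iff.2 (sub_ne_zero.2 hxg)
      refine h _ ?_ ?_ x hx
      · rw [norm_smul, norm_inv, norm_norm, inv_mul_cancel₀ hne]
      · rw [inner_smul_right, inner_sub_right]
        conv_lhs => rw [← hg, g.inner_map_map, hg]
        simp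
  refine ⟨u, hu, fun g hg => Subset.antisymm ?_ ?_⟩
  · rintro _ ⟨x, hx, rfl⟩; exact key g hg x hx
  · intro x hx
    refine ⟨g.symm x, key g.symm ?_ x hx, g.apply_symm_apply x⟩
    rw [LinearIsometryEquiv.symm_apply_eq, hg]

lemma IsSteinerAffineLimit.of_step {K L C : ConvexBody (Eucl n)}
    (h : IsSteinerStep K L ∨ IsAffineStep K L) (hC : IsSteinerAffineLimit L C) :
    IsSteinerAffineLimit K C := by
  obtain ⟨S, h0, hstep, hlim⟩ := hC
  refine ⟨fun m => Nat.casesOn m K S, rfl, ?_, ?_⟩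
  · rintro (_ | m)
    · simpa [h0] using h
    · exact hstep m
  · rw [← tendsto_add_atTop_iff_nat 1]
    exact hlim

end SymmetrizationLimit

/-! ### Support functions of convex bodies. -/

section SupportFunction

variable {n : ℕ}

/-- The support function of a set. -/
noncomputable def suppFn (K : Set (Eucl n)) (u : Eucl n) : ℝ := sSup ((fun x => ⟪u, x⟫) '' K)

lemma inner_le_suppFn (K : ConvexBody (Eucl n)) (u : Eucl n) {x : Eucl n} (hx : x ∈ K) :
    ⟪u, x⟫ ≤ suppFn K u := by
  refine le_csSup ?_ ⟨x, hx, rfl⟩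
  exact (K.isCompact.image (by fun_prop : Continuous fun x : Eucl n => ⟪u, x⟫)).bddAbove

lemma exists_inner_eq_suppFn (K : ConvexBody (Eucl n)) (u : Eucl n) :
    ∃ x ∈ K, ⟪u, x⟫ = suppFn K u := by
  obtain ⟨x, hx, h⟩ := (K.isCompact.image
    (by fun_prop : Continuous fun x : Eucl n => ⟪u, x⟫)).sSup_mem (K.nonempty.image _)
  exact ⟨x, hx, h⟩

lemma suppFn_le (K : ConvexBody (Eucl n)) {u : Eucl n} {c : ℝ} (h : ∀ x ∈ K, ⟪u, x⟫ ≤ c) :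
    suppFn K u ≤ c := by
  obtain ⟨x, hx, hxu⟩ := exists_inner_eq_suppFn K u
  rw [← hxu]; exact h x hx

lemma suppFn_mono {K L : ConvexBody (Eucl n)} (h : (K : Set (Eucl n)) ⊆ L) (u : Eucl n) :
    suppFn K u ≤ suppFn L u :=
  suppFn_le K fun _ hx => inner_le_suppFn L u (h hx)

lemma suppFn_le_of_subset_smul {K L : ConvexBody (Eucl n)} {c : ℝ} (hc : 0 ≤ c)
    (h : (K : Set (Eucl n)) ⊆ c • (L : Set (Eucl n))) (u : Eucl n) :
    suppFn K u ≤ c * suppFn L u := by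
  refine suppFn_le K fun x hx => ?_
  obtain ⟨y, hy, rfl⟩ := h hx
  simp only [inner_smul_right]
  exact mul_le_mul_of_nonneg_left (inner_le_suppFn L u hy) hc

/-- A point outside K is strictly separated from it by a functional, which is represented by a
vector u. -/
lemma mem_of_forall_inner_le (K : ConvexBody (Eucl n)) {x : Eucl n}
    (h : ∀ u, ⟪u, x⟫ ≤ suppFn K u) : x ∈ K := by
  by_contra hx
  obtain ⟨f, s, hf, hs⟩ := geometric_hahn_banach_closed_point K.convex K.isClosed hx
  set u := (InnerProductSpace.toDual ℝ (Eucl n)).symm f with hu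
  have hfu : ∀ y, f y = ⟪u, y⟫ := fun y => by
    rw [hu, InnerProductSpace.toDual_symm_apply]
  obtain ⟨y, hy, hyu⟩ := exists_inner_eq_suppFn K u
  have h1 := hf y hy
  have h2 := h u
  rw [hfu] at h1 hs
  linarith

lemma le_suppFn_of_closedBall_subset {K : ConvexBody (Eucl n)} {r : ℝ} (hr : 0 ≤ r)
    (h : Metric.closedBall 0 r ⊆ (K : Set (Eucl n))) (u : Eucl n) : r * ‖u‖ ≤ suppFn K u := by
  rcases eq_or_ne u 0 with rfl | hu
  · have : (0 : Eucl n) ∈ K := h (by simpa using hr)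
    simpa using inner_le_suppFn K 0 this
  · have hn : 0 < ‖u‖ := norm_pos_iff.2 hu
    have : (r / ‖u‖) • u ∈ K := h (by
      rw [mem_closedBall_zero_iff, norm_smul, norm_div, norm_norm, Real.norm_of_nonneg hr,
        div_mul_cancel₀ _ hn.ne'])
    refine le_trans (le_of_eq ?_) (inner_le_suppFn K u this)
    rw [inner_smul_right, real_inner_self_eq_norm_sq]; field_simp

lemma suppFn_le_of_subset_closedBall {K : ConvexBody (Eucl n)} {R : ℝ}
    (h : (K : Set (Eucl n)) ⊆ Metric.closedBall 0 R) (u : Eucl n) : suppFn K u ≤ R * ‖u‖ := by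
  refine suppFn_le K fun x hx => (real_inner_le_norm _ _).trans ?_
  rw [mul_comm]
  exact mul_le_mul_of_nonneg_right (mem_closedBall_zero_iff.1 (h hx)) (norm_nonneg _)

lemma suppFn_nonneg {K : ConvexBody (Eucl n)} (h : (0 : Eucl n) ∈ K) (u : Eucl n) :
    0 ≤ suppFn K u := by
  simpa using inner_le_suppFn K u h

lemma suppFn_smul (K : ConvexBody (Eucl n)) {c : ℝ} (hc : 0 ≤ c) (u : Eucl n) :
    suppFn K (c • u) = c * suppFn K u := by
  refine le_antisymm (suppFn_le K fun x hx => ?_) ?_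
  · rw [inner_smul_left]
    exact mul_le_mul_of_nonneg_left (inner_le_suppFn K u hx) hc
  · obtain ⟨x, hx, h⟩ := exists_inner_eq_suppFn K u
    rw [← h]
    have := inner_le_suppFn K (c • u) hx
    rwa [inner_smul_left] at this

lemma suppFn_steinerBody {u v : Eucl n} (hu : ‖u‖ = 1) (huv : ⟪u, v⟫ = 0)
    (K : ConvexBody (Eucl n)) : suppFn (steinerSet u K) v = suppFn K v := by
  refine le_antisymm ?_ ?_
  · refine suppFn_le (steinerBody u hu K) fun z hz => ?_
    obtain ⟨x, hx, h⟩ := exists_mem_inner_eq_of_mem_steinerSet huv hz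
    rw [← h]; exact inner_le_suppFn K v hx
  · refine suppFn_le K fun x hx => ?_
    obtain ⟨z, hz, h⟩ := exists_mem_steinerSet_inner_eq hu huv hx
    rw [← h]; exact inner_le_suppFn (steinerBody u hu K) v hz

lemma suppFn_eq_of_tendsto {S : ℕ → ConvexBody (Eucl n)} {C : ConvexBody (Eucl n)}
    (h : Tendsto S atTop (𝓝 C)) {r : ℝ} (hr : 0 < r)
    (hS : ∀ m, Metric.closedBall 0 r ⊆ (S m : Set (Eucl n))) {u : Eucl n} {a : ℝ}
    (ha : ∀ m, suppFn (S m) u = a) : suppFn C u = a := by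
  refine le_antisymm ?_ ?_
  · refine le_of_forall_one_add_pow_mul (k := 1) fun δ hδ => ?_
    obtain ⟨m, -, hm⟩ := (eventually_subset_smul h hr hS hδ).exists
    rw [← ha m, pow_one]
    exact suppFn_le_of_subset_smul (by linarith) hm u
  · refine le_of_forall_one_add_pow_mul (k := 1) fun δ hδ => ?_
    obtain ⟨m, hm, -⟩ := (eventually_subset_smul h hr hS hδ).exists
    rw [← ha m, pow_one]
    exact suppFn_le_of_subset_smul (by linarith) hm u

end SupportFunction

/-! ### Linear images, second moments, and the moment identity for ellipsoids. -/

section Ellipsoid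

open MeasureTheory

variable {n : ℕ}

lemma setIntegral_linearEquiv_image (T : Eucl n ≃ₗ[ℝ] Eucl n) {S : Set (Eucl n)}
    (hS : MeasurableSet S) (φ : Eucl n → ℝ) :
    ∫ x in T '' S, φ x = |LinearMap.det (T : Eucl n →ₗ[ℝ] Eucl n)| * ∫ x in S, φ (T x) := by
  have h := integral_image_eq_integral_abs_det_fderiv_smul (volume : Measure (Eucl n)) hS
    (f' := fun _ => (T.toContinuousLinearEquiv : Eucl n →L[ℝ] Eucl n)) (f := T)
    (fun x _ => T.toContinuousLinearEquiv.hasFDerivAt.hasFDerivWithinAt) T.injective.injOn φ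
  rw [h]
  simp only [smul_eq_mul]
  rw [integral_const_mul]
  rfl

lemma linearEquiv_det_pos (T : Eucl n ≃ₗ[ℝ] Eucl n) :
    0 < |LinearMap.det (T : Eucl n →ₗ[ℝ] Eucl n)| :=
  abs_pos.2 (LinearEquiv.isUnit_det' T).ne_zero

/-- The image of a convex body under a linear map. -/
noncomputable def linearImage {m : ℕ} (T : Eucl n →ₗ[ℝ] Eucl m) (K : ConvexBody (Eucl n)) :
    ConvexBody (Eucl m) where
  carrier := T '' K
  convex' := K.convex.linear_image T
  isCompact' := K.isCompact.image T.continuous_of_finiteDimensional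
  nonempty' := K.nonempty.image T

@[simp] lemma coe_linearImage {m : ℕ} (T : Eucl n →ₗ[ℝ] Eucl m) (K : ConvexBody (Eucl n)) :
    (linearImage T K : Set (Eucl m)) = T '' (K : Set (Eucl n)) := rfl

/-- The translate `K - c` of a convex body. -/
noncomputable def translateBody (c : Eucl n) (K : ConvexBody (Eucl n)) : ConvexBody (Eucl n) where
  carrier := (fun z => z - c) '' K
  convex' := by
    simpa only [sub_eq_add_neg, add_comm (-c)] using K.convex.translate (-c)
  isCompact' := K.isCompact.image (by fun_prop)
  nonempty' := K.nonempty.image _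

@[simp] lemma coe_translateBody (c : Eucl n) (K : ConvexBody (Eucl n)) :
    (translateBody c K : Set (Eucl n)) = (fun z => z - c) '' (K : Set (Eucl n)) := rfl

lemma suppFn_translateBody (c : Eucl n) (K : ConvexBody (Eucl n)) (u : Eucl n) :
    suppFn (translateBody c K) u = suppFn K u - ⟪u, c⟫ := by
  refine le_antisymm (suppFn_le _ ?_) ?_
  · rintro _ ⟨x, hx, rfl⟩
    rw [inner_sub_right]; linarith [inner_le_suppFn K u hx]
  · obtain ⟨x, hx, h⟩ := exists_inner_eq_suppFn K u
    have := inner_le_suppFn (translateBody c K) u ⟨x, hx, rfl⟩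
    rw [inner_sub_right] at this; linarith

lemma suppFn_linearImage {m : ℕ} (T : Eucl n →ₗ[ℝ] Eucl m) (K : ConvexBody (Eucl n)) {u : Eucl m}
    {v : Eucl n} (h : ∀ x, ⟪u, T x⟫ = ⟪v, x⟫) : suppFn (linearImage T K) u = suppFn K v := by
  refine le_antisymm (suppFn_le _ ?_) (suppFn_le _ fun x hx => ?_)
  · rintro _ ⟨x, hx, rfl⟩
    rw [h]; exact inner_le_suppFn K v hx
  · rw [← h]; exact inner_le_suppFn (linearImage T K) u ⟨x, hx, rfl⟩

/-- The unit ball as a convex body. -/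
noncomputable def ballBody (n : ℕ) : ConvexBody (Eucl n) where
  carrier := Metric.closedBall 0 1
  convex' := convex_closedBall 0 1
  isCompact' := isCompact_closedBall 0 1
  nonempty' := ⟨0, by simp⟩

@[simp] lemma coe_ballBody : (ballBody n : Set (Eucl n)) = Metric.closedBall 0 1 := rfl

lemma suppFn_ballBody (u : Eucl n) : suppFn (ballBody n) u = ‖u‖ :=
  le_antisymm (by simpa using suppFn_le_of_subset_closedBall (K := ballBody n) subset_rfl u)
    (by simpa using le_suppFn_of_closedBall_subset (K := ballBody n) zero_le_one subset_rfl u)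

lemma exists_adjoint (Φ : Eucl n ≃ₗ[ℝ] Eucl n) :
    ∃ Ψ : Eucl n ≃ₗ[ℝ] Eucl n, ∀ u x, ⟪u, Φ x⟫ = ⟪Ψ u, x⟫ := by
  have h : ∀ u x, ⟪u, Φ x⟫ = ⟪LinearMap.adjoint (Φ : Eucl n →ₗ[ℝ] Eucl n) u, x⟫ := fun u x => by
    rw [LinearMap.adjoint_inner_left]; rfl
  refine ⟨LinearEquiv.ofInjectiveEndo (LinearMap.adjoint (Φ : Eucl n →ₗ[ℝ] Eucl n)) ?_, h⟩
  rw [← LinearMap.ker_eq_bot, LinearMap.ker_eq_bot']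
  intro u hu
  have := h u (Φ.symm u)
  rw [hu, inner_zero_left, LinearEquiv.apply_symm_apply] at this
  exact inner_self_eq_zero.1 this

/-- The reflection along u - v exchanges the two vectors and preserves the ball. -/
lemma setIntegral_ball_inner_sq_eq {u v : Eucl n} (h : ‖u‖ = ‖v‖) :
    ∫ x in Metric.closedBall 0 1, ⟪u, x⟫ ^ 2 = ∫ x in Metric.closedBall 0 1, ⟪v, x⟫ ^ 2 := by
  set R := (ℝ ∙ (u - v))ᗮ.reflection with hR
  have hRu : R u = v := Submodule.reflection_sub h
  have hpre : R ⁻¹' Metric.closedBall 0 1 = Metric.closedBall 0 1 := by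
    ext x; simp
  have := R.measurePreserving.setIntegral_preimage_emb
    R.toHomeomorph.measurableEmbedding (fun x => ⟪v, x⟫ ^ 2) (Metric.closedBall 0 1)
  rw [hpre] at this
  rw [← this]
  simp only [← hRu, LinearIsometryEquiv.inner_map_map]

lemma volume_integral_pos {K : ConvexBody (Eucl n)}
    (hK : (interior (K : Set (Eucl n))).Nonempty) : 0 < ∫ _x in (K : Set (Eucl n)), (1 : ℝ) := by
  rw [setIntegral_const, smul_eq_mul, mul_one]
  refine ENNReal.toReal_pos ?_ K.isCompact.measure_lt_top.ne
  exact (Measure.measure_pos_of_nonempty_interior volume hK).ne'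

lemma inner_sq_integral_pos {K : ConvexBody (Eucl n)}
    (hK : (interior (K : Set (Eucl n))).Nonempty) {u : Eucl n} (hu : u ≠ 0) :
    0 < ∫ x in (K : Set (Eucl n)), ⟪u, x⟫ ^ 2 := by
  have hc : Continuous fun x : Eucl n => ⟪u, x⟫ ^ 2 := by fun_prop
  rw [setIntegral_pos_iff_support_of_nonneg_ae (ae_of_all _ fun x => by positivity)
    (K.integrableOn hc)]
  have hopen : IsOpen (Function.support fun x : Eucl n => ⟪u, x⟫ ^ 2) := hc.isOpen_support
  have : (Function.support (fun x : Eucl n => ⟪u, x⟫ ^ 2) ∩ interior (K : Set (Eucl n))).Nonempty := by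
    by_contra hne
    rw [not_nonempty_iff_eq_empty] at hne
    obtain ⟨x, hx⟩ := hK
    have hz : ∀ y ∈ interior (K : Set (Eucl n)), ⟪u, y⟫ = 0 := by
      intro y hy
      by_contra hy0
      have : y ∈ (∅ : Set (Eucl n)) := hne ▸ ⟨by simpa using hy0, hy⟩
      exact this
    have hnear : ∀ᶠ t : ℝ in 𝓝 0, x + t • u ∈ interior (K : Set (Eucl n)) := by
      have hcont : Continuous fun t : ℝ => x + t • u := by fun_prop
      exact hcont.continuousAt.eventually_mem (isOpen_interior.mem_nhds (by simpa using hx))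
    obtain ⟨ε, hε, hball⟩ := Metric.eventually_nhds_iff.1 hnear
    have h1 := hz _ (hball (y := ε / 2) (by simp [abs_of_pos hε]; linarith))
    rw [inner_add_right, hz x hx, inner_smul_right, zero_add, real_inner_self_eq_norm_sq] at h1
    have : 0 < ε / 2 * ‖u‖ ^ 2 := by have := norm_pos_iff.2 hu; positivity
    linarith
  refine ((hopen.inter isOpen_interior).measure_pos volume this).trans_le (measure_mono ?_)
  exact inter_subset_inter_right _ interior_subset

lemma interior_of_closedBall_subset {r : ℝ} (hr : 0 < r) {S : Set (Eucl n)}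
    (hS : Metric.closedBall 0 r ⊆ S) : (interior S).Nonempty := by
  refine ⟨0, interior_mono hS ?_⟩
  exact interior_mono Metric.ball_subset_closedBall
    (by rw [Metric.isOpen_ball.interior_eq]; exact Metric.mem_ball_self hr)

/-- The ratio `∫_E ⟪u, x⟫² / (h_E(u)² V(E))` is the same for all centred ellipsoids `E`. -/
lemma exists_ellipsoid_moment (n : ℕ) (hn : 1 ≤ n) : ∃ c : ℝ, 0 < c ∧ c ≤ 1 ∧
    ∀ (Φ : Eucl n ≃ₗ[ℝ] Eucl n) (u : Eucl n),
      ∫ x in (linearImage (Φ : Eucl n →ₗ[ℝ] Eucl n) (ballBody n) : Set (Eucl n)), ⟪u, x⟫ ^ 2 =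
        c * suppFn (linearImage (Φ : Eucl n →ₗ[ℝ] Eucl n) (ballBody n)) u ^ 2 *
        ∫ _x in (linearImage (Φ : Eucl n →ₗ[ℝ] Eucl n) (ballBody n) : Set (Eucl n)), (1 : ℝ) := by
  set e : Eucl n := EuclideanSpace.single ⟨0, hn⟩ 1 with he
  have hen : ‖e‖ = 1 := by simp [he]
  have hint : (interior (ballBody n : Set (Eucl n))).Nonempty :=
    interior_of_closedBall_subset one_pos subset_rfl
  have hV := volume_integral_pos hint
  have hI := inner_sq_integral_pos hint (u := e) (norm_ne_zero_iff.1 (by rw [hen]; norm_num))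
  simp only [coe_ballBody] at hV hI
  set V := ∫ _x in Metric.closedBall (0 : Eucl n) 1, (1 : ℝ) with hVdef
  set I := ∫ x in Metric.closedBall (0 : Eucl n) 1, ⟪e, x⟫ ^ 2 with hIdef
  refine ⟨I / V, by positivity, ?_, fun Φ u => ?_⟩
  · rw [div_le_one hV]
    refine setIntegral_mono_on ((ballBody n).integrableOn (by fun_prop))
      ((ballBody n).integrableOn (by fun_prop)) (ballBody n).isCompact.measurableSet ?_
    intro x hx
    have h1 := abs_real_inner_le_norm e x
    rw [hen, one_mul] at h1
    have h2 := mem_closedBall_zero_iff.1 hx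
    rw [← sq_abs]
    exact pow_le_one₀ (abs_nonneg _) (h1.trans h2)
  · obtain ⟨Ψ, hΨ⟩ := exists_adjoint Φ
    rw [suppFn_linearImage (Φ : Eucl n →ₗ[ℝ] Eucl n) (ballBody n) (hΨ u), suppFn_ballBody]
    simp only [coe_linearImage, coe_ballBody, LinearEquiv.coe_coe]
    rw [setIntegral_linearEquiv_image Φ measurableSet_closedBall,
      setIntegral_linearEquiv_image Φ measurableSet_closedBall]
    simp only [hΨ]
    have h1 : ∫ x in Metric.closedBall (0 : Eucl n) 1, ⟪Ψ u, x⟫ ^ 2 = ‖Ψ u‖ ^ 2 * I := by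
      rw [setIntegral_ball_inner_sq_eq (v := ‖Ψ u‖ • e) (by rw [norm_smul, hen]; simp),
        ← integral_const_mul]
      refine integral_congr_ae (ae_of_all _ fun x => ?_)
      simp only [inner_smul_left, conj_trivial, mul_pow]
    rw [h1]
    field_simp
    rfl

-- A nonnegative matrix factors as A = B*B, so that ‖Bu‖² is the quadratic form of A; definiteness
-- makes B injective.
open scoped MatrixOrder Matrix.Norms.L2Operator in
lemma exists_linearEquiv_of_posDef {A : Matrix (Fin n) (Fin n) ℝ} (hA : A.PosDef) :
    ∃ Ψ : Eucl n ≃ₗ[ℝ] Eucl n, ∀ u, ‖Ψ u‖ ^ 2 = ∑ i, ∑ j, u i * A i j * u j := by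
  obtain ⟨B, hB⟩ := CStarAlgebra.nonneg_iff_eq_star_mul_self.mp hA.posSemidef.nonneg
  have key : ∀ u : Eucl n, ‖Matrix.toEuclideanLin B u‖ ^ 2 = ∑ i, ∑ j, u i * A i j * u j := by
    intro u
    rw [EuclideanSpace.real_norm_sq_eq]
    have h1 : ∑ i, ∑ j, u i * A i j * u j = u.ofLp ⬝ᵥ (A.mulVec u.ofLp) := by
      simp only [dotProduct, Matrix.mulVec, Finset.mul_sum, mul_assoc]
    rw [h1, hB, ← Matrix.mulVec_mulVec, Matrix.dotProduct_mulVec]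
    simp [dotProduct, Matrix.vecMul, Matrix.mulVec, Matrix.toLpLin_apply, sq, mul_comm]
  refine ⟨LinearEquiv.ofInjectiveEndo (Matrix.toEuclideanLin B) ?_, key⟩
  rw [← LinearMap.ker_eq_bot, LinearMap.ker_eq_bot']
  intro u hu
  by_contra hne
  have h := key u
  rw [hu] at h
  have hpos := hA.dotProduct_mulVec_pos (x := u.ofLp) (by
    intro h0; exact hne (by ext i; simp [h0]))
  simp only [dotProduct, Matrix.mulVec, Finset.mul_sum, star_trivial] at hpos
  simp only [norm_zero, ← mul_assoc] at h hpos
  linarith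

/-- The quadratic form of second moments of a convex body is the square of a Euclidean norm. -/
lemma exists_linearEquiv_inner_sq_integral {K : ConvexBody (Eucl n)}
    (hK : (interior (K : Set (Eucl n))).Nonempty) :
    ∃ Ψ : Eucl n ≃ₗ[ℝ] Eucl n, ∀ u, ‖Ψ u‖ ^ 2 = ∫ x in (K : Set (Eucl n)), ⟪u, x⟫ ^ 2 := by
  set A : Matrix (Fin n) (Fin n) ℝ := Matrix.of fun i j =>
    ∫ x in (K : Set (Eucl n)), x i * x j with hAdef
  have hform : ∀ u : Fin n → ℝ, ∑ i, ∑ j, u i * A i j * u j =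
      ∫ x in (K : Set (Eucl n)), ⟪WithLp.toLp 2 u, x⟫ ^ 2 := by
    intro u
    have h1 : ∀ x : Eucl n, ⟪WithLp.toLp 2 u, x⟫ ^ 2 =
        ∑ i, ∑ j, u i * (x i * x j) * u j := by
      intro x
      simp only [PiLp.inner_apply, RCLike.inner_apply, conj_trivial, sq, Finset.sum_mul_sum]
      refine Finset.sum_congr rfl fun i _ => Finset.sum_congr rfl fun j _ => by ring
    simp only [h1]
    have hint : ∀ i j, Integrable (fun x : Eucl n => u i * (x i * x j) * u j)
        (volume.restrict (K : Set (Eucl n))) := fun i j => K.integrableOn (by fun_prop)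
    rw [integral_finsetSum _ fun i _ => integrable_finsetSum _ fun j _ => hint i j]
    refine Finset.sum_congr rfl fun i _ => ?_
    rw [integral_finsetSum _ fun j _ => hint i j]
    refine Finset.sum_congr rfl fun j _ => ?_
    rw [integral_mul_const, integral_const_mul]
    rfl
  have hA : A.PosDef := by
    refine Matrix.PosDef.of_dotProduct_mulVec_pos ?_ fun u hu => ?_
    · ext i j; simp [hAdef, mul_comm]
    · have := hform u
      have h2 := inner_sq_integral_pos hK (u := WithLp.toLp 2 u) (by simpa using hu)
      rw [← this] at h2
      simpa [dotProduct, Matrix.mulVec, Finset.mul_sum, mul_assoc] using h2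
  obtain ⟨Ψ, hΨ⟩ := exists_linearEquiv_of_posDef hA
  exact ⟨Ψ, fun u => by rw [hΨ, hform]⟩

end Ellipsoid

/-! ### Distance to the ball expressed by ellipsoids, support functions and moments. -/

section BanachMazur

open MeasureTheory

variable {n : ℕ}

/-- The ellipsoid `Φ (Bⁿ)`. -/
noncomputable abbrev ellBody (Φ : Eucl n ≃ₗ[ℝ] Eucl n) : ConvexBody (Eucl n) :=
  linearImage (Φ : Eucl n →ₗ[ℝ] Eucl n) (ballBody n)

lemma mem_ellBody (Φ : Eucl n ≃ₗ[ℝ] Eucl n) (x : Eucl n) : x ∈ ellBody Φ ↔ ‖Φ.symm x‖ ≤ 1 := by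
  constructor
  · rintro ⟨z, hz, rfl⟩
    simpa using hz
  · intro h
    exact ⟨Φ.symm x, by simpa using h, by simp⟩

lemma bmDist_le {K : ConvexBody (Eucl n)} (c : Eucl n) (Φ : Eucl n ≃ₗ[ℝ] Eucl n) {lam : ℝ}
    (hlam : 1 ≤ lam) (h1 : (translateBody c K : Set (Eucl n)) ⊆ ellBody Φ)
    (h2 : (ellBody Φ : Set (Eucl n)) ⊆ lam • (translateBody c K : Set (Eucl n))) :
    bmDist (K : Set (Eucl n)) (unitBall n) ≤ lam := by
  refine csInf_le ⟨1, fun _ h => h.1⟩ ⟨hlam, Φ, c, 0, ?_, ?_⟩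
  · simpa [unitBall] using h1
  · simpa [unitBall] using h2

/-- The definition allows a ball with centre y, so the ellipsoid around K and the smaller homothetic
one inside K come with two unrelated shifts s and t. For symmetric bodies both are later removed by
averaging. -/
lemma exists_ellipsoid_of_bmDist_lt {K : ConvexBody (Eucl n)}
    (hK : (interior (K : Set (Eucl n))).Nonempty) {lam : ℝ}
    (h : bmDist (K : Set (Eucl n)) (unitBall n) < lam) :
    1 < lam ∧ ∃ (Φ : Eucl n ≃ₗ[ℝ] Eucl n) (s t : Eucl n), (∀ x ∈ K, x - s ∈ ellBody Φ) ∧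
      ∀ x ∈ ellBody Φ, lam⁻¹ • x + t ∈ K := by
  have hne : {lam : ℝ | 1 ≤ lam ∧ ∃ (Φ : Eucl n ≃ₗ[ℝ] Eucl n) (x y : Eucl n),
      (fun z => z - x) '' (K : Set (Eucl n)) ⊆ Φ '' ((fun z => z - y) '' unitBall n) ∧
      Φ '' ((fun z => z - y) '' unitBall n) ⊆
        lam • ((fun z => z - x) '' (K : Set (Eucl n)))}.Nonempty := by
    obtain ⟨c, hc⟩ := hK
    obtain ⟨r, hr, hball⟩ := Metric.isOpen_iff.1 isOpen_interior c hc
    obtain ⟨R, hR⟩ := K.isBounded.subset_closedBall c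
    set R' := max R r with hR'
    have hR0 : 0 < R' := lt_of_lt_of_le hr (le_max_right _ _)
    -- An explicit admissible ratio, since the infimum of an empty set would be the default value 0.
    -- The factor 2 leaves room because only an open ball of radius r is known to lie in K.
    refine ⟨2 * R' / r, ?_, LinearEquiv.smulOfNeZero ℝ _ R' hR0.ne', c, 0, ?_, ?_⟩
    · rw [le_div_iff₀ hr]
      linarith [le_max_right R r]
    · rintro _ ⟨x, hx, rfl⟩
      refine ⟨R'⁻¹ • (x - c), ⟨R'⁻¹ • (x - c), ?_, by simp⟩, by simp [smul_smul, hR0.ne']⟩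
      have := hR hx
      rw [mem_closedBall_iff_norm] at this
      rw [unitBall, mem_closedBall_zero_iff, norm_smul, norm_inv, Real.norm_of_nonneg hR0.le,
        inv_mul_le_iff₀ hR0, mul_one]
      exact this.trans (le_max_left _ _)
    · rintro _ ⟨_, ⟨z, hz, rfl⟩, rfl⟩
      refine ⟨(r / 2) • z, ⟨c + (r / 2) • z, ?_, by simp⟩, ?_⟩
      · refine interior_subset (hball ?_)
        rw [unitBall, mem_closedBall_zero_iff] at hz
        rw [mem_ball_iff_norm, add_sub_cancel_left, norm_smul, Real.norm_of_nonneg (by positivity)]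
        nlinarith
      · simp only [sub_zero, smul_smul, LinearEquiv.smulOfNeZero_apply]
        congr 1
        field_simp
  obtain ⟨mu, ⟨hmu1, Φ, x, y, h1, h2⟩, hmu⟩ := exists_lt_of_csInf_lt hne h
  have hmu0 : 0 < mu := by linarith
  have hlam0 : 0 < lam := by linarith
  -- The attained ratio is `mu` < `lam`: the vector Φ y enters the outer inclusion with factor 1 and
  -- the inner one with factor `mu⁻¹`, which determines s and t.
  refine ⟨by linarith, Φ, x - Φ y, x - mu⁻¹ • Φ y, fun p hp => ?_, fun p hp => ?_⟩
  · obtain ⟨_, ⟨b, hb, rfl⟩, hbp⟩ := h1 ⟨p, hp, rfl⟩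
    simp only [map_sub] at hbp
    refine ⟨b, hb, ?_⟩
    rw [LinearEquiv.coe_coe]
    calc Φ b = (Φ b - Φ y) + Φ y := by abel
      _ = _ := by rw [hbp]; abel
  · obtain ⟨b, hb, rfl⟩ := hp
    rw [coe_ballBody, mem_closedBall_zero_iff] at hb
    have hb' : (mu * lam⁻¹) • b ∈ unitBall n := by
      rw [unitBall, mem_closedBall_zero_iff, norm_smul, Real.norm_of_nonneg (by positivity)]
      have : mu * lam⁻¹ ≤ 1 := by rw [← div_eq_mul_inv, div_le_one hlam0]; exact hmu.le
      exact mul_le_one₀ this (norm_nonneg _) hb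
    obtain ⟨_, ⟨k, hk, rfl⟩, hk2⟩ := h2 ⟨_, ⟨_, hb', rfl⟩, rfl⟩
    rw [← SetLike.mem_coe]
    convert hk using 1
    simp only [map_sub, map_smul] at hk2
    have : k - x = mu⁻¹ • ((mu * lam⁻¹) • Φ b - Φ y) := by
      rw [← hk2, smul_smul, inv_mul_cancel₀ hmu0.ne', one_smul]
    rw [eq_add_of_sub_eq this, smul_sub, smul_smul, ← mul_assoc, inv_mul_cancel₀ hmu0.ne', one_mul,
      LinearEquiv.coe_coe]
    abel

lemma neg_mem_ellBody {Φ : Eucl n ≃ₗ[ℝ] Eucl n} {x : Eucl n} (h : x ∈ ellBody Φ) :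
    -x ∈ ellBody Φ := by
  rw [mem_ellBody] at *
  rwa [map_neg, norm_neg]

/-- An origin-symmetric body at small Banach-Mazur distance from the ball is sandwiched between
centred homothetic ellipsoids. -/
lemma exists_centred_ellipsoid {K : ConvexBody (Eucl n)}
    (hK : (interior (K : Set (Eucl n))).Nonempty) (hsymm : ∀ x ∈ K, -x ∈ K) {lam : ℝ}
    (h : bmDist (K : Set (Eucl n)) (unitBall n) < lam) :
    1 < lam ∧ ∃ Φ : Eucl n ≃ₗ[ℝ] Eucl n, (K : Set (Eucl n)) ⊆ ellBody Φ ∧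
      (ellBody Φ : Set (Eucl n)) ⊆ lam • (K : Set (Eucl n)) := by
  obtain ⟨hlam, Φ, s, t, h1, h2⟩ := exists_ellipsoid_of_bmDist_lt hK h
  have hl0 : lam ≠ 0 := by linarith
  refine ⟨hlam, Φ, fun x hx => ?_, fun x hx => ?_⟩
  · have := (ellBody Φ).convex (h1 x hx) (neg_mem_ellBody (h1 _ (hsymm x hx)))
      (by norm_num : (0 : ℝ) ≤ 1 / 2) (by norm_num : (0 : ℝ) ≤ 1 / 2) (by norm_num)
    convert this using 1
    module
  · rw [mem_smul_set_iff_inv_smul_mem₀ hl0]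
    have := K.convex (h2 x hx) (hsymm _ (h2 _ (neg_mem_ellBody hx)))
      (by norm_num : (0 : ℝ) ≤ 1 / 2) (by norm_num : (0 : ℝ) ≤ 1 / 2) (by norm_num)
    convert this using 1
    module

/-- If the squared support function of `K - c` is comparable to a quadratic form, then `K` is
close to an ellipsoid. -/
lemma bmDist_le_of_suppFn {K : ConvexBody (Eucl n)} (c : Eucl n) (Ψ : Eucl n ≃ₗ[ℝ] Eucl n)
    {a b : ℝ} (ha : 0 < a) (hab : a ≤ b)
    (h1 : ∀ u, a * ‖Ψ u‖ ≤ suppFn (translateBody c K) u)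
    (h2 : ∀ u, suppFn (translateBody c K) u ≤ b * ‖Ψ u‖) :
    bmDist (K : Set (Eucl n)) (unitBall n) ≤ b / a := by
  have hb : 0 < b := by linarith
  obtain ⟨Φ, hΦ⟩ := exists_adjoint (Ψ.trans (LinearEquiv.smulOfNeZero ℝ _ b hb.ne'))
  have hE : ∀ u, suppFn (ellBody Φ) u = b * ‖Ψ u‖ := by
    intro u
    rw [suppFn_linearImage (Φ : Eucl n →ₗ[ℝ] Eucl n) (ballBody n) (v := b • Ψ u), suppFn_ballBody,
      norm_smul, Real.norm_of_nonneg hb.le]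
    intro x
    have := hΦ x u
    simp only [LinearEquiv.trans_apply, LinearEquiv.smulOfNeZero_apply] at this
    rw [real_inner_comm, LinearEquiv.coe_coe, ← this, real_inner_comm]
  refine bmDist_le c Φ ((one_le_div ha).2 hab) (fun x hx => ?_) (fun x hx => ?_)
  · refine mem_of_forall_inner_le _ fun u => ?_
    rw [hE]
    exact (inner_le_suppFn (translateBody c K) u hx).trans (h2 u)
  · rw [mem_smul_set_iff_inv_smul_mem₀ (by positivity)]
    refine mem_of_forall_inner_le _ fun u => ?_
    refine le_trans ?_ (h1 u)
    have h3 := inner_le_suppFn (ellBody Φ) u hx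
    rw [hE] at h3
    rw [inner_smul_right, inv_div, div_mul_eq_mul_div, div_le_iff₀ hb]
    nlinarith

/-- Second moments of an origin-symmetric body close to an ellipsoid. -/
lemma moment_of_ellipsoid {c : ℝ} (hc0 : 0 < c)
    (hc : ∀ (Φ : Eucl n ≃ₗ[ℝ] Eucl n) (u : Eucl n), ∫ x in (ellBody Φ : Set (Eucl n)), ⟪u, x⟫ ^ 2 =
        c * suppFn (ellBody Φ) u ^ 2 * ∫ _x in (ellBody Φ : Set (Eucl n)), (1 : ℝ))
    {K : ConvexBody (Eucl n)} (h0 : (0 : Eucl n) ∈ K) {lam : ℝ} (hlam : 1 ≤ lam)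
    {Φ : Eucl n ≃ₗ[ℝ] Eucl n}
    (h1 : (K : Set (Eucl n)) ⊆ ellBody Φ)
    (h2 : (ellBody Φ : Set (Eucl n)) ⊆ lam • (K : Set (Eucl n))) (u : Eucl n) :
    c * suppFn K u ^ 2 * (∫ _x in (K : Set (Eucl n)), (1 : ℝ)) ≤
      lam ^ (n + 2) * ∫ x in (K : Set (Eucl n)), ⟪u, x⟫ ^ 2 ∧
    ∫ x in (K : Set (Eucl n)), ⟪u, x⟫ ^ 2 ≤
      lam ^ (n + 2) * (c * suppFn K u ^ 2 * ∫ _x in (K : Set (Eucl n)), (1 : ℝ)) := by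
  have hl0 : 0 < lam := by linarith
  have hcont : Continuous fun x : Eucl n => ⟪u, x⟫ ^ 2 := by fun_prop
  have hhom : ∀ (a : ℝ) (x : Eucl n), ⟪u, a • x⟫ ^ 2 = a ^ 2 * ⟪u, x⟫ ^ 2 := by
    intro a x; rw [inner_smul_right]; ring
  have hV0 : ∀ L : ConvexBody (Eucl n), 0 ≤ ∫ _x in (L : Set (Eucl n)), (1 : ℝ) :=
    fun L => integral_nonneg fun _ => zero_le_one
  have hV1 := setIntegral_mono_body (φ := fun _ => (1 : ℝ)) continuous_const
    (fun _ => zero_le_one) h1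
  have hV2 := setIntegral_le_of_subset_smul (φ := fun _ => (1 : ℝ)) (d := 0) continuous_const
    (fun _ => zero_le_one) (by simp) hl0 h2
  have hI1 := setIntegral_mono_body hcont (fun _ => sq_nonneg _) h1
  have hI2 := setIntegral_le_of_subset_smul hcont (fun _ => sq_nonneg _) hhom hl0 h2
  have hs0 := suppFn_nonneg h0 u
  have hs1 := suppFn_mono h1 u
  have hs2 := suppFn_le_of_subset_smul hl0.le h2 u
  rw [add_zero] at hV2
  have hVK := hV0 K
  have hVE := hV0 (ellBody Φ)
  constructor
  · calc _ ≤ c * suppFn (ellBody Φ) u ^ 2 * ∫ _x in (ellBody Φ : Set (Eucl n)), (1 : ℝ) := by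
          gcongr
      _ = ∫ x in (ellBody Φ : Set (Eucl n)), ⟪u, x⟫ ^ 2 := (hc Φ u).symm
      _ ≤ _ := hI2
  · have hs3 := hs0.trans hs1
    calc _ ≤ ∫ x in (ellBody Φ : Set (Eucl n)), ⟪u, x⟫ ^ 2 := hI1
      _ = c * suppFn (ellBody Φ) u ^ 2 * ∫ _x in (ellBody Φ : Set (Eucl n)), (1 : ℝ) := hc Φ u
      _ ≤ c * (lam * suppFn K u) ^ 2 * (lam ^ n * ∫ _x in (K : Set (Eucl n)), (1 : ℝ)) := by
          gcongr
      _ = _ := by ring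

end BanachMazur

/-! ### A crude universal bound from the centroid and the inertia ellipsoid. -/

section Rough

open MeasureTheory

variable {n : ℕ}

lemma setIntegral_translateBody (c : Eucl n) (K : ConvexBody (Eucl n)) (φ : Eucl n → ℝ) :
    ∫ x in (translateBody c K : Set (Eucl n)), φ x = ∫ x in (K : Set (Eucl n)), φ (x - c) := by
  have h := (measurePreserving_sub_right (volume : Measure (Eucl n)) c).setIntegral_image_emb
    (measurableEmbedding_subRight c) φ (K : Set (Eucl n))
  exact h

lemma exists_centroid {K : ConvexBody (Eucl n)} (hK : (interior (K : Set (Eucl n))).Nonempty) :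
    ∃ c : Eucl n, ∀ u, ∫ x in (translateBody c K : Set (Eucl n)), ⟪u, x⟫ = 0 := by
  have hV := volume_integral_pos hK
  set V := ∫ _x in (K : Set (Eucl n)), (1 : ℝ) with hVdef
  refine ⟨V⁻¹ • ∫ x in (K : Set (Eucl n)), x, fun u => ?_⟩
  have hint : Integrable (fun x : Eucl n => x) (volume.restrict (K : Set (Eucl n))) :=
    continuous_id.continuousOn.integrableOn_compact K.isCompact
  rw [setIntegral_translateBody]
  simp only [inner_sub_right]
  rw [integral_sub (K.integrableOn (by fun_prop)) (K.integrableOn (by fun_prop)),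
    integral_inner hint, inner_smul_right]
  have : ∫ _x in (K : Set (Eucl n)), V⁻¹ * ⟪u, ∫ x in (K : Set (Eucl n)), x⟫ =
      (V⁻¹ * ⟪u, ∫ x in (K : Set (Eucl n)), x⟫) * V := by
    rw [hVdef, ← integral_const_mul]; simp
  rw [this]; field_simp; ring

/-- The homothetic copy `(K + p)/2` of `K` is contained in `K` for `p ∈ K`. -/
lemma half_translate_subset {K : ConvexBody (Eucl n)} {p : Eucl n} (hp : p ∈ K) :
    (((1 / 2 : ℝ) • translateBody (-p) K : ConvexBody (Eucl n)) : Set (Eucl n)) ⊆ K := by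
  rintro _ ⟨_, ⟨x, hx, rfl⟩, rfl⟩
  have := K.convex hx hp (by norm_num : (0 : ℝ) ≤ 1 / 2) (by norm_num : (0 : ℝ) ≤ 1 / 2)
    (by norm_num)
  convert this using 1
  simp only [sub_neg_eq_add, smul_add]

lemma integral_inner_le {K : ConvexBody (Eucl n)} (u : Eucl n) :
    ∫ x in (K : Set (Eucl n)), ⟪u, x⟫ ≤ suppFn K u * ∫ _x in (K : Set (Eucl n)), (1 : ℝ) := by
  rw [← integral_const_mul]
  refine setIntegral_mono_on (K.integrableOn (by fun_prop)) (K.integrableOn (by fun_prop))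
    K.isCompact.measurableSet fun x hx => ?_
  rw [mul_one]; exact inner_le_suppFn K u hx

lemma suppFn_nonneg_of_centroid {K : ConvexBody (Eucl n)}
    (hK : (interior (K : Set (Eucl n))).Nonempty)
    (h0 : ∀ u, ∫ x in (K : Set (Eucl n)), ⟪u, x⟫ = 0) (u : Eucl n) : 0 ≤ suppFn K u := by
  have h := integral_inner_le (K := K) u
  rw [h0] at h
  exact nonneg_of_mul_nonneg_left h (volume_integral_pos hK)

/-- Compare K with its subset (K + p)/2, where p is a point of maximal ⟪u, ·⟫. The moment of the
subset is 2^(-(n+2)) times (moment of K plus h(u)² V), the linear term vanishing at the centroid. -/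
lemma suppFn_sq_le_moment {K : ConvexBody (Eucl n)}
    (h0 : ∀ u, ∫ x in (K : Set (Eucl n)), ⟪u, x⟫ = 0) (u : Eucl n) :
    suppFn K u ^ 2 * (∫ _x in (K : Set (Eucl n)), (1 : ℝ)) ≤
      2 ^ (n + 2) * ∫ x in (K : Set (Eucl n)), ⟪u, x⟫ ^ 2 := by
  obtain ⟨p, hp, hpu⟩ := exists_inner_eq_suppFn K u
  have hcont : Continuous fun x : Eucl n => ⟪u, x⟫ ^ 2 := by fun_prop
  have hhom : ∀ (a : ℝ) (x : Eucl n), ⟪u, a • x⟫ ^ 2 = a ^ 2 * ⟪u, x⟫ ^ 2 := by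
    intro a x; rw [inner_smul_right]; ring
  have h1 := setIntegral_mono_body hcont (fun _ => sq_nonneg _) (half_translate_subset hp)
  rw [ConvexBody.coe_smul, setIntegral_smul_set hhom (by norm_num), setIntegral_translateBody] at h1
  have h2 : ∫ x in (K : Set (Eucl n)), ⟪u, x - -p⟫ ^ 2 =
      (∫ x in (K : Set (Eucl n)), ⟪u, x⟫ ^ 2) +
        suppFn K u ^ 2 * ∫ _x in (K : Set (Eucl n)), (1 : ℝ) := by
    have : ∀ x : Eucl n, ⟪u, x - -p⟫ ^ 2 =
        ⟪u, x⟫ ^ 2 + (2 * suppFn K u) * ⟪u, x⟫ + suppFn K u ^ 2 * 1 := by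
      intro x; rw [sub_neg_eq_add, inner_add_right, hpu]; ring
    simp only [this]
    rw [integral_add (K.integrableOn (by fun_prop)) (K.integrableOn (by fun_prop)),
      integral_add (K.integrableOn (by fun_prop)) (K.integrableOn (by fun_prop)),
      integral_const_mul, integral_const_mul, h0]
    ring
  rw [h2] at h1
  have hI : 0 ≤ ∫ x in (K : Set (Eucl n)), ⟪u, x⟫ ^ 2 := integral_nonneg fun x => sq_nonneg _
  have h3 : (2 : ℝ) ^ (n + 2) * (1 / 2) ^ (n + 2) = 1 := by rw [← mul_pow]; norm_num
  have h4 := mul_le_mul_of_nonneg_left h1 (by positivity : (0 : ℝ) ≤ 2 ^ (n + 2))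
  rw [← mul_assoc, h3, one_mul] at h4
  linarith

/-- The same comparison of K with (K + p)/2, now for the function ⟪u, x⟫ + h(-u), which is
nonnegative on K and has integral h(-u) V. -/
lemma suppFn_le_neg {K : ConvexBody (Eucl n)} (hK : (interior (K : Set (Eucl n))).Nonempty)
    (h0 : ∀ u, ∫ x in (K : Set (Eucl n)), ⟪u, x⟫ = 0) (u : Eucl n) :
    suppFn K u ≤ 2 ^ (n + 1) * suppFn K (-u) := by
  have hV := volume_integral_pos hK
  obtain ⟨p, hp, hpu⟩ := exists_inner_eq_suppFn K u
  have hnn := suppFn_nonneg_of_centroid hK h0 (-u)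
  set M := ((1 / 2 : ℝ) • translateBody (-p) K : ConvexBody (Eucl n)) with hM
  have hhom : ∀ (a : ℝ) (x : Eucl n), ⟪u, a • x⟫ = a ^ 1 * ⟪u, x⟫ := by
    intro a x; rw [inner_smul_right]; ring
  have h1 : ∫ x in (M : Set (Eucl n)), (⟪u, x⟫ + suppFn K (-u)) ≤
      ∫ x in (K : Set (Eucl n)), (⟪u, x⟫ + suppFn K (-u)) := by
    refine setIntegral_mono_set (K.integrableOn (by fun_prop)) ?_
      (LE.le.eventuallyLE (half_translate_subset hp))
    filter_upwards [ae_restrict_mem K.isCompact.measurableSet] with x hx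
    have := inner_le_suppFn K (-u) hx
    rw [inner_neg_left] at this
    simp only [Pi.zero_apply]; linarith
  rw [integral_add (M.integrableOn (by fun_prop)) (M.integrableOn (by fun_prop)),
    integral_add (K.integrableOn (by fun_prop)) (K.integrableOn (by fun_prop)), h0, zero_add] at h1
  have h2 : 0 ≤ ∫ _x in (M : Set (Eucl n)), suppFn K (-u) := integral_nonneg fun _ => hnn
  have h3 : ∫ x in (M : Set (Eucl n)), ⟪u, x⟫ =
      (1 / 2) ^ (n + 1) * (suppFn K u * ∫ _x in (K : Set (Eucl n)), (1 : ℝ)) := by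
    rw [hM, ConvexBody.coe_smul, setIntegral_smul_set hhom (by norm_num),
      setIntegral_translateBody]
    simp only [sub_neg_eq_add, inner_add_right, hpu]
    rw [integral_add (K.integrableOn (by fun_prop)) (K.integrableOn (by fun_prop)), h0, zero_add,
      ← integral_const_mul]
    simp; ring
  have h4 : ∫ _x in (K : Set (Eucl n)), suppFn K (-u) =
      suppFn K (-u) * ∫ _x in (K : Set (Eucl n)), (1 : ℝ) := by
    rw [← integral_const_mul]; simp
  rw [h3, h4] at h1
  have h5 : (1 / 2 : ℝ) ^ (n + 1) * suppFn K u ≤ suppFn K (-u) := by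
    refine le_of_mul_le_mul_right ?_ hV
    linarith
  have h6 : (2 : ℝ) ^ (n + 1) * (1 / 2) ^ (n + 1) = 1 := by rw [← mul_pow]; norm_num
  have h7 := mul_le_mul_of_nonneg_left h5 (by positivity : (0 : ℝ) ≤ 2 ^ (n + 1))
  rwa [← mul_assoc, h6, one_mul] at h7

lemma moment_le_suppFn_sq {K : ConvexBody (Eucl n)} (hK : (interior (K : Set (Eucl n))).Nonempty)
    (h0 : ∀ u, ∫ x in (K : Set (Eucl n)), ⟪u, x⟫ = 0) (u : Eucl n) :
    ∫ x in (K : Set (Eucl n)), ⟪u, x⟫ ^ 2 ≤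
      (2 ^ (n + 1) * suppFn K u) ^ 2 * ∫ _x in (K : Set (Eucl n)), (1 : ℝ) := by
  rw [← integral_const_mul]
  have hnn := suppFn_nonneg_of_centroid hK h0 u
  refine setIntegral_mono_on (K.integrableOn (by fun_prop)) (K.integrableOn (by fun_prop))
    K.isCompact.measurableSet fun x hx => ?_
  have h1 := inner_le_suppFn K u hx
  have h2 := inner_le_suppFn K (-u) hx
  have h3 := suppFn_le_neg hK h0 (-u)
  rw [neg_neg] at h3
  rw [inner_neg_left] at h2
  have h4 : suppFn K u ≤ 2 ^ (n + 1) * suppFn K u :=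
    le_mul_of_one_le_left hnn (one_le_pow₀ (by norm_num))
  rw [mul_one, ← sq_abs]
  exact pow_le_pow_left₀ (abs_nonneg _) (abs_le.2 ⟨by linarith, by linarith⟩) 2

/-- Every convex body has a translate comparable to its ellipsoid of inertia. -/
lemma exists_rough_position {K : ConvexBody (Eucl n)}
    (hK : (interior (K : Set (Eucl n))).Nonempty) :
    ∃ (c : Eucl n) (Ψ : Eucl n ≃ₗ[ℝ] Eucl n), ∀ u,
      (2 ^ (n + 1))⁻¹ * ‖Ψ u‖ ≤ suppFn (translateBody c K) u ∧
      suppFn (translateBody c K) u ≤ 2 ^ (n + 2) * ‖Ψ u‖ := by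
  obtain ⟨c, hc⟩ := exists_centroid hK
  have hK' : (interior (translateBody c K : Set (Eucl n))).Nonempty := by
    obtain ⟨x, hx⟩ := hK
    have h := (Homeomorph.subRight c).image_interior (K : Set (Eucl n))
    exact ⟨x - c, by
      have : x - c ∈ Homeomorph.subRight c '' interior (K : Set (Eucl n)) := ⟨x, hx, rfl⟩
      rw [h] at this; exact this⟩
  obtain ⟨Ψ, hΨ⟩ := exists_linearEquiv_inner_sq_integral hK'
  have hV := volume_integral_pos hK'
  set L := translateBody c K
  set V := ∫ _x in (L : Set (Eucl n)), (1 : ℝ)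
  have hs : 0 < Real.sqrt V := Real.sqrt_pos.2 hV
  refine ⟨c, Ψ.trans (LinearEquiv.smulOfNeZero ℝ _ (Real.sqrt V)⁻¹ (inv_pos.2 hs).ne'),
    fun u => ?_⟩
  have hnn := suppFn_nonneg_of_centroid hK' hc u
  have hn : ‖(Ψ.trans (LinearEquiv.smulOfNeZero ℝ _ (Real.sqrt V)⁻¹ (inv_pos.2 hs).ne')) u‖ =
      ‖Ψ u‖ / Real.sqrt V := by
    simp only [LinearEquiv.trans_apply, LinearEquiv.smulOfNeZero_apply]
    rw [norm_smul, norm_inv, Real.norm_of_nonneg hs.le, div_eq_inv_mul]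
  rw [hn]
  constructor
  · rw [inv_mul_le_iff₀ (by positivity), div_le_iff₀ hs]
    refine le_of_sq_le_sq ?_ (by positivity)
    rw [hΨ, mul_pow _ (Real.sqrt V), Real.sq_sqrt hV.le]
    exact moment_le_suppFn_sq hK' hc u
  · rw [mul_div_assoc', le_div_iff₀ hs]
    refine le_of_sq_le_sq ?_ (by positivity)
    rw [mul_pow, mul_pow, Real.sq_sqrt hV.le, hΨ]
    refine (suppFn_sq_le_moment hc u).trans ?_
    refine mul_le_mul_of_nonneg_right ?_ (integral_nonneg fun x => sq_nonneg _)
    exact le_self_pow₀ (one_le_pow₀ (by norm_num)) two_ne_zero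

lemma bmDist_le_rough {K : ConvexBody (Eucl n)}
    (hK : (interior (K : Set (Eucl n))).Nonempty) :
    bmDist (K : Set (Eucl n)) (unitBall n) ≤ 2 ^ (2 * n + 3) := by
  obtain ⟨c, Ψ, h⟩ := exists_rough_position hK
  have h1 : ((2 : ℝ) ^ (n + 1))⁻¹ ≤ 2 ^ (n + 2) :=
    (inv_le_one_of_one_le₀ (one_le_pow₀ (by norm_num))).trans (one_le_pow₀ (by norm_num))
  have := bmDist_le_of_suppFn c Ψ (by positivity) h1 (fun u => (h u).1) (fun u => (h u).2)
  refine this.trans (le_of_eq ?_)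
  rw [div_inv_eq_mul, ← pow_add]
  congr 1; ring

/-- Linearises powers on [0, 1], where only the order of magnitude of the constant matters. -/
lemma one_add_pow_le {x : ℝ} (h0 : 0 ≤ x) (h1 : x ≤ 1) (N : ℕ) :
    (1 + x) ^ N ≤ 1 + N * 2 ^ N * x := by
  induction N with
  | zero => simp
  | succ N ih =>
    have hN : 0 ≤ (N : ℝ) * 2 ^ N * x := by positivity
    have h2 : (1 : ℝ) ≤ 2 ^ N := one_le_pow₀ (by norm_num)
    calc (1 + x) ^ (N + 1) = (1 + x) ^ N * (1 + x) := pow_succ _ _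
      _ ≤ (1 + N * 2 ^ N * x) * (1 + x) := by gcongr
      _ ≤ 1 + ((N + 1 : ℕ) : ℝ) * 2 ^ (N + 1) * x := by
        push_cast
        rw [pow_succ]
        nlinarith [mul_le_mul_of_nonneg_left h1 hN, mul_le_mul_of_nonneg_right h2 h0]

end Rough

/-! ### The o-symmetric case, with linear dependence on ε. -/

section OriginSymmetric

open MeasureTheory

variable {n : ℕ}

/-- Rounding an origin-symmetric body about the axis `ℝ u`. -/
lemma exists_axial_limit {K : ConvexBody (Eucl n)} (hn : 2 ≤ n) {r : ℝ} (hr : 0 < r)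
    (hrK : Metric.closedBall 0 r ⊆ (K : Set (Eucl n))) (hsymm : ∀ x ∈ K, -x ∈ K) {u : Eucl n}
    (hu : ‖u‖ = 1) :
    ∃ C : ConvexBody (Eucl n), HasInterior C ∧ OSymmetric (C : Set (Eucl n)) ∧
      AxialSymmetric (C : Set (Eucl n)) ∧ IsSteinerAffineLimit K C ∧
      suppFn C u = suppFn K u ∧
      ∫ _x in (C : Set (Eucl n)), (1 : ℝ) = ∫ _x in (K : Set (Eucl n)), (1 : ℝ) ∧
      ∫ x in (C : Set (Eucl n)), ⟪u, x⟫ ^ 2 = ∫ x in (K : Set (Eucl n)), ⟪u, x⟫ ^ 2 := by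
  -- The condition n ≥ 2 enters here: there must be a direction orthogonal to u.
  have hne : {v : Eucl n | ‖v‖ = 1 ∧ ⟪v, u⟫ = 0}.Nonempty := by
    have hf : Module.finrank ℝ ((ℝ ∙ u)ᗮ : Submodule ℝ (Eucl n)) = n - 1 := by
      have h1 := Submodule.finrank_add_finrank_orthogonal (ℝ ∙ u : Submodule ℝ (Eucl n))
      rw [finrank_span_singleton (norm_ne_zero_iff.1 (by rw [hu]; norm_num)),
        finrank_euclideanSpace, Fintype.card_fin] at h1
      omega
    have : Nontrivial ((ℝ ∙ u)ᗮ : Submodule ℝ (Eucl n)) :=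
      Module.nontrivial_of_finrank_pos (R := ℝ) (by omega)
    obtain ⟨y, hy⟩ := exists_ne (0 : ((ℝ ∙ u)ᗮ : Submodule ℝ (Eucl n)))
    have hy' : (y : Eucl n) ≠ 0 := by simpa using hy
    refine ⟨‖(y : Eucl n)‖⁻¹ • (y : Eucl n), ?_, ?_⟩
    · rw [norm_smul, norm_inv, norm_norm, inv_mul_cancel₀ (norm_ne_zero_iff.2 hy')]
    · rw [inner_smul_left, real_inner_comm, inner_orthogonal_eq_zero y, mul_zero]
  obtain ⟨S, C, h0, hstep, hrS, hlim, hC⟩ :=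
    exists_symmetrization_limit hne (fun v hv => hv.1) K hr hrK
  have hrC : Metric.closedBall 0 r ⊆ (C : Set (Eucl n)) := fun x hx =>
    mem_of_tendsto_bodies hlim fun m => hrS m hx
  have hsS : ∀ m, ∀ x ∈ S m, -x ∈ S m := by
    intro m
    induction m with
    | zero => rw [h0]; exact hsymm
    | succ m ih =>
      obtain ⟨v, hv, hSv⟩ := hstep m
      intro x hx
      rw [← SetLike.mem_coe, hSv] at *
      exact neg_mem_steinerSet ih x hx
  have hneg : ∀ x ∈ C, -x ∈ C := by
    intro x hx
    refine closure_mem_of_forall_dist fun ε hε => ?_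
    obtain ⟨m, hm⟩ := Metric.tendsto_atTop.1 hlim (ε / 2) (by positivity)
    have hd : Metric.hausdorffDist (S m : Set (Eucl n)) (C : Set (Eucl n)) < ε / 2 := hm m le_rfl
    obtain ⟨y, hy, hyx⟩ := Metric.exists_dist_lt_of_hausdorffDist_lt' hx hd
      ConvexBody.hausdorffEDist_ne_top
    obtain ⟨z, hz, hzy⟩ := Metric.exists_dist_lt_of_hausdorffDist_lt (hsS m y hy) hd
      ConvexBody.hausdorffEDist_ne_top
    refine ⟨z, hz, ?_⟩
    have h1 : dist (-x) (-y) < ε / 2 := by rw [dist_neg_neg, dist_comm]; exact hyx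
    linarith [dist_triangle (-x) (-y) z]
  have hinv : ∀ {φ : Eucl n → ℝ}, Continuous φ →
      (∀ v : Eucl n, ⟪v, u⟫ = 0 → ∀ x, φ (hproj v x) = φ x) →
      ∀ m, ∫ x in (S m : Set (Eucl n)), φ x = ∫ x in (K : Set (Eucl n)), φ x := by
    intro φ hφ hφv m
    induction m with
    | zero => rw [h0]
    | succ m ih =>
      obtain ⟨v, hv, hSv⟩ := hstep m
      rw [hSv, setIntegral_steinerBody hv.1 (S m) hφ (hφv v hv.2), ih]
  refine ⟨C, interior_of_closedBall_subset hr hrC, ?_, ?_, ⟨S, h0, fun m => ?_, hlim⟩, ?_, ?_, ?_⟩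
  · refine Subset.antisymm (fun x hx => ?_) fun x hx => hneg x hx
    simpa using hneg _ hx
  · exact axialSymmetric_of_hrefl hu fun v hv huv z hz =>
      hC v ⟨hv, by rw [real_inner_comm]; exact huv⟩ z hz
  · obtain ⟨v, hv, hSv⟩ := hstep m
    exact Or.inl ⟨v, 0, hv.1, by rw [hSv, steinerSymmetral_eq (S m) hv.1]⟩
  · refine suppFn_eq_of_tendsto hlim hr hrS fun m => ?_
    induction m with
    | zero => rw [h0]
    | succ m ih =>
      obtain ⟨v, hv, hSv⟩ := hstep m
      rw [hSv, suppFn_steinerBody hv.1 hv.2, ih]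
  · exact setIntegral_eq_of_tendsto hlim hr hrS (d := 0) continuous_const (fun _ => zero_le_one)
      (by simp) (hinv continuous_const (by simp))
  · refine setIntegral_eq_of_tendsto hlim hr hrS (d := 2) (by fun_prop) (fun _ => sq_nonneg _)
      (fun a x => by rw [inner_smul_right]; ring) (hinv (by fun_prop) fun v hv x => ?_)
    have hv' : ⟪u, v⟫ = 0 := by rw [real_inner_comm]; exact hv
    rw [hproj, inner_sub_right, inner_smul_right, hv']
    simp

lemma exists_closedBall_subset_of_symmetric {K : ConvexBody (Eucl n)}
    (hK : (interior (K : Set (Eucl n))).Nonempty) (hsymm : ∀ x ∈ K, -x ∈ K) :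
    ∃ r > 0, Metric.closedBall 0 r ⊆ (K : Set (Eucl n)) := by
  obtain ⟨c, hc⟩ := hK
  obtain ⟨r, hr, hball⟩ := Metric.isOpen_iff.1 isOpen_interior c hc
  refine ⟨r / 2, by positivity, fun x hx => ?_⟩
  rw [mem_closedBall_zero_iff] at hx
  have h1 : c + x ∈ K := interior_subset (hball (by
    rw [mem_ball_iff_norm, add_sub_cancel_left]; linarith))
  have h2 : c - x ∈ K := interior_subset (hball (by
    rw [mem_ball_iff_norm, sub_sub_cancel_left, norm_neg]; linarith))
  have := K.convex h1 (hsymm _ h2) (by norm_num : (0 : ℝ) ≤ 1 / 2)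
    (by norm_num : (0 : ℝ) ≤ 1 / 2) (by norm_num)
  convert this using 1
  module

/-- If second moments and the support function of a body satisfy the relation valid for ellipsoids
up to a factor `mu`, then the body is `mu`-close to an ellipsoid. -/
lemma bmDist_le_of_moment {K : ConvexBody (Eucl n)}
    (hK : (interior (K : Set (Eucl n))).Nonempty) (h0 : (0 : Eucl n) ∈ K) {c mu : ℝ} (hc : 0 < c)
    (hmu : 1 ≤ mu)
    (h1 : ∀ u : Eucl n, ‖u‖ = 1 → c * suppFn K u ^ 2 * (∫ _x in (K : Set (Eucl n)), (1 : ℝ)) ≤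
      mu * ∫ x in (K : Set (Eucl n)), ⟪u, x⟫ ^ 2)
    (h2 : ∀ u : Eucl n, ‖u‖ = 1 → ∫ x in (K : Set (Eucl n)), ⟪u, x⟫ ^ 2 ≤
      mu * (c * suppFn K u ^ 2 * ∫ _x in (K : Set (Eucl n)), (1 : ℝ))) :
    ∃ (Ψ : Eucl n ≃ₗ[ℝ] Eucl n) (a b : ℝ), 0 < a ∧ a ≤ b ∧ b / a = mu ∧
      ∀ u, a * ‖Ψ u‖ ≤ suppFn K u ∧ suppFn K u ≤ b * ‖Ψ u‖ := by
  have hV := volume_integral_pos hK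
  obtain ⟨Ψ, hΨ⟩ := exists_linearEquiv_inner_sq_integral hK
  set V := ∫ _x in (K : Set (Eucl n)), (1 : ℝ)
  -- With I = ∫ ⟪u, x⟫² both hypotheses bound h² by I/(cV) up to a factor `mu` in each direction.
  -- Taking roots gives √mu on each side, so the ratio of the two constants is `mu`.
  have hs : 0 < Real.sqrt (mu * (c * V)) := Real.sqrt_pos.2 (by positivity)
  have hsq : Real.sqrt (mu * (c * V)) ^ 2 = mu * (c * V) := Real.sq_sqrt (by positivity)
  have hunit : ∀ u : Eucl n, ‖u‖ = 1 → ‖Ψ u‖ ≤ suppFn K u * Real.sqrt (mu * (c * V)) ∧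
      suppFn K u * Real.sqrt (mu * (c * V)) ≤ mu * ‖Ψ u‖ := by
    intro u hu
    have hnn := suppFn_nonneg h0 u
    have k1 := h1 u hu
    have k2 := h2 u hu
    rw [← hΨ] at k1 k2
    constructor
    · refine le_of_sq_le_sq ?_ (by positivity)
      rw [mul_pow, hsq]; linarith
    · refine le_of_sq_le_sq ?_ (by positivity)
      rw [mul_pow, mul_pow, hsq]
      nlinarith
  have hall : ∀ u : Eucl n, ‖Ψ u‖ ≤ suppFn K u * Real.sqrt (mu * (c * V)) ∧
      suppFn K u * Real.sqrt (mu * (c * V)) ≤ mu * ‖Ψ u‖ := by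
    intro u
    rcases eq_or_ne u 0 with rfl | hu
    · have : suppFn K (0 : Eucl n) = 0 := by
        have := suppFn_smul K le_rfl (0 : Eucl n)
        simpa using this
      simp [this]
    · have hn : 0 < ‖u‖ := norm_pos_iff.2 hu
      have := hunit (‖u‖⁻¹ • u) (by rw [norm_smul, norm_inv, norm_norm, inv_mul_cancel₀ hn.ne'])
      rw [suppFn_smul K (by positivity), map_smul, norm_smul, norm_inv, norm_norm] at this
      constructor
      · refine le_of_mul_le_mul_left ?_ (inv_pos.2 hn)
        linarith [this.1]
      · refine le_of_mul_le_mul_left ?_ (inv_pos.2 hn)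
        linarith [this.2]
  refine ⟨Ψ, (Real.sqrt (mu * (c * V)))⁻¹, mu / Real.sqrt (mu * (c * V)), by positivity, ?_, ?_,
    fun u => ⟨?_, ?_⟩⟩
  · rw [inv_eq_one_div]; gcongr
  · field_simp
  · rw [inv_mul_le_iff₀ hs, mul_comm]; exact (hall u).1
  · rw [div_mul_eq_mul_div, le_div_iff₀ hs]; exact (hall u).2

lemma translateBody_zero (K : ConvexBody (Eucl n)) : translateBody 0 K = K := by
  ext x; simp

/-- By contradiction: if all axial limits are nearly ellipsoids, each direction u has its own limit
`C`, and `C` shares with K the three quantities that enter the moment quotient in direction u. -/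
theorem exists_axial_body_of_symmetric (n : ℕ) (hn : 2 ≤ n) :
    ∃ γ : ℝ, 0 < γ ∧ ∀ (ε : ℝ) (K : ConvexBody (Eucl n)), 0 < ε → HasInterior K →
      1 + ε < bmDist (K : Set (Eucl n)) (unitBall n) → (∀ x ∈ K, -x ∈ K) →
      ∃ C : ConvexBody (Eucl n), HasInterior C ∧ OSymmetric (C : Set (Eucl n)) ∧
        AxialSymmetric (C : Set (Eucl n)) ∧ IsSteinerAffineLimit K C ∧
        1 + γ * ε < bmDist (C : Set (Eucl n)) (unitBall n) := by
  obtain ⟨c, hc0, -, hc⟩ := exists_ellipsoid_moment n (by omega)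
  set M : ℝ := 2 ^ (2 * n + 3) with hM
  set N : ℝ := ((n + 2 : ℕ) : ℝ) * 2 ^ (n + 2) with hN
  have hM1 : 1 ≤ M := one_le_pow₀ (by norm_num)
  have hN1 : 1 ≤ N := by
    have h1 : (1 : ℝ) ≤ ((n + 2 : ℕ) : ℝ) := by exact_mod_cast (by omega : 1 ≤ n + 2)
    have h2 : (1 : ℝ) ≤ 2 ^ (n + 2) := one_le_pow₀ (by norm_num)
    nlinarith
  -- For x = ε/(MN) the limits are within 1 + γε = 1 + x/2 < 1 + x of ellipsoids. The rough bound ε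
  -- ≤ M gives x ≤ 1, and then (1 + x)^(n+2) ≤ 1 + Nx ≤ 1 + ε because M ≥ 1.
  refine ⟨1 / (2 * M * N), by positivity, fun ε K hε hK hbm hsymm => ?_⟩
  by_contra hcon
  push Not at hcon
  obtain ⟨r, hr, hrK⟩ := exists_closedBall_subset_of_symmetric hK hsymm
  have h0K : (0 : Eucl n) ∈ K := hrK (by simpa using hr.le)
  have hεM : ε ≤ M := by linarith [bmDist_le_rough hK]
  set x : ℝ := ε / (M * N) with hx
  have hx0 : 0 < x := by positivity
  have hx1 : x ≤ 1 := by
    rw [hx, div_le_one (by positivity)]; nlinarith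
  have hmom : ∀ u : Eucl n, ‖u‖ = 1 →
      c * suppFn K u ^ 2 * (∫ _x in (K : Set (Eucl n)), (1 : ℝ)) ≤
        (1 + x) ^ (n + 2) * ∫ x in (K : Set (Eucl n)), ⟪u, x⟫ ^ 2 ∧
      ∫ x in (K : Set (Eucl n)), ⟪u, x⟫ ^ 2 ≤
        (1 + x) ^ (n + 2) * (c * suppFn K u ^ 2 * ∫ _x in (K : Set (Eucl n)), (1 : ℝ)) := by
    intro u hu
    obtain ⟨C, hCint, hCsymm, hCax, hClim, hCh, hCV, hCI⟩ := exists_axial_limit hn hr hrK hsymm hu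
    have hbmC := hcon C hCint hCsymm hCax hClim
    have hlt : bmDist (C : Set (Eucl n)) (unitBall n) < 1 + x := by
      refine hbmC.trans_lt ?_
      have : 1 / (2 * M * N) * ε = x / 2 := by rw [hx]; field_simp
      linarith
    have hCneg : ∀ y ∈ C, -y ∈ C := by
      intro y hy
      rw [← SetLike.mem_coe, ← hCsymm]
      simpa using hy
    obtain ⟨-, Φ, hΦ1, hΦ2⟩ := exists_centred_ellipsoid hCint hCneg hlt
    have := moment_of_ellipsoid hc0 hc (C.zero_mem_of_symmetric hCneg) (by linarith) hΦ1 hΦ2 u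
    rwa [hCh, hCV, hCI] at this
  obtain ⟨Ψ, a, b, ha, hab, hba, hΨ⟩ := bmDist_le_of_moment hK h0K hc0
    (one_le_pow₀ (by linarith)) (fun u hu => (hmom u hu).1) (fun u hu => (hmom u hu).2)
  have := bmDist_le_of_suppFn (K := K) 0 Ψ ha hab
    (by rw [translateBody_zero]; exact fun u => (hΨ u).1)
    (by rw [translateBody_zero]; exact fun u => (hΨ u).2)
  rw [hba] at this
  have h3 := one_add_pow_le hx0.le hx1 (n + 2)
  rw [← hN] at h3
  have h4 : N * x ≤ ε := by
    rw [hx, mul_div_assoc', div_le_iff₀ (by positivity)]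
    nlinarith [mul_pos hε (by positivity : 0 < N)]
  linarith

end OriginSymmetric

/-! ### Area of a symmetric plane body against its largest inscribed determinant. -/

section Plane

open MeasureTheory

lemma eucl_two_ext {x y : Eucl 2} (h0 : x 0 = y 0) (h1 : x 1 = y 1) : x = y := by
  ext i; fin_cases i <;> assumption

lemma inner_eucl_two (x y : Eucl 2) : ⟪x, y⟫ = x 0 * y 0 + x 1 * y 1 := by
  rw [PiLp.inner_apply, Fin.sum_univ_two]; simp [mul_comm]

lemma norm_sq_eucl_two (x : Eucl 2) : ‖x‖ ^ 2 = x 0 ^ 2 + x 1 ^ 2 := by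
  rw [EuclideanSpace.norm_sq_eq, Fin.sum_univ_two]; simp

/-- The linear map of the plane with matrix `(a, b; c, d)`. -/
noncomputable def planeMap (a b c d : ℝ) (h : a * d - b * c ≠ 0) : Eucl 2 ≃ₗ[ℝ] Eucl 2 :=
  LinearMap.equivOfDetNeZero
    (Matrix.toLin (EuclideanSpace.basisFun (Fin 2) ℝ).toBasis
      (EuclideanSpace.basisFun (Fin 2) ℝ).toBasis !![a, b; c, d])
    (by rw [LinearMap.det_toLin, Matrix.det_fin_two_of]; exact h)

lemma planeMap_coe (a b c d : ℝ) (h : a * d - b * c ≠ 0) :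
    (planeMap a b c d h : Eucl 2 →ₗ[ℝ] Eucl 2) =
    Matrix.toLin (EuclideanSpace.basisFun (Fin 2) ℝ).toBasis
      (EuclideanSpace.basisFun (Fin 2) ℝ).toBasis !![a, b; c, d] := by
  ext; rfl

lemma planeMap_det (a b c d : ℝ) (h : a * d - b * c ≠ 0) :
    LinearMap.det (planeMap a b c d h : Eucl 2 →ₗ[ℝ] Eucl 2) = a * d - b * c := by
  rw [planeMap_coe, LinearMap.det_toLin, Matrix.det_fin_two_of]

lemma planeMap_apply (a b c d : ℝ) (h : a * d - b * c ≠ 0) (z : Eucl 2) :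
    planeMap a b c d h z = !₂[a * z 0 + b * z 1, c * z 0 + d * z 1] := by
  rw [← LinearEquiv.coe_coe, planeMap_coe, Matrix.toLin_apply]
  refine eucl_two_ext ?_ ?_ <;>
  simp [Matrix.mulVec, dotProduct, Fin.sum_univ_two]

@[simp] lemma planeMap_apply_zero (a b c d : ℝ) (h : a * d - b * c ≠ 0) (z : Eucl 2) :
    planeMap a b c d h z 0 = a * z 0 + b * z 1 := by
  rw [planeMap_apply]; rfl

@[simp] lemma planeMap_apply_one (a b c d : ℝ) (h : a * d - b * c ≠ 0) (z : Eucl 2) :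
    planeMap a b c d h z 1 = c * z 0 + d * z 1 := by
  rw [planeMap_apply]; rfl

/-- The determinant of two plane vectors. -/
def planeDet (x y : Eucl 2) : ℝ := x 0 * y 1 - x 1 * y 0

lemma volume_plane {s : Set (Eucl 2)} (hs : MeasurableSet s) :
    volume s = ∫⁻ t : ℝ, volume {r : ℝ | (!₂[t, r] : Eucl 2) ∈ s} := by
  have h1 : MeasurePreserving (fun p : ℝ × ℝ => (!₂[p.1, p.2] : Eucl 2)) volume volume :=
    (EuclideanSpace.volume_preserving_symm_measurableEquiv_toLp (Fin 2)).symm.comp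
      (volume_preserving_finTwoArrow ℝ).symm
  rw [← h1.measure_preimage hs.nullMeasurableSet, Measure.volume_eq_prod,
    Measure.prod_apply (h1.measurable hs)]
  rfl

lemma volume_integral_eq {n : ℕ} (s : Set (Eucl n)) : ∫ _x in s, (1 : ℝ) = volume.real s := by simp

/-- An axis-parallel ellipse has area `π a b`. -/
lemma area_ellipse {a b : ℝ} (ha : 0 < a) (hb : 0 < b) :
    ∫ _x in {z : Eucl 2 | (z 0 / a) ^ 2 + (z 1 / b) ^ 2 ≤ 1}, (1 : ℝ) = Real.pi * a * b := by
  have h : a * b - 0 * 0 ≠ 0 := by rw [mul_zero, sub_zero]; positivity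
  have h1 : {z : Eucl 2 | (z 0 / a) ^ 2 + (z 1 / b) ^ 2 ≤ 1} =
      planeMap a 0 0 b h '' Metric.closedBall 0 1 := by
    ext z
    constructor
    · intro hz
      refine ⟨!₂[z 0 / a, z 1 / b], ?_, eucl_two_ext ?_ ?_⟩
      · rw [mem_closedBall_zero_iff, ← sq_le_one_iff₀ (norm_nonneg _), norm_sq_eucl_two]
        exact hz
      · simp; field_simp
      · simp; field_simp
    · rintro ⟨w, hw, rfl⟩
      rw [mem_closedBall_zero_iff, ← sq_le_one_iff₀ (norm_nonneg _), norm_sq_eucl_two] at hw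
      simpa [ha.ne', hb.ne'] using hw
  rw [h1, setIntegral_linearEquiv_image _ Metric.isClosed_closedBall.measurableSet, planeMap_det,
    volume_integral_eq, Measure.real, EuclideanSpace.volume_closedBall_fin_two]
  simp [abs_of_pos, ha, hb, Real.pi_pos.le]
  ring

/-- Substituting t = cos θ on (0, 1) and t = -sin θ on (-1, 0) turns both pieces into integrals over
the same quarter period, where the hypothesis bounds the sum of the integrands by 1. -/
lemma lintegral_le_pi_div_two {F : ℝ → ENNReal} (hF : Measurable F)
    (hsupp : ∀ t, 1 < |t| → F t = 0)
    (h : ∀ θ ∈ Ioo 0 (Real.pi / 2), ENNReal.ofReal (Real.sin θ) * F (Real.cos θ) +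
      ENNReal.ofReal (Real.cos θ) * F (-Real.sin θ) ≤ 1) :
    ∫⁻ t, F t ≤ ENNReal.ofReal (Real.pi / 2) := by
  have hpi := Real.pi_pos
  have h1 : ∫⁻ t, F t ≤ ∫⁻ t, (Ioo (0 : ℝ) 1 ∪ Ioo (-1) 0).indicator F t := by
    refine lintegral_mono_ae ?_
    have h3 : (volume : Measure ℝ) {-1, 0, 1} = 0 := (Set.toFinite _).measure_zero _
    filter_upwards [measure_eq_zero_iff_ae_notMem.1 h3] with t ht
    by_cases hmem : t ∈ Ioo (0 : ℝ) 1 ∪ Ioo (-1) 0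
    · rw [indicator_of_mem hmem]
    · rw [hsupp t, ]; · simp
      simp only [mem_insert_iff, mem_singleton_iff, not_or] at ht
      by_contra! hcon
      obtain ⟨h4, h5⟩ := abs_le.1 hcon
      apply hmem
      rcases lt_or_gt_of_ne ht.2.1 with h6 | h6
      · exact Or.inr ⟨lt_of_le_of_ne h4 (Ne.symm ht.1), h6⟩
      · exact Or.inl ⟨h6, lt_of_le_of_ne h5 ht.2.2⟩
  have h2 : ∫⁻ t in Ioo (0 : ℝ) 1, F t ≤
      ∫⁻ θ in Ioo 0 (Real.pi / 2), ENNReal.ofReal (Real.sin θ) * F (Real.cos θ) := by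
    have hsub : Ioo (0 : ℝ) 1 ⊆ Real.cos '' Ioo 0 (Real.pi / 2) := fun t ht =>
      ⟨Real.arccos t, ⟨Real.arccos_pos.2 ht.2, Real.arccos_lt_pi_div_two.2 ht.1⟩,
        Real.cos_arccos (by linarith [ht.1]) ht.2.le⟩
    refine (lintegral_mono_set hsub).trans ?_
    rw [lintegral_image_eq_lintegral_abs_deriv_mul measurableSet_Ioo
      (fun x _ => (Real.hasDerivAt_cos x).hasDerivWithinAt)
      (Real.injOn_cos.mono (Ioo_subset_Icc_self.trans
        (Icc_subset_Icc_right (by linarith))))]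
    refine (setLIntegral_congr_fun measurableSet_Ioo fun x hx => ?_).le
    rw [abs_neg, abs_of_pos (Real.sin_pos_of_pos_of_lt_pi hx.1 (by linarith [hx.2]))]
  have h3 : ∫⁻ t in Ioo (-1 : ℝ) 0, F t ≤
      ∫⁻ θ in Ioo 0 (Real.pi / 2), ENNReal.ofReal (Real.cos θ) * F (-Real.sin θ) := by
    have hsub : Ioo (-1 : ℝ) 0 ⊆ (fun x => -Real.sin x) '' Ioo 0 (Real.pi / 2) := fun t ht =>
      ⟨Real.arcsin (-t), ⟨Real.arcsin_pos.2 (by linarith [ht.2]),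
        Real.arcsin_lt_pi_div_two.2 (by linarith [ht.1])⟩, by
        simp only [Real.sin_arcsin (show -1 ≤ -t by linarith [ht.2]) (show -t ≤ 1 by linarith [ht.1]),
          neg_neg]⟩
    refine (lintegral_mono_set hsub).trans ?_
    rw [lintegral_image_eq_lintegral_abs_deriv_mul (f := fun x => -Real.sin x) measurableSet_Ioo
      (fun x _ => (Real.hasDerivAt_sin x).fun_neg.hasDerivWithinAt)
      (fun x hx y hy hxy => Real.injOn_sin ⟨by linarith [hx.1], hx.2.le⟩
        ⟨by linarith [hy.1], hy.2.le⟩ (neg_injective hxy))]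
    refine (setLIntegral_congr_fun measurableSet_Ioo fun x hx => ?_).le
    rw [abs_neg, abs_of_pos (Real.cos_pos_of_mem_Ioo ⟨by linarith [hx.1], hx.2⟩)]
  calc ∫⁻ t, F t ≤ ∫⁻ t in Ioo (0 : ℝ) 1 ∪ Ioo (-1) 0, F t := by
        rwa [lintegral_indicator (measurableSet_Ioo.union measurableSet_Ioo)] at h1
    _ ≤ (∫⁻ t in Ioo (0 : ℝ) 1, F t) + ∫⁻ t in Ioo (-1 : ℝ) 0, F t := lintegral_union_le _ _ _
    _ ≤ _ := add_le_add h2 h3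
    _ = ∫⁻ θ in Ioo 0 (Real.pi / 2), (ENNReal.ofReal (Real.sin θ) * F (Real.cos θ) +
          ENNReal.ofReal (Real.cos θ) * F (-Real.sin θ)) :=
        (lintegral_add_left (by fun_prop) _).symm
    _ ≤ ∫⁻ θ in Ioo 0 (Real.pi / 2), 1 := setLIntegral_mono measurable_const h
    _ = ENNReal.ofReal (Real.pi / 2) := by simp

/-- A symmetric plane body in which `e₀, e₁` span a parallelogram of maximal area has area at
most `π`. -/
lemma volume_le_pi {D : Set (Eucl 2)} (hc : Convex ℝ D) (hcl : IsClosed D)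
    (hsymm : ∀ x ∈ D, -x ∈ D) (h0 : (!₂[1, 0] : Eucl 2) ∈ D) (h1 : (!₂[0, 1] : Eucl 2) ∈ D)
    (hdet : ∀ x ∈ D, ∀ y ∈ D, planeDet x y ≤ 1) : volume D ≤ ENNReal.ofReal Real.pi := by
  have hdet' : ∀ x ∈ D, ∀ y ∈ D, |planeDet x y| ≤ 1 := by
    intro x hx y hy
    refine abs_le'.2 ⟨hdet x hx y hy, ?_⟩
    have := hdet (-x) (hsymm x hx) y hy
    simp only [planeDet, PiLp.neg_apply] at this ⊢
    linarith
  set H : Set (Eucl 2) := D ∩ {z | 0 ≤ z 1} with hH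
  have hHcl : IsClosed H := hcl.inter (isClosed_le continuous_const (by fun_prop))
  have hDH : volume D ≤ volume H + volume H := by
    have : D ⊆ H ∪ -H := by
      intro x hx
      rcases le_total 0 (x 1) with h | h
      · exact Or.inl ⟨hx, h⟩
      · exact Or.inr ⟨hsymm x hx, by simpa using h⟩
    refine (measure_mono this).trans ((measure_union_le _ _).trans ?_)
    rw [Measure.measure_neg]
  set F : ℝ → ENNReal := fun t => volume {r : ℝ | (!₂[t, r] : Eucl 2) ∈ H} with hF
  have hcont : Continuous fun p : ℝ × ℝ => (!₂[p.1, p.2] : Eucl 2) := by fun_prop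
  have hFm : Measurable F :=
    measurable_measure_prodMk_left (hHcl.preimage hcont).measurableSet
  have hsupp : ∀ t, 1 < |t| → F t = 0 := by
    intro t ht
    have : {r : ℝ | (!₂[t, r] : Eucl 2) ∈ H} = ∅ := by
      refine eq_empty_of_forall_notMem fun r hr => ?_
      have := hdet' _ hr.1 _ h1
      simp [planeDet] at this
      linarith
    simp only [hF, this, measure_empty]
  have hmax : ∀ t, |t| ≤ 1 → ∃ r, 0 ≤ r ∧ (!₂[t, r] : Eucl 2) ∈ D ∧ F t ≤ ENNReal.ofReal r := by
    intro t ht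
    have hcpt : IsCompact {r : ℝ | (!₂[t, r] : Eucl 2) ∈ H} := by
      refine (isCompact_Icc (a := (0 : ℝ)) (b := 1)).of_isClosed_subset
        (hHcl.preimage (by fun_prop)) fun r hr => ⟨hr.2, ?_⟩
      have := (abs_le.1 (hdet' _ h0 _ hr.1)).2
      simpa [planeDet] using this
    have hne : {r : ℝ | (!₂[t, r] : Eucl 2) ∈ H}.Nonempty := by
      refine ⟨0, ?_, by simp⟩
      obtain ⟨h4, h5⟩ := abs_le.1 ht
      have := hc h0 (hsymm _ h0) (by linarith : 0 ≤ (1 + t) / 2) (by linarith : 0 ≤ (1 - t) / 2)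
        (by ring)
      convert this using 1
      refine eucl_two_ext ?_ ?_ <;> simp; ring
    obtain ⟨r, hr, hrmax⟩ := hcpt.exists_isGreatest hne
    refine ⟨r, hr.2, hr.1, ?_⟩
    calc F t ≤ volume (Icc 0 r) := measure_mono fun s hs => ⟨hs.2, hrmax hs⟩
      _ = ENNReal.ofReal r := by simp
  have hlin : ∫⁻ t, F t ≤ ENNReal.ofReal (Real.pi / 2) := by
    refine lintegral_le_pi_div_two hFm hsupp fun θ hθ => ?_
    have hs : 0 ≤ Real.sin θ := Real.sin_nonneg_of_nonneg_of_le_pi hθ.1.le (by linarith [hθ.2, hθ.1])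
    have hcs : 0 ≤ Real.cos θ :=
      Real.cos_nonneg_of_neg_pi_div_two_le_of_le (by linarith [hθ.1, hθ.2]) hθ.2.le
    obtain ⟨r, hr0, hrD, hr⟩ := hmax (Real.cos θ) (Real.abs_cos_le_one θ)
    obtain ⟨s, hs0, hsD, hs'⟩ := hmax (-Real.sin θ) (by rw [abs_neg]; exact Real.abs_sin_le_one θ)
    -- The determinant of (cos θ, r) and (-sin θ, s) is r sin θ + s cos θ, exactly the combination
    -- to be bounded by 1.
    have := hdet _ hrD _ hsD
    simp only [planeDet, Matrix.cons_val_zero, Matrix.cons_val_one] at this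
    calc _ ≤ ENNReal.ofReal (Real.sin θ) * ENNReal.ofReal r +
          ENNReal.ofReal (Real.cos θ) * ENNReal.ofReal s := by gcongr
      _ = ENNReal.ofReal (Real.sin θ * r + Real.cos θ * s) := by
        rw [ENNReal.ofReal_add (by positivity) (by positivity), ENNReal.ofReal_mul hs,
          ENNReal.ofReal_mul hcs]
      _ ≤ 1 := by
        rw [ENNReal.ofReal_le_one]; linarith
  rw [volume_plane hHcl.measurableSet] at hDH
  refine hDH.trans ((add_le_add hlin hlin).trans ?_)
  rw [← ENNReal.ofReal_add (by positivity) (by positivity), add_halves]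

/-- A symmetric plane body has area at most `π` times that of a maximal spanned parallelogram. -/
lemma area_le_of_planeDet_le {D : ConvexBody (Eucl 2)}
    (hD : (interior (D : Set (Eucl 2))).Nonempty) (hsymm : ∀ x ∈ D, -x ∈ D) {M : ℝ}
    (hM : ∀ x ∈ D, ∀ y ∈ D, planeDet x y ≤ M) :
    ∫ _x in (D : Set (Eucl 2)), (1 : ℝ) ≤ Real.pi * M := by
  obtain ⟨⟨x, y⟩, ⟨hx, hy⟩, hmax⟩ := (D.isCompact.prod D.isCompact).exists_isMaxOn
    (D.nonempty.prod D.nonempty) (f := fun p : Eucl 2 × Eucl 2 => planeDet p.1 p.2)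
    (by unfold planeDet; fun_prop)
  have hxy : ∀ z ∈ D, ∀ w ∈ D, planeDet z w ≤ planeDet x y := fun z hz w hw =>
    hmax (a := (z, w)) ⟨hz, hw⟩
  obtain ⟨r, hr, hball⟩ := exists_closedBall_subset_of_symmetric hD hsymm
  have hpos : 0 < planeDet x y := by
    have h0 : (!₂[r, 0] : Eucl 2) ∈ D := hball (by
      rw [mem_closedBall_zero_iff, ← sq_le_sq₀ (norm_nonneg _) hr.le, norm_sq_eucl_two]; simp)
    have h1 : (!₂[0, r] : Eucl 2) ∈ D := hball (by
      rw [mem_closedBall_zero_iff, ← sq_le_sq₀ (norm_nonneg _) hr.le, norm_sq_eucl_two]; simp)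
    have := hxy _ h0 _ h1
    simp only [planeDet, Matrix.cons_val_zero, Matrix.cons_val_one] at this ⊢
    nlinarith
  have hne : x 0 * y 1 - y 0 * x 1 ≠ 0 := by
    unfold planeDet at hpos; rw [mul_comm (y 0)]; exact hpos.ne'
  -- `T` maps the standard basis to a maximising pair, so its preimage of D is normalised as
  -- `volume_le_pi` requires.
  set T := planeMap (x 0) (y 0) (x 1) (y 1) hne with hT
  have hdetT : ∀ z w, planeDet (T z) (T w) = planeDet x y * planeDet z w := by
    intro z w
    simp only [planeDet, hT, planeMap_apply_zero, planeMap_apply_one]; ring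
  have hcl : IsClosed (T ⁻¹' (D : Set (Eucl 2))) :=
    D.isClosed.preimage T.toContinuousLinearEquiv.continuous
  have hle : volume (T ⁻¹' (D : Set (Eucl 2))) ≤ ENNReal.ofReal Real.pi := by
    refine volume_le_pi ?_ hcl (fun z hz => ?_) ?_ ?_ fun z hz w hw => ?_
    · exact D.convex.linear_preimage (T : Eucl 2 →ₗ[ℝ] Eucl 2)
    · rw [mem_preimage, map_neg]; exact hsymm _ hz
    · rw [mem_preimage]
      convert hx using 1
      refine eucl_two_ext ?_ ?_ <;> simp [hT]
    · rw [mem_preimage]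
      convert hy using 1
      refine eucl_two_ext ?_ ?_ <;> simp [hT]
    · have := hxy _ hz _ hw
      rw [hdetT] at this
      exact le_of_mul_le_mul_left (by linarith) hpos
  have himg : (D : Set (Eucl 2)) = T '' (T ⁻¹' (D : Set (Eucl 2))) :=
    (image_preimage_eq _ T.surjective).symm
  rw [himg, setIntegral_linearEquiv_image _ hcl.measurableSet, planeMap_det,
    volume_integral_eq]
  have h5 : x 0 * y 1 - y 0 * x 1 = planeDet x y := by unfold planeDet; ring
  rw [h5, abs_of_pos hpos, mul_comm]
  have h6 : volume.real (T ⁻¹' (D : Set (Eucl 2))) ≤ Real.pi :=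
    ENNReal.toReal_le_of_le_ofReal Real.pi_pos.le hle
  exact mul_le_mul h6 (hM x hx y hy) hpos.le Real.pi_pos.le

end Plane

/-! ### The half-difference body and its support function. -/

section DifferenceBody

open MeasureTheory

variable {n : ℕ}

/-- The half-difference body `(K - K) / 2`. -/
noncomputable def diffBody (K : ConvexBody (Eucl n)) : ConvexBody (Eucl n) :=
  (1 / 2 : ℝ) • (K + linearImage (-LinearMap.id) K)

lemma mem_diffBody {K : ConvexBody (Eucl n)} {z : Eucl n} :
    z ∈ diffBody K ↔ ∃ x ∈ K, ∃ y ∈ K, z = (1 / 2 : ℝ) • (x - y) := by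
  rw [← SetLike.mem_coe, diffBody, ConvexBody.coe_smul, ConvexBody.coe_add, coe_linearImage,
    Set.mem_smul_set]
  constructor
  · rintro ⟨_, ⟨x, hx, _, ⟨y, hy, rfl⟩, rfl⟩, rfl⟩
    exact ⟨x, hx, y, hy, by simp [sub_eq_add_neg]⟩
  · rintro ⟨x, hx, y, hy, rfl⟩
    exact ⟨x - y, ⟨x, hx, -y, ⟨y, hy, by simp⟩, by simp [sub_eq_add_neg]⟩, rfl⟩

lemma neg_mem_diffBody {K : ConvexBody (Eucl n)} {z : Eucl n} (hz : z ∈ diffBody K) :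
    -z ∈ diffBody K := by
  obtain ⟨x, hx, y, hy, rfl⟩ := mem_diffBody.1 hz
  exact mem_diffBody.2 ⟨y, hy, x, hx, by rw [← smul_neg, neg_sub]⟩

lemma zero_mem_diffBody (K : ConvexBody (Eucl n)) : (0 : Eucl n) ∈ diffBody K := by
  obtain ⟨x, hx⟩ := K.nonempty
  exact mem_diffBody.2 ⟨x, hx, x, hx, by simp⟩

lemma suppFn_diffBody (K : ConvexBody (Eucl n)) (u : Eucl n) :
    suppFn (diffBody K) u = (suppFn K u + suppFn K (-u)) / 2 := by
  apply le_antisymm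
  · refine suppFn_le _ fun z hz => ?_
    obtain ⟨x, hx, y, hy, rfl⟩ := mem_diffBody.1 hz
    have h1 := inner_le_suppFn K u hx
    have h2 := inner_le_suppFn K (-u) hy
    rw [inner_neg_left] at h2
    rw [inner_smul_right, inner_sub_right]
    linarith
  · obtain ⟨x, hx, hxu⟩ := exists_inner_eq_suppFn K u
    obtain ⟨y, hy, hyu⟩ := exists_inner_eq_suppFn K (-u)
    have := inner_le_suppFn (diffBody K) u (mem_diffBody.2 ⟨x, hx, y, hy, rfl⟩)
    rw [inner_smul_right, inner_sub_right] at this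
    rw [inner_neg_left] at hyu
    linarith

lemma diffBody_linearImage {m : ℕ} (T : Eucl n →ₗ[ℝ] Eucl m) (K : ConvexBody (Eucl n)) :
    diffBody (linearImage T K) = linearImage T (diffBody K) := by
  ext z
  rw [SetLike.mem_coe, mem_diffBody]
  constructor
  · rintro ⟨_, ⟨x, hx, rfl⟩, _, ⟨y, hy, rfl⟩, rfl⟩
    exact ⟨_, mem_diffBody.2 ⟨x, hx, y, hy, rfl⟩, by simp⟩
  · rintro ⟨_, hw, rfl⟩
    obtain ⟨x, hx, y, hy, rfl⟩ := mem_diffBody.1 hw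
    exact ⟨T x, ⟨x, hx, rfl⟩, T y, ⟨y, hy, rfl⟩, by simp⟩

lemma interior_diffBody {K : ConvexBody (Eucl n)} (hK : (interior (K : Set (Eucl n))).Nonempty) :
    (interior (diffBody K : Set (Eucl n))).Nonempty := by
  obtain ⟨c, hc⟩ := hK
  obtain ⟨r, hr, hball⟩ := Metric.isOpen_iff.1 isOpen_interior c hc
  refine interior_of_closedBall_subset (r := r / 4) (by positivity) fun z hz => ?_
  rw [mem_closedBall_zero_iff] at hz
  refine mem_diffBody.2 ⟨c + (2 : ℝ) • z, interior_subset (hball ?_), c,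
    interior_subset hc, by simp⟩
  rw [mem_ball_iff_norm, add_sub_cancel_left, norm_smul]
  norm_num; linarith

lemma interior_linearImage {K : ConvexBody (Eucl n)}
    (hK : (interior (K : Set (Eucl n))).Nonempty) {m : ℕ} {T : Eucl n →ₗ[ℝ] Eucl m}
    (hT : Function.Surjective T) : (interior (linearImage T K : Set (Eucl m))).Nonempty := by
  have hopen : IsOpenMap T := LinearMap.isOpenMap_of_finiteDimensional T hT
  exact (hK.image T).mono ((hopen.image_interior_subset _))

end DifferenceBody

/-! ### Plane bodies whose symmetral in both axes is nearly an ellipse. -/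

section NearEllipse

open MeasureTheory

/-- The `i`-th standard unit vector. -/
noncomputable def stdVec {n : ℕ} (i : Fin n) : Eucl n := EuclideanSpace.single i 1

lemma norm_stdVec {n : ℕ} (i : Fin n) : ‖stdVec i‖ = 1 := by simp [stdVec]

lemma inner_stdVec {n : ℕ} (i : Fin n) (x : Eucl n) : ⟪stdVec i, x⟫ = x i := by
  simp [stdVec, EuclideanSpace.inner_single_left]

lemma hproj_stdVec_add {n : ℕ} (i : Fin n) (x : Eucl n) (s : ℝ) (j : Fin n) :
    (hproj (stdVec i) x + s • stdVec i) j = if j = i then s else x j := by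
  simp only [hproj, inner_stdVec]; simp only [stdVec]
  by_cases h : j = i
  · subst h; simp
  · simp [h]

lemma mem_steinerSet_one {Q : Set (Eucl 2)} {z : Eucl 2} :
    z ∈ steinerSet (stdVec 1) Q ↔ ∃ r s : ℝ, (!₂[z 0, r] : Eucl 2) ∈ Q ∧
      (!₂[z 0, s] : Eucl 2) ∈ Q ∧ 2 * |z 1| ≤ s - r := by
  have h : ∀ s : ℝ, hproj (stdVec 1) z + s • stdVec 1 = (!₂[z 0, s] : Eucl 2) := fun s =>
    eucl_two_ext (by rw [hproj_stdVec_add]; simp) (by rw [hproj_stdVec_add]; simp)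
  simp only [steinerSet, mem_ofPred_eq, h, inner_stdVec]

lemma mem_steinerSet_zero {Q : Set (Eucl 2)} {z : Eucl 2} :
    z ∈ steinerSet (stdVec 0) Q ↔ ∃ r s : ℝ, (!₂[r, z 1] : Eucl 2) ∈ Q ∧
      (!₂[s, z 1] : Eucl 2) ∈ Q ∧ 2 * |z 0| ≤ s - r := by
  have h : ∀ s : ℝ, hproj (stdVec 0) z + s • stdVec 0 = (!₂[s, z 1] : Eucl 2) := fun s =>
    eucl_two_ext (by rw [hproj_stdVec_add]; simp) (by rw [hproj_stdVec_add]; simp)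
  simp only [steinerSet, mem_ofPred_eq, h, inner_stdVec]

/-- Symmetrization of a plane body with respect to both coordinate axes. -/
noncomputable def doubleSym (Q : ConvexBody (Eucl 2)) : ConvexBody (Eucl 2) :=
  steinerBody (stdVec 0) (norm_stdVec 0) (steinerBody (stdVec 1) (norm_stdVec 1) Q)

lemma mem_doubleSym {Q : ConvexBody (Eucl 2)} {z : Eucl 2} : z ∈ doubleSym Q ↔
    z ∈ steinerSet (stdVec 0) (steinerSet (stdVec 1) (Q : Set (Eucl 2))) := Iff.rfl

/-- The double symmetral of `Q` lies between the ellipse `E` with half-axes `a, b` and `lam⁻¹ E`. -/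
structure IsNearEllipse (lam a b : ℝ) (Q : ConvexBody (Eucl 2)) : Prop where
  one_le : 1 ≤ lam
  pos_left : 0 < a
  pos_right : 0 < b
  subset : ∀ z ∈ doubleSym Q, (z 0 / a) ^ 2 + (z 1 / b) ^ 2 ≤ 1
  superset : ∀ z : Eucl 2, (z 0 / a) ^ 2 + (z 1 / b) ^ 2 ≤ 1 → lam⁻¹ • z ∈ doubleSym Q

variable {lam a b : ℝ} {Q : ConvexBody (Eucl 2)}

/-- Two points of Q at horizontal distance d put a point of the double symmetral at abscissa d/2 on
the first axis. -/
lemma IsNearEllipse.width_le (h : IsNearEllipse lam a b Q) {p q : Eucl 2} (hp : p ∈ Q)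
    (hq : q ∈ Q) : p 0 - q 0 ≤ 2 * a := by
  have ha := h.pos_left
  rcases le_or_gt (p 0) (q 0) with hle | hlt
  · linarith
  have h1 : ∀ x ∈ Q, (!₂[x 0, 0] : Eucl 2) ∈ steinerSet (stdVec 1) (Q : Set (Eucl 2)) := by
    intro x hx
    have : (!₂[x 0, x 1] : Eucl 2) = x := eucl_two_ext rfl rfl
    exact mem_steinerSet_one.2 ⟨x 1, x 1, by simpa [this] using hx, by simpa [this] using hx, by simp⟩
  have h2 := h.subset !₂[(p 0 - q 0) / 2, 0] (mem_doubleSym.2 (mem_steinerSet_zero.2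
    ⟨q 0, p 0, by simpa using h1 q hq, by simpa using h1 p hp, by
      simp only [Matrix.cons_val_zero]; rw [abs_of_pos (by linarith)]; linarith⟩))
  simp only [Matrix.cons_val_zero, Matrix.cons_val_one, zero_div, ne_eq, OfNat.ofNat_ne_zero,
    not_false_eq_true, zero_pow, add_zero] at h2
  have h3 := (sq_le_one_iff_abs_le_one _).1 h2
  have h4 := (abs_le.1 h3).2
  rw [div_le_one ha] at h4
  linarith

lemma IsNearEllipse.chord_le (h : IsNearEllipse lam a b Q) {p q : Eucl 2} (hp : p ∈ Q)
    (hq : q ∈ Q) (hpq : p 0 = q 0) : p 1 - q 1 ≤ 2 * b := by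
  have hb := h.pos_right
  rcases le_or_gt (p 1) (q 1) with hle | hlt
  · linarith
  have h1 : (!₂[p 0, (p 1 - q 1) / 2] : Eucl 2) ∈ steinerSet (stdVec 1) (Q : Set (Eucl 2)) := by
    have e1 : (!₂[p 0, p 1] : Eucl 2) = p := eucl_two_ext rfl rfl
    have e2 : (!₂[p 0, q 1] : Eucl 2) = q := eucl_two_ext hpq rfl
    refine mem_steinerSet_one.2 ⟨q 1, p 1, by simpa [e2] using hq, by simpa [e1] using hp, ?_⟩
    simp only [Matrix.cons_val_one, Matrix.cons_val_zero]; rw [abs_of_pos (by linarith)]; linarith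
  have h2 := h.subset !₂[0, (p 1 - q 1) / 2] (mem_doubleSym.2 (mem_steinerSet_zero.2
    ⟨p 0, p 0, by simpa using h1, by simpa using h1, by simp⟩))
  simp only [Matrix.cons_val_zero, Matrix.cons_val_one, zero_div, ne_eq, OfNat.ofNat_ne_zero,
    not_false_eq_true, zero_pow, zero_add] at h2
  have h3 := (sq_le_one_iff_abs_le_one _).1 h2
  have h4 := (abs_le.1 h3).2
  rw [div_le_one hb] at h4
  linarith

/-- A near-ellipse contains parallelograms with two vertical sides, with the dimensions of
inscribed rectangles of the ellipse. -/
lemma IsNearEllipse.exists_parallelogram (h : IsNearEllipse lam a b Q) {c s : ℝ} (hc : 0 ≤ c)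
    (hs : 0 ≤ s) (hcs : c ^ 2 + s ^ 2 = 1) :
    ∃ x y w : ℝ, (!₂[x, y] : Eucl 2) ∈ Q ∧ (!₂[x, y + 2 * (b * s / lam)] : Eucl 2) ∈ Q ∧
      (!₂[x + 2 * (a * c / lam), w] : Eucl 2) ∈ Q ∧
      (!₂[x + 2 * (a * c / lam), w + 2 * (b * s / lam)] : Eucl 2) ∈ Q := by
  have ha := h.pos_left
  have hb := h.pos_right
  have hl : 0 < lam := by linarith [h.one_le]
  have h1 := h.superset !₂[a * c, b * s] (by
    simp only [Matrix.cons_val_zero, Matrix.cons_val_one]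
    rw [mul_div_cancel_left₀ _ ha.ne', mul_div_cancel_left₀ _ hb.ne', hcs])
  have hy : 0 ≤ b * s / lam := by positivity
  have hx : 0 ≤ a * c / lam := by positivity
  obtain ⟨r, t, hr, ht, hrt⟩ := mem_steinerSet_zero.1 (mem_doubleSym.1 h1)
  have e1 : (lam⁻¹ • (!₂[a * c, b * s] : Eucl 2)) 0 = a * c / lam := by
    simp [div_eq_inv_mul]
  have e2 : (lam⁻¹ • (!₂[a * c, b * s] : Eucl 2)) 1 = b * s / lam := by
    simp [div_eq_inv_mul]
  rw [e1, abs_of_nonneg hx] at hrt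
  rw [e2] at hr ht
  have hQ' : Convex ℝ (steinerSet (stdVec 1) (Q : Set (Eucl 2))) := Q.convex.steinerSet _
  -- The chord supplied by the symmetral may be too long; convexity cuts it to the prescribed
  -- length.
  have hmem : (!₂[r + 2 * (a * c / lam), b * s / lam] : Eucl 2) ∈
      steinerSet (stdVec 1) (Q : Set (Eucl 2)) := by
    have := line_mem_of_convex hQ' (y := !₂[0, b * s / lam]) (u := stdVec 0) (s := r) (t := t)
      (r := r + 2 * (a * c / lam)) (by convert hr using 1; refine eucl_two_ext ?_ ?_ <;> simp [stdVec])
      (by convert ht using 1; refine eucl_two_ext ?_ ?_ <;> simp [stdVec])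
      ⟨by linarith, by linarith⟩
    convert this using 1
    refine eucl_two_ext ?_ ?_ <;> simp [stdVec]
  have key : ∀ x : ℝ, (!₂[x, b * s / lam] : Eucl 2) ∈ steinerSet (stdVec 1) (Q : Set (Eucl 2)) →
      ∃ y, (!₂[x, y] : Eucl 2) ∈ Q ∧ (!₂[x, y + 2 * (b * s / lam)] : Eucl 2) ∈ Q := by
    intro x hxm
    obtain ⟨y, y', h3, h4, h5⟩ := mem_steinerSet_one.1 hxm
    simp only [Matrix.cons_val_zero, Matrix.cons_val_one] at h3 h4 h5
    rw [abs_of_nonneg hy] at h5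
    refine ⟨y, h3, ?_⟩
    have := line_mem_of_convex Q.convex (y := !₂[x, 0]) (u := stdVec 1) (s := y) (t := y')
      (r := y + 2 * (b * s / lam)) (by convert h3 using 1; refine eucl_two_ext ?_ ?_ <;> simp [stdVec])
      (by convert h4 using 1; refine eucl_two_ext ?_ ?_ <;> simp [stdVec])
      ⟨by linarith, by linarith⟩
    rw [← SetLike.mem_coe]
    convert this using 1
    refine eucl_two_ext ?_ ?_ <;> simp [stdVec]
  obtain ⟨y, hy1, hy2⟩ := key _ hr
  obtain ⟨w, hw1, hw2⟩ := key _ hmem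
  exact ⟨r, y, w, hy1, hy2, hw1, hw2⟩

lemma area_doubleSym (Q : ConvexBody (Eucl 2)) :
    ∫ _x in (doubleSym Q : Set (Eucl 2)), (1 : ℝ) = ∫ _x in (Q : Set (Eucl 2)), (1 : ℝ) := by
  rw [doubleSym, coe_steinerBody, setIntegral_steinerBody (norm_stdVec 0) _ continuous_const
    (by simp), coe_steinerBody,
    setIntegral_steinerBody (norm_stdVec 1) _ continuous_const (by simp)]

lemma IsNearEllipse.subset_ellBody (h : IsNearEllipse lam a b Q) :
    ∃ Φ : Eucl 2 ≃ₗ[ℝ] Eucl 2, (doubleSym Q : Set (Eucl 2)) ⊆ ellBody Φ ∧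
      (ellBody Φ : Set (Eucl 2)) ⊆ lam • (doubleSym Q : Set (Eucl 2)) ∧
      (ellBody Φ : Set (Eucl 2)) = {z : Eucl 2 | (z 0 / a) ^ 2 + (z 1 / b) ^ 2 ≤ 1} := by
  have ha := h.pos_left
  have hb := h.pos_right
  have hl : 0 < lam := by linarith [h.one_le]
  have hab : a⁻¹ * b⁻¹ - 0 * 0 ≠ 0 := by rw [mul_zero, sub_zero]; positivity
  have hE : (ellBody (planeMap a⁻¹ 0 0 b⁻¹ hab).symm : Set (Eucl 2)) =
      {z : Eucl 2 | (z 0 / a) ^ 2 + (z 1 / b) ^ 2 ≤ 1} := by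
    ext z
    rw [SetLike.mem_coe, mem_ellBody, ← sq_le_one_iff₀ (norm_nonneg _), norm_sq_eucl_two]
    simp [div_eq_inv_mul]
  refine ⟨_, ?_, ?_, hE⟩
  · rw [hE]; exact h.subset
  · rw [hE]
    exact fun z hz => (Set.mem_smul_set_iff_inv_smul_mem₀ hl.ne' _ _).2 (h.superset z hz)

lemma IsNearEllipse.area (h : IsNearEllipse lam a b Q) :
    ∫ _x in (Q : Set (Eucl 2)), (1 : ℝ) ≤ Real.pi * a * b ∧
      Real.pi * a * b ≤ lam ^ 2 * ∫ _x in (Q : Set (Eucl 2)), (1 : ℝ) := by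
  have hl : 0 < lam := by linarith [h.one_le]
  obtain ⟨Φ, h1, h2, h3⟩ := h.subset_ellBody
  rw [← area_ellipse h.pos_left h.pos_right, ← h3, ← area_doubleSym]
  exact ⟨setIntegral_mono_body continuous_const (fun _ => zero_le_one) h1,
    setIntegral_le_of_subset_smul (d := 0) continuous_const (fun _ => zero_le_one) (by simp) hl h2⟩

end NearEllipse

/-! ### The half-difference body of such a plane body is nearly an ellipse. -/

section PlaneDifference

open MeasureTheory

lemma linearImage_linearImage {l m n : ℕ} (S : Eucl m →ₗ[ℝ] Eucl n) (T : Eucl l →ₗ[ℝ] Eucl m)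
    (K : ConvexBody (Eucl l)) : linearImage S (linearImage T K) = linearImage (S ∘ₗ T) K := by
  apply SetLike.coe_injective
  simp [image_image]

lemma integral_linearImage_one {n : ℕ} (T : Eucl n ≃ₗ[ℝ] Eucl n) (K : ConvexBody (Eucl n)) :
    ∫ _x in (linearImage (T : Eucl n →ₗ[ℝ] Eucl n) K : Set (Eucl n)), (1 : ℝ) =
      |LinearMap.det (T : Eucl n →ₗ[ℝ] Eucl n)| * ∫ _x in (K : Set (Eucl n)), (1 : ℝ) :=
  setIntegral_linearEquiv_image T K.isCompact.measurableSet _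

/-- All linear images of `Q` have nearly elliptic double symmetrals. -/
def AllNearEllipse (lam : ℝ) (Q : ConvexBody (Eucl 2)) : Prop :=
  ∀ T : Eucl 2 ≃ₗ[ℝ] Eucl 2,
    ∃ a b, IsNearEllipse lam a b (linearImage (T : Eucl 2 →ₗ[ℝ] Eucl 2) Q)

variable {lam a b : ℝ} {Q : ConvexBody (Eucl 2)}

lemma AllNearEllipse.image (h : AllNearEllipse lam Q) (T : Eucl 2 ≃ₗ[ℝ] Eucl 2) :
    AllNearEllipse lam (linearImage (T : Eucl 2 →ₗ[ℝ] Eucl 2) Q) := fun S => by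
  rw [linearImage_linearImage]
  exact h (T.trans S)

/-- Apply the map T of determinant 1 that sends x to (0, 1) and has -det(x, ·) as first coordinate.
A chord of Q parallel to x becomes vertical of length 2, so b ≥ 1; the width bound gives det(x, y) ≤
a; and πab ≤ λ² V(Q). -/
lemma AllNearEllipse.planeDet_le (h : AllNearEllipse lam Q) {x y : Eucl 2} (hx : x ∈ diffBody Q)
    (hy : y ∈ diffBody Q) :
    planeDet x y ≤ lam ^ 2 * (∫ _x in (Q : Set (Eucl 2)), (1 : ℝ)) / Real.pi := by
  have hA : 0 ≤ ∫ _x in (Q : Set (Eucl 2)), (1 : ℝ) := integral_nonneg fun _ => zero_le_one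
  have hpi := Real.pi_pos
  by_cases hx0 : x = 0
  · subst hx0
    simp only [planeDet, PiLp.zero_apply, zero_mul, sub_self]
    positivity
  have hN : 0 < x 0 ^ 2 + x 1 ^ 2 := by
    rw [← norm_sq_eucl_two]; have := norm_pos_iff.2 hx0; positivity
  obtain ⟨N, hNdef⟩ : ∃ N, N = x 0 ^ 2 + x 1 ^ 2 := ⟨_, rfl⟩
  rw [← hNdef] at hN
  have hdet : x 1 * (x 1 / N) - (-x 0) * (x 0 / N) = 1 := by
    field_simp; linarith
  set T := planeMap (x 1) (-x 0) (x 0 / N) (x 1 / N) (by rw [hdet]; exact one_ne_zero) with hT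
  obtain ⟨a, b, hab⟩ := h T
  have harea := hab.area.2
  rw [integral_linearImage_one, hT, planeMap_det, hdet, abs_one, one_mul] at harea
  obtain ⟨p, hp, p', hp', hxp⟩ := mem_diffBody.1 hx
  obtain ⟨q, hq, q', hq', hyq⟩ := mem_diffBody.1 hy
  have hx0' : x 0 = (p 0 - p' 0) / 2 := by rw [hxp]; simp; ring
  have hx1' : x 1 = (p 1 - p' 1) / 2 := by rw [hxp]; simp; ring
  have hy0' : y 0 = (q 0 - q' 0) / 2 := by rw [hyq]; simp; ring
  have hy1' : y 1 = (q 1 - q' 1) / 2 := by rw [hyq]; simp; ring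
  have hb : 2 ≤ 2 * b := by
    refine le_trans (le_of_eq ?_) (hab.chord_le (p := T p) (q := T p') ⟨p, hp, rfl⟩ ⟨p', hp', rfl⟩ ?_)
    · simp only [hT, planeMap_apply_one]
      have : x 0 / N * p 0 + x 1 / N * p 1 - (x 0 / N * p' 0 + x 1 / N * p' 1) =
        2 * (x 0 / N * ((p 0 - p' 0) / 2) + x 1 / N * ((p 1 - p' 1) / 2)) := by ring
      rw [this, ← hx0', ← hx1']
      field_simp; linarith
    · simp only [hT, planeMap_apply_zero]
      have : x 1 * (p 0 - p' 0) = x 0 * (p 1 - p' 1) := by rw [hx0', hx1']; ring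
      linarith
  have ha := hab.width_le (p := T q') (q := T q) ⟨q', hq', rfl⟩ ⟨q, hq, rfl⟩
  have ha' : planeDet x y ≤ a := by
    simp only [hT, planeMap_apply_zero] at ha
    simp only [planeDet, hy0', hy1']
    linarith
  rw [le_div_iff₀ hpi]
  have : a ≤ a * b := le_mul_of_one_le_right hab.pos_left.le (by linarith)
  nlinarith

lemma AllNearEllipse.area_diffBody_le (h : AllNearEllipse lam Q)
    (hQ : (interior (Q : Set (Eucl 2))).Nonempty) :
    ∫ _x in (diffBody Q : Set (Eucl 2)), (1 : ℝ) ≤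
      lam ^ 2 * ∫ _x in (Q : Set (Eucl 2)), (1 : ℝ) := by
  refine (area_le_of_planeDet_le (interior_diffBody hQ) (fun x => neg_mem_diffBody)
    fun x hx y hy => h.planeDet_le hx hy).trans (le_of_eq ?_)
  field_simp

/-- Two vertical chords of Q at abscissae r and s, each of length at least 2|z₁|, have as
half-differences vertical chords of D at ±(s - r)/2 of at least the same length. Convexity covers
the abscissae in between. -/
lemma doubleSym_subset (Q : ConvexBody (Eucl 2)) :
    (doubleSym Q : Set (Eucl 2)) ⊆ steinerBody (stdVec 1) (norm_stdVec 1) (diffBody Q) := by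
  intro z hz
  obtain ⟨r, s, hr, hs, hrs⟩ := mem_steinerSet_zero.1 (mem_doubleSym.1 hz)
  obtain ⟨y₁, y₂, hy₁, hy₂, hy⟩ := mem_steinerSet_one.1 hr
  obtain ⟨w₁, w₂, hw₁, hw₂, hw⟩ := mem_steinerSet_one.1 hs
  simp only [Matrix.cons_val_zero, Matrix.cons_val_one] at *
  rw [coe_steinerBody]
  have h1 : (!₂[(s - r) / 2, z 1] : Eucl 2) ∈ steinerSet (stdVec 1) (diffBody Q : Set (Eucl 2)) := by
    refine mem_steinerSet_one.2 ⟨(w₁ - y₂) / 2, (w₂ - y₁) / 2, mem_diffBody.2 ⟨_, hw₁, _, hy₂, ?_⟩,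
      mem_diffBody.2 ⟨_, hw₂, _, hy₁, ?_⟩, ?_⟩
    · refine eucl_two_ext ?_ ?_ <;> simp <;> ring
    · refine eucl_two_ext ?_ ?_ <;> simp <;> ring
    · simp only [Matrix.cons_val_one, Matrix.cons_val_zero]; linarith
  have h2 : (!₂[-((s - r) / 2), z 1] : Eucl 2) ∈
      steinerSet (stdVec 1) (diffBody Q : Set (Eucl 2)) := by
    refine mem_steinerSet_one.2 ⟨(y₁ - w₂) / 2, (y₂ - w₁) / 2, mem_diffBody.2 ⟨_, hy₁, _, hw₂, ?_⟩,
      mem_diffBody.2 ⟨_, hy₂, _, hw₁, ?_⟩, ?_⟩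
    · refine eucl_two_ext ?_ ?_ <;> simp <;> ring
    · refine eucl_two_ext ?_ ?_ <;> simp <;> ring
    · simp only [Matrix.cons_val_one, Matrix.cons_val_zero]; linarith
  obtain ⟨h3, h4⟩ := abs_le.1 (show |z 0| ≤ (s - r) / 2 by linarith)
  have := line_mem_of_convex ((diffBody Q).convex.steinerSet (stdVec 1)) (y := !₂[0, z 1])
    (u := stdVec 0) (s := -((s - r) / 2)) (t := (s - r) / 2) (r := z 0)
    (by convert h2 using 1; refine eucl_two_ext ?_ ?_ <;> simp [stdVec])
    (by convert h1 using 1; refine eucl_two_ext ?_ ?_ <;> simp [stdVec]) ⟨h3, h4⟩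
  convert this using 1
  refine eucl_two_ext ?_ ?_ <;> simp [stdVec]

lemma inner_stdVec_zero_one : ⟪(stdVec 1 : Eucl 2), stdVec 0⟫ = 0 := by
  rw [inner_stdVec]; simp [stdVec]

/-- The upper bound is the inclusion in a symmetral of D. For the lower bound half the horizontal
distance of two points of Q is realised on the first axis. -/
lemma suppFn_doubleSym (Q : ConvexBody (Eucl 2)) :
    suppFn (n := 2) (doubleSym Q) (stdVec 0) = suppFn (n := 2) (diffBody Q) (stdVec 0) := by
  apply le_antisymm
  · have := suppFn_mono (doubleSym_subset Q) (stdVec 0)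
    rwa [coe_steinerBody, suppFn_steinerBody (norm_stdVec 1) inner_stdVec_zero_one] at this
  · refine suppFn_le _ fun z hz => ?_
    obtain ⟨p, hp, q, hq, rfl⟩ := mem_diffBody.1 hz
    have h1 : ∀ x ∈ Q, (!₂[x 0, 0] : Eucl 2) ∈ steinerSet (stdVec 1) (Q : Set (Eucl 2)) := by
      intro x hx
      have : (!₂[x 0, x 1] : Eucl 2) = x := eucl_two_ext rfl rfl
      exact mem_steinerSet_one.2
        ⟨x 1, x 1, by simpa [this] using hx, by simpa [this] using hx, by simp⟩
    rcases le_total (q 0) (p 0) with h | h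
    · have h2 : (!₂[(p 0 - q 0) / 2, 0] : Eucl 2) ∈ doubleSym Q :=
        mem_doubleSym.2 (mem_steinerSet_zero.2
        ⟨q 0, p 0, by simpa using h1 q hq, by simpa using h1 p hp, by
          simp only [Matrix.cons_val_zero]; rw [abs_of_nonneg (by linarith)]; linarith⟩)
      refine le_trans (le_of_eq ?_) (inner_le_suppFn _ _ h2)
      rw [inner_stdVec, inner_stdVec]; simp; ring
    · have h2 : (0 : Eucl 2) ∈ doubleSym Q := by
        have := mem_doubleSym.2 (mem_steinerSet_zero (z := 0).2
          ⟨q 0, q 0, by simpa using h1 q hq, by simpa using h1 q hq, by simp⟩)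
        exact this
      refine le_trans ?_ (suppFn_nonneg h2 _)
      rw [inner_stdVec]; simp; linarith

/-- The second moment of the half-difference body in direction `e₀`. -/
lemma IsNearEllipse.moment (h : IsNearEllipse lam a b Q) {c : ℝ} (hc0 : 0 < c)
    (hc : ∀ (Φ : Eucl 2 ≃ₗ[ℝ] Eucl 2) (u : Eucl 2), ∫ x in (ellBody Φ : Set (Eucl 2)), ⟪u, x⟫ ^ 2 =
        c * suppFn (ellBody Φ) u ^ 2 * ∫ _x in (ellBody Φ : Set (Eucl 2)), (1 : ℝ))
    (hV : ∫ _x in (diffBody Q : Set (Eucl 2)), (1 : ℝ) ≤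
      lam ^ 2 * ∫ _x in (Q : Set (Eucl 2)), (1 : ℝ)) :
    c * suppFn (n := 2) (diffBody Q) (stdVec 0) ^ 2 * (∫ _x in (diffBody Q : Set (Eucl 2)), (1 : ℝ)) ≤
      (lam ^ 6 + (lam ^ 2 - 1) / c) * ∫ x in (diffBody Q : Set (Eucl 2)), ⟪stdVec 0, x⟫ ^ 2 ∧
    ∫ x in (diffBody Q : Set (Eucl 2)), ⟪stdVec 0, x⟫ ^ 2 ≤ (lam ^ 6 + (lam ^ 2 - 1) / c) *
      (c * suppFn (n := 2) (diffBody Q) (stdVec 0) ^ 2 *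
        ∫ _x in (diffBody Q : Set (Eucl 2)), (1 : ℝ)) := by
  obtain ⟨Φ, h1, h2, -⟩ := h.subset_ellBody
  have hl := h.one_le
  have h0 : (0 : Eucl 2) ∈ doubleSym Q := by
    have := h.superset 0 (by simp)
    rwa [smul_zero] at this
  obtain ⟨m1, m2⟩ := moment_of_ellipsoid hc0 hc h0 hl h1 h2 (stdVec 0)
  rw [suppFn_doubleSym, area_doubleSym] at m1 m2
  set S := steinerBody (stdVec 1) (norm_stdVec 1) (diffBody Q) with hS
  have hSI : ∫ x in (S : Set (Eucl 2)), ⟪stdVec 0, x⟫ ^ 2 =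
      ∫ x in (diffBody Q : Set (Eucl 2)), ⟪stdVec 0, x⟫ ^ 2 := by
    refine setIntegral_steinerBody (norm_stdVec 1) _ (by fun_prop) fun x => ?_
    have : ⟪(stdVec 0 : Eucl 2), stdVec 1⟫ = 0 := by
      rw [real_inner_comm]; exact inner_stdVec_zero_one
    rw [hproj, inner_sub_right, inner_smul_right, this]; simp
  have hSV : ∫ _x in (S : Set (Eucl 2)), (1 : ℝ) =
      ∫ _x in (diffBody Q : Set (Eucl 2)), (1 : ℝ) :=
    setIntegral_steinerBody (norm_stdVec 1) _ continuous_const (by simp)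
  have hsub := doubleSym_subset Q
  rw [← hS] at hsub
  have hIle : ∫ x in (doubleSym Q : Set (Eucl 2)), ⟪stdVec 0, x⟫ ^ 2 ≤
      ∫ x in (S : Set (Eucl 2)), ⟪stdVec 0, x⟫ ^ 2 :=
    setIntegral_mono_body (by fun_prop) (fun _ => sq_nonneg _) hsub
  have hVle : ∫ _x in (doubleSym Q : Set (Eucl 2)), (1 : ℝ) ≤ ∫ _x in (S : Set (Eucl 2)), (1 : ℝ) :=
    setIntegral_mono_body continuous_const (fun _ => zero_le_one) hsub
  -- The integrand is nonnegative on S, so the part of S outside the double symmetral contributes to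
  -- the second moment at most h² times its area, which is small by `hV`.
  have hdiff : ∫ x in (doubleSym Q : Set (Eucl 2)),
        (suppFn (n := 2) (diffBody Q) (stdVec 0) ^ 2 * 1 - ⟪stdVec 0, x⟫ ^ 2) ≤
      ∫ x in (S : Set (Eucl 2)), (suppFn (n := 2) (diffBody Q) (stdVec 0) ^ 2 * 1 - ⟪stdVec 0, x⟫ ^ 2) := by
    refine setIntegral_mono_set (S.integrableOn (by fun_prop)) ?_ (LE.le.eventuallyLE hsub)
    filter_upwards [ae_restrict_mem S.isCompact.measurableSet] with x hx
    have hsupp : suppFn (n := 2) S (stdVec 0) = suppFn (n := 2) (diffBody Q) (stdVec 0) :=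
      suppFn_steinerBody (norm_stdVec 1) inner_stdVec_zero_one _
    have h3 := inner_le_suppFn S (stdVec 0) hx
    have h4 := inner_le_suppFn S (stdVec 0)
      (neg_mem_steinerSet (fun z hz => neg_mem_diffBody hz) x hx)
    rw [inner_neg_right] at h4
    rw [hsupp] at h3 h4
    simp only [Pi.zero_apply]
    nlinarith
  rw [integral_sub ((doubleSym Q).integrableOn (by fun_prop))
    ((doubleSym Q).integrableOn (by fun_prop)), integral_sub (S.integrableOn (by fun_prop))
    (S.integrableOn (by fun_prop)), integral_const_mul, integral_const_mul, hSI, hSV,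
    area_doubleSym] at hdiff
  rw [area_doubleSym, hSV] at hVle
  rw [hSI] at hIle
  set H := suppFn (n := 2) (diffBody Q) (stdVec 0)
  set I := ∫ x in (diffBody Q : Set (Eucl 2)), ⟪stdVec 0, x⟫ ^ 2
  set J := ∫ x in (doubleSym Q : Set (Eucl 2)), ⟪stdVec 0, x⟫ ^ 2
  set V := ∫ _x in (diffBody Q : Set (Eucl 2)), (1 : ℝ)
  set A := ∫ _x in (Q : Set (Eucl 2)), (1 : ℝ)
  have hA : 0 ≤ A := integral_nonneg fun _ => zero_le_one
  have hJ : 0 ≤ J := integral_nonneg fun _ => sq_nonneg _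
  have hl2 : 0 ≤ (lam ^ 2 - 1) / c := div_nonneg (by nlinarith) hc0.le
  constructor
  · calc c * H ^ 2 * V ≤ c * H ^ 2 * (lam ^ 2 * A) := by gcongr
      _ = lam ^ 2 * (c * H ^ 2 * A) := by ring
      _ ≤ lam ^ 2 * (lam ^ (2 + 2) * J) := by gcongr
      _ = lam ^ 6 * J := by ring
      _ ≤ (lam ^ 6 + (lam ^ 2 - 1) / c) * I :=
        mul_le_mul (by linarith) hIle hJ (by positivity)
  · have e1 : H ^ 2 * (V - A) ≤ H ^ 2 * ((lam ^ 2 - 1) * A) := by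
      gcongr; linarith
    have e2 : I ≤ lam ^ 4 * (c * H ^ 2 * A) + H ^ 2 * ((lam ^ 2 - 1) * A) := by
      norm_num at m2; linarith
    have e3 : lam ^ 4 ≤ lam ^ 6 := pow_le_pow_right₀ hl (by norm_num)
    calc I ≤ lam ^ 4 * (c * H ^ 2 * A) + H ^ 2 * ((lam ^ 2 - 1) * A) := e2
      _ = (lam ^ 4 + (lam ^ 2 - 1) / c) * (c * H ^ 2 * A) := by field_simp
      _ ≤ (lam ^ 6 + (lam ^ 2 - 1) / c) * (c * H ^ 2 * V) := by gcongr

/-- The moment estimate in direction e₀ is applied to rotated copies of Q, which satisfy the same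
hypothesis; this covers all directions. -/
lemma exists_plane_norm_approx : ∃ c : ℝ, 0 < c ∧ ∀ (lam : ℝ) (Q : ConvexBody (Eucl 2)), 1 ≤ lam →
    (interior (Q : Set (Eucl 2))).Nonempty → AllNearEllipse lam Q →
    ∃ (Ψ : Eucl 2 ≃ₗ[ℝ] Eucl 2) (a b : ℝ), 0 < a ∧ a ≤ b ∧ b / a = lam ^ 6 + (lam ^ 2 - 1) / c ∧
      ∀ u, a * ‖Ψ u‖ ≤ suppFn (diffBody Q) u ∧ suppFn (diffBody Q) u ≤ b * ‖Ψ u‖ := by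
  obtain ⟨c, hc0, -, hc⟩ := exists_ellipsoid_moment 2 (by norm_num)
  refine ⟨c, hc0, fun lam Q hl hQ h => ?_⟩
  have key : ∀ u : Eucl 2, ‖u‖ = 1 →
      c * suppFn (diffBody Q) u ^ 2 * (∫ _x in (diffBody Q : Set (Eucl 2)), (1 : ℝ)) ≤
        (lam ^ 6 + (lam ^ 2 - 1) / c) * ∫ x in (diffBody Q : Set (Eucl 2)), ⟪u, x⟫ ^ 2 ∧
      ∫ x in (diffBody Q : Set (Eucl 2)), ⟪u, x⟫ ^ 2 ≤ (lam ^ 6 + (lam ^ 2 - 1) / c) *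
        (c * suppFn (diffBody Q) u ^ 2 * ∫ _x in (diffBody Q : Set (Eucl 2)), (1 : ℝ)) := by
    intro u hu
    have hdet : u 0 * u 0 - u 1 * -u 1 = 1 := by
      have := norm_sq_eucl_two u
      rw [hu] at this; linarith
    set T := planeMap (u 0) (u 1) (-u 1) (u 0) (by rw [hdet]; exact one_ne_zero) with hT
    obtain ⟨a, b, hab⟩ := h T
    have hV := (h.image T).area_diffBody_le (interior_linearImage hQ T.surjective)
    have hdetT : |LinearMap.det (T : Eucl 2 →ₗ[ℝ] Eucl 2)| = 1 := by
      rw [hT, planeMap_det, hdet, abs_one]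
    have hinner : ∀ x, ⟪stdVec 0, T x⟫ = ⟪u, x⟫ := by
      intro x
      rw [inner_stdVec, inner_eucl_two, hT, planeMap_apply_zero]
    have := hab.moment hc0 hc hV
    have hVD : ∫ _x in (linearImage (T : Eucl 2 →ₗ[ℝ] Eucl 2) (diffBody Q) : Set (Eucl 2)), (1 : ℝ) =
        ∫ _x in (diffBody Q : Set (Eucl 2)), (1 : ℝ) := by
      rw [integral_linearImage_one, hdetT, one_mul]
    have hID : ∫ x in (linearImage (T : Eucl 2 →ₗ[ℝ] Eucl 2) (diffBody Q) : Set (Eucl 2)),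
        ⟪stdVec 0, x⟫ ^ 2 = ∫ x in (diffBody Q : Set (Eucl 2)), ⟪u, x⟫ ^ 2 := by
      rw [coe_linearImage]
      refine (setIntegral_linearEquiv_image T (diffBody Q).isCompact.measurableSet _).trans ?_
      rw [hdetT, one_mul]
      simp only [hinner]
    rwa [diffBody_linearImage, hVD, hID, suppFn_linearImage (T : Eucl 2 →ₗ[ℝ] Eucl 2) _ hinner]
      at this
  exact bmDist_le_of_moment (interior_diffBody hQ) (zero_mem_diffBody Q) hc0
    (le_add_of_le_of_nonneg (one_le_pow₀ hl) (div_nonneg (by nlinarith) hc0.le))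
    (fun u hu => (key u hu).1) fun u hu => (key u hu).2

end PlaneDifference

/-! ### Parallelograms with prescribed diagonals when the half-difference body is nearly a disc. -/

section PlaneAsymmetry

open MeasureTheory

variable {n : ℕ} {lam a b κ : ℝ} {Q : ConvexBody (Eucl 2)}

lemma area_closedBall {r : ℝ} (hr : 0 ≤ r) :
    ∫ _x in Metric.closedBall (0 : Eucl 2) r, (1 : ℝ) = r ^ 2 * Real.pi := by
  rw [volume_integral_eq, Measure.real, EuclideanSpace.volume_closedBall_fin_two]
  simp [Real.pi_pos.le, hr]

/-- The half-axes of the ellipse, when the half-difference body is nearly the unit disc. -/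
lemma AllNearEllipse.axes_bounds (h : AllNearEllipse lam Q) (hab : IsNearEllipse lam a b Q)
    (hk : 0 ≤ κ) (hlam : lam ≤ 1 + κ)
    (hD1 : Metric.closedBall 0 1 ⊆ (diffBody Q : Set (Eucl 2)))
    (hD2 : (diffBody Q : Set (Eucl 2)) ⊆ Metric.closedBall 0 (1 + κ))
    (hQ : (interior (Q : Set (Eucl 2))).Nonempty) :
    1 ≤ a ∧ a ≤ (1 + κ) ^ 2 ∧ 1 ≤ b * (1 + κ) ^ 4 ∧ b ≤ (1 + κ) ^ 4 := by
  have hpi := Real.pi_pos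
  have ha := hab.pos_left
  have hb := hab.pos_right
  have hl := hab.one_le
  -- Area of Q at most area of D: both symmetrizations preserve area, so `doubleSym_subset` is
  -- enough.
  have hA : ∫ _x in (Q : Set (Eucl 2)), (1 : ℝ) ≤ ∫ _x in (diffBody Q : Set (Eucl 2)), (1 : ℝ) := by
    rw [← area_doubleSym, ← setIntegral_steinerBody (norm_stdVec 1) (diffBody Q)
      (φ := fun _ => (1 : ℝ)) continuous_const (by simp)]
    exact setIntegral_mono_body (L := steinerBody (stdVec 1) (norm_stdVec 1) (diffBody Q))
      continuous_const (fun _ => zero_le_one) (doubleSym_subset Q)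
  have hD1' : Real.pi ≤ ∫ _x in (diffBody Q : Set (Eucl 2)), (1 : ℝ) := by
    have := setIntegral_mono_body (φ := fun _ => (1 : ℝ)) (K := ballBody 2) (L := diffBody Q)
      continuous_const (fun _ => zero_le_one) hD1
    rw [coe_ballBody, area_closedBall zero_le_one] at this
    linarith
  have hD2' : ∫ _x in (diffBody Q : Set (Eucl 2)), (1 : ℝ) ≤ (1 + κ) ^ 2 * Real.pi := by
    rw [← area_closedBall (by linarith)]
    refine setIntegral_mono_set ?_ (Eventually.of_forall fun _ => zero_le_one)
      (LE.le.eventuallyLE hD2)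
    exact continuousOn_const.integrableOn_compact (isCompact_closedBall 0 (1 + κ))
  have hDQ := h.area_diffBody_le hQ
  obtain ⟨hA1, hA2⟩ := hab.area
  set A := ∫ _x in (Q : Set (Eucl 2)), (1 : ℝ)
  set V := ∫ _x in (diffBody Q : Set (Eucl 2)), (1 : ℝ)
  have hl2 : lam ^ 2 ≤ (1 + κ) ^ 2 := pow_le_pow_left₀ (by linarith) hlam 2
  have ha1 : 1 ≤ a := by
    have h1 : (stdVec 0 : Eucl 2) ∈ diffBody Q := hD1 (by simp [norm_stdVec])
    obtain ⟨p, hp, q, hq, hpq⟩ := mem_diffBody.1 h1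
    have h2 := hab.width_le hp hq
    have h3 : (stdVec 0 : Eucl 2) 0 = (p 0 - q 0) / 2 := by rw [hpq]; simp; ring
    have h4 : (stdVec 0 : Eucl 2) 0 = 1 := by simp [stdVec]
    linarith
  have ha2 : a ≤ (1 + κ) ^ 2 := by
    have h1 := hab.superset !₂[a, 0] (by simp [ha.ne'])
    have h2 := inner_le_suppFn (doubleSym Q) (stdVec 0) h1
    have h3 := suppFn_le_of_subset_closedBall hD2 (stdVec 0)
    rw [suppFn_doubleSym, inner_stdVec] at h2
    rw [norm_stdVec, mul_one] at h3
    have h4 : lam⁻¹ * a ≤ 1 + κ := by simpa using h2.trans h3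
    rw [inv_mul_le_iff₀ (by linarith)] at h4
    nlinarith
  refine ⟨ha1, ha2, ?_, ?_⟩
  · have h1 : Real.pi ≤ lam ^ 2 * (Real.pi * a * b) :=
      hD1'.trans (hDQ.trans (mul_le_mul_of_nonneg_left hA1 (by positivity)))
    have h2 : 1 ≤ lam ^ 2 * (a * b) := by
      have : Real.pi * 1 ≤ Real.pi * (lam ^ 2 * (a * b)) := by linarith
      exact le_of_mul_le_mul_left this hpi
    calc 1 ≤ lam ^ 2 * (a * b) := h2
      _ ≤ (1 + κ) ^ 2 * ((1 + κ) ^ 2 * b) := by gcongr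
      _ = b * (1 + κ) ^ 4 := by ring
  · have h1 : Real.pi * (a * b) ≤ Real.pi * (1 + κ) ^ 4 := by
      calc Real.pi * (a * b) ≤ lam ^ 2 * A := by linarith
        _ ≤ (1 + κ) ^ 2 * ((1 + κ) ^ 2 * Real.pi) := by
          have : A ≤ (1 + κ) ^ 2 * Real.pi := hA.trans hD2'
          have hA0 : 0 ≤ A := integral_nonneg fun _ => zero_le_one
          gcongr
        _ = Real.pi * (1 + κ) ^ 4 := by ring
    have h2 := le_of_mul_le_mul_left h1 hpi
    nlinarith

lemma pow_bounds_of_small (hk : 0 ≤ κ) (hk' : κ ≤ 1 / 100) :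
    (1 + κ) ^ 2 ≤ 1 + 3 * κ ∧ (1 + κ) ^ 4 ≤ 1 + 5 * κ ∧ (1 - 5 * κ) * (1 + κ) ^ 5 ≤ 1 := by
  have hκ2 : κ ^ 2 ≤ κ / 100 := by nlinarith
  have p2 : (1 + κ) ^ 2 ≤ 1 + 21 / 10 * κ := by nlinarith
  refine ⟨by linarith, ?_, ?_⟩
  · calc (1 + κ) ^ 4 = ((1 + κ) ^ 2) ^ 2 := by ring
      _ ≤ (1 + 21 / 10 * κ) ^ 2 := by gcongr
      _ ≤ 1 + 5 * κ := by nlinarith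
  · have h := one_add_mul_le_pow (show (-2 : ℝ) ≤ -κ by linarith) 5
    have h1 : (0 : ℝ) ≤ 1 + -κ := by linarith
    calc (1 - 5 * κ) * (1 + κ) ^ 5 ≤ (1 + -κ) ^ 5 * (1 + κ) ^ 5 := by
          gcongr; push_cast at h; linarith
      _ = (1 - κ ^ 2) ^ 5 := by ring
      _ ≤ 1 := pow_le_one₀ (by linarith) (by linarith [sq_nonneg κ])

/-- A half-diagonal (X, Y + t/2) that lies in a disc of radius about 1, although X² + Y² is already
about 1, leaves Yt ≤ 13κ. As Y > 65/100, this bounds t by 20κ. -/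
lemma offset_le {c s X Y t : ℝ} (hk : 0 ≤ κ) (hk' : κ ≤ 1 / 100)
    (hs : 7 / 10 ≤ s) (hcs : c ^ 2 + s ^ 2 = 1) (hX : c ^ 2 * (1 - 10 * κ) ≤ X ^ 2)
    (hY : s ^ 2 * (1 - 10 * κ) ≤ Y ^ 2) (hYs : s * (1 - 5 * κ) ≤ Y)
    (h : X ^ 2 + (Y + t / 2) ^ 2 ≤ 1 + 3 * κ) : t ≤ 20 * κ := by
  by_contra! hcon
  have h1 : 1 - 10 * κ ≤ X ^ 2 + Y ^ 2 := by
    have : (c ^ 2 + s ^ 2) * (1 - 10 * κ) ≤ X ^ 2 + Y ^ 2 := by linarith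
    rwa [hcs, one_mul] at this
  have h2 : Y * t ≤ 13 * κ := by linarith [sq_nonneg t, (by ring : (Y + t / 2) ^ 2 = Y ^ 2 + Y * t + t ^ 2 / 4)]
  have h3 : 65 / 100 < Y := by
    have : 7 / 10 * (1 - 5 * κ) ≤ s * (1 - 5 * κ) := mul_le_mul_of_nonneg_right hs (by linarith)
    linarith
  have h4 : 65 / 100 * t < Y * t := mul_lt_mul_of_pos_right h3 (by linarith)
  linarith

/-- Here σ is the slant of the parallelogram. The condition c ≤ s keeps s, hence Y, away from 0, so
the slant is at most 20κ in both directions. The coordinates X and Y deviate by at most 5κ, which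
leaves errors 5κ and 15κ. -/
lemma parallelogram_estimate {X Y c s σ : ℝ} (hk : 0 ≤ κ) (hk' : κ ≤ 1 / 100) (hc : 0 ≤ c)
    (hsc : c ≤ s) (hcs : c ^ 2 + s ^ 2 = 1) (hX1 : c ≤ X * (1 + κ)) (hX2 : X ≤ c * (1 + κ) ^ 2)
    (hY1 : s ≤ Y * (1 + κ) ^ 5) (hY2 : Y ≤ s * (1 + κ) ^ 4)
    (hE : X ^ 2 + (σ / 2 + Y) ^ 2 ≤ (1 + κ) ^ 2) (hV : X ^ 2 + (Y - σ / 2) ^ 2 ≤ (1 + κ) ^ 2) :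
    (X - c) ^ 2 + (σ / 2 + Y - s) ^ 2 ≤ (20 * κ) ^ 2 ∧
      (-X - -c) ^ 2 + (Y - σ / 2 - s) ^ 2 ≤ (20 * κ) ^ 2 := by
  have hs : 0 ≤ s := hc.trans hsc
  have hc2 : c ^ 2 ≤ s ^ 2 := pow_le_pow_left₀ hc hsc 2
  have hs2 : 7 / 10 ≤ s := by
    by_contra! hcon
    have : s ^ 2 ≤ (7 / 10) ^ 2 := pow_le_pow_left₀ hs hcon.le 2
    linarith
  have hc1 : c ≤ 1 := by
    by_contra! hcon
    have : (1 : ℝ) ^ 2 < c ^ 2 := pow_lt_pow_left₀ hcon (by norm_num) (by norm_num)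
    linarith [sq_nonneg s]
  have hs1 : s ≤ 1 := by
    by_contra! hcon
    have : (1 : ℝ) ^ 2 < s ^ 2 := pow_lt_pow_left₀ hcon (by norm_num) (by norm_num)
    linarith [sq_nonneg c]
  obtain ⟨p2, p4, p5⟩ := pow_bounds_of_small hk hk'
  have hXl : c * (1 - 5 * κ) ≤ X := by
    have h1 : c * ((1 - 5 * κ) * (1 + κ)) ≤ c * 1 :=
      mul_le_mul_of_nonneg_left (by linarith [sq_nonneg κ, (by ring : (1 - 5 * κ) * (1 + κ) = 1 - 4 * κ - 5 * κ ^ 2)]) hc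
    exact le_of_mul_le_mul_right (by linarith : c * (1 - 5 * κ) * (1 + κ) ≤ X * (1 + κ))
      (by linarith)
  have hYl : s * (1 - 5 * κ) ≤ Y := by
    have h1 : s * ((1 - 5 * κ) * (1 + κ) ^ 5) ≤ s * 1 := mul_le_mul_of_nonneg_left p5 hs
    exact le_of_mul_le_mul_right (by linarith : s * (1 - 5 * κ) * (1 + κ) ^ 5 ≤ Y * (1 + κ) ^ 5)
      (by positivity)
  have hXu : X ≤ c * (1 + 3 * κ) := hX2.trans (mul_le_mul_of_nonneg_left p2 hc)
  have hYu : Y ≤ s * (1 + 5 * κ) := hY2.trans (mul_le_mul_of_nonneg_left p4 hs)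
  have hsq : (1 - 10 * κ) ≤ (1 - 5 * κ) ^ 2 := by linarith [sq_nonneg κ, (by ring : (1 - 5 * κ) ^ 2 = 1 - 10 * κ + 25 * κ ^ 2)]
  have hX2l : c ^ 2 * (1 - 10 * κ) ≤ X ^ 2 :=
    calc c ^ 2 * (1 - 10 * κ) ≤ c ^ 2 * (1 - 5 * κ) ^ 2 := by gcongr
      _ = (c * (1 - 5 * κ)) ^ 2 := by ring
      _ ≤ X ^ 2 := pow_le_pow_left₀ (mul_nonneg hc (by linarith)) hXl 2
  have hY2l : s ^ 2 * (1 - 10 * κ) ≤ Y ^ 2 :=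
    calc s ^ 2 * (1 - 10 * κ) ≤ s ^ 2 * (1 - 5 * κ) ^ 2 := by gcongr
      _ = (s * (1 - 5 * κ)) ^ 2 := by ring
      _ ≤ Y ^ 2 := pow_le_pow_left₀ (mul_nonneg hs (by linarith)) hYl 2
  have hσ1 : σ ≤ 20 * κ := offset_le hk hk' hs2 hcs hX2l hY2l hYl
    (by rw [add_comm Y]; exact hE.trans p2)
  have hσ2 : -σ ≤ 20 * κ := offset_le hk hk' hs2 hcs hX2l hY2l hYl
    (by rw [neg_div, ← sub_eq_add_neg]; exact hV.trans p2)
  have hcκ : c * κ ≤ κ := mul_le_of_le_one_left hk hc1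
  have hsκ : s * κ ≤ κ := mul_le_of_le_one_left hk hs1
  have hXc : (X - c) ^ 2 ≤ (5 * κ) ^ 2 := by apply sq_le_sq' <;> linarith
  have hXc' : (-X - -c) ^ 2 ≤ (5 * κ) ^ 2 := by apply sq_le_sq' <;> linarith
  have e1 : (σ / 2 + Y - s) ^ 2 ≤ (15 * κ) ^ 2 := by apply sq_le_sq' <;> linarith
  have e2 : (Y - σ / 2 - s) ^ 2 ≤ (15 * κ) ^ 2 := by apply sq_le_sq' <;> linarith
  have e3 : (5 * κ) ^ 2 + (15 * κ) ^ 2 ≤ (20 * κ) ^ 2 := by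
    linarith [sq_nonneg κ, (by ring : (20 * κ) ^ 2 = (5 * κ) ^ 2 + (15 * κ) ^ 2 + 150 * κ ^ 2)]
  exact ⟨by linarith, by linarith⟩

/-- For a nearly round half-difference body, `Q` contains parallelograms with prescribed
directions of the diagonals, of nearly maximal length. -/
lemma AllNearEllipse.exists_parallelogram_axis (h : AllNearEllipse lam Q) (hk : 0 ≤ κ)
    (hk' : κ ≤ 1 / 100) (hlam : lam ≤ 1 + κ)
    (hD1 : Metric.closedBall 0 1 ⊆ (diffBody Q : Set (Eucl 2)))
    (hD2 : (diffBody Q : Set (Eucl 2)) ⊆ Metric.closedBall 0 (1 + κ))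
    (hQ : (interior (Q : Set (Eucl 2))).Nonempty) {c s : ℝ} (hc : 0 ≤ c) (hsc : c ≤ s)
    (hcs : c ^ 2 + s ^ 2 = 1) :
    ∃ m E V : Eucl 2, m + E ∈ Q ∧ m - E ∈ Q ∧ m + V ∈ Q ∧ m - V ∈ Q ∧
      ‖E - !₂[c, s]‖ ≤ 20 * κ ∧ ‖V - !₂[-c, s]‖ ≤ 20 * κ := by
  obtain ⟨a, b, hab⟩ : ∃ a b, IsNearEllipse lam a b Q := by
    obtain ⟨a, b, hab⟩ := h (LinearEquiv.refl ℝ _)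
    refine ⟨a, b, ?_⟩
    convert hab
    apply SetLike.coe_injective
    simp
  obtain ⟨ha1, ha2, hb1, hb2⟩ := h.axes_bounds hab hk hlam hD1 hD2 hQ
  have hl := hab.one_le
  have hl0 : 0 < lam := by linarith
  have hb := hab.pos_right
  have hs : 0 ≤ s := hc.trans hsc
  obtain ⟨x, y, w, h1, h2, h3, h4⟩ := hab.exists_parallelogram hc hs hcs
  obtain ⟨X, hX⟩ : ∃ X, X = a * c / lam := ⟨_, rfl⟩
  obtain ⟨Y, hY⟩ : ∃ Y, Y = b * s / lam := ⟨_, rfl⟩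
  simp only [← hX, ← hY] at h2 h3 h4
  have hnorm : ∀ z ∈ diffBody Q, z 0 ^ 2 + z 1 ^ 2 ≤ (1 + κ) ^ 2 := by
    intro z hz
    rw [← norm_sq_eucl_two]
    have := hD2 hz
    rw [mem_closedBall_zero_iff] at this
    exact pow_le_pow_left₀ (norm_nonneg _) this 2
  have hE := hnorm _ (mem_diffBody.2 ⟨_, h4, _, h1, rfl⟩)
  have hV := hnorm _ (mem_diffBody.2 ⟨_, h2, _, h3, rfl⟩)
  simp at hE hV
  obtain ⟨hE', hV'⟩ := parallelogram_estimate (X := X) (Y := Y) (σ := w - y) hk hk' hc hsc hcs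
    (by
      rw [hX, div_mul_eq_mul_div, le_div_iff₀ hl0]
      have : c * lam ≤ c * (1 + κ) := by gcongr
      have : c * (1 + κ) * 1 ≤ c * (1 + κ) * a := by gcongr
      linarith)
    (by
      rw [hX, div_le_iff₀ hl0]
      have : a * c ≤ (1 + κ) ^ 2 * c := by gcongr
      have : c * (1 + κ) ^ 2 * 1 ≤ c * (1 + κ) ^ 2 * lam := by gcongr
      linarith)
    (by
      rw [hY, div_mul_eq_mul_div, le_div_iff₀ hl0]
      have h5 : s * lam ≤ s * (1 + κ) := by gcongr
      have : s * (1 + κ) * 1 ≤ s * (1 + κ) * (b * (1 + κ) ^ 4) := by gcongr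
      linarith [this, h5, (by ring : s * (1 + κ) * (b * (1 + κ) ^ 4) = b * s * (1 + κ) ^ 5)])
    (by
      rw [hY, div_le_iff₀ hl0]
      have : b * s ≤ (1 + κ) ^ 4 * s := by gcongr
      have : s * (1 + κ) ^ 4 * 1 ≤ s * (1 + κ) ^ 4 * lam := by gcongr
      linarith)
    (by refine le_trans (le_of_eq ?_) hE; ring) (by refine le_trans (le_of_eq ?_) hV; ring)
  have hle : ∀ z : Eucl 2, z 0 ^ 2 + z 1 ^ 2 ≤ (20 * κ) ^ 2 → ‖z‖ ≤ 20 * κ := by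
    intro z hz
    rw [← norm_sq_eucl_two] at hz
    exact abs_le_of_sq_le_sq' hz (by positivity) |>.2
  -- The centre and the two half-diagonals of the parallelogram; w - y is its slant.
  refine ⟨!₂[x + X, (y + w) / 2 + Y], !₂[X, (w - y) / 2 + Y], !₂[-X, Y - (w - y) / 2],
    ?_, ?_, ?_, ?_, hle _ (by simpa using hE'), hle _ (by simpa using hV')⟩
  · convert h4 using 1
    refine eucl_two_ext ?_ ?_ <;> simp <;> ring
  · convert h1 using 1
    refine eucl_two_ext ?_ ?_ <;> simp <;> ring
  · convert h2 using 1
    refine eucl_two_ext ?_ ?_ <;> simp <;> ring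
  · convert h3 using 1
    refine eucl_two_ext ?_ ?_ <;> simp <;> ring

/-- After replacing v by -v the angle between e and v is at most a right angle. An isometry taking
their bisector to the second axis then gives them the form (c, s), (-c, s) with c ≤ s. -/
lemma AllNearEllipse.exists_parallelogram (h : AllNearEllipse lam Q) (hk : 0 ≤ κ)
    (hk' : κ ≤ 1 / 100) (hlam : lam ≤ 1 + κ)
    (hD1 : Metric.closedBall 0 1 ⊆ (diffBody Q : Set (Eucl 2)))
    (hD2 : (diffBody Q : Set (Eucl 2)) ⊆ Metric.closedBall 0 (1 + κ))
    (hQ : (interior (Q : Set (Eucl 2))).Nonempty) {e v : Eucl 2} (he : ‖e‖ = 1) (hv : ‖v‖ = 1) :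
    ∃ m E V : Eucl 2, m + E ∈ Q ∧ m - E ∈ Q ∧ m + V ∈ Q ∧ m - V ∈ Q ∧
      ‖E - e‖ ≤ 20 * κ ∧ ‖V - v‖ ≤ 20 * κ := by
  wlog hev : 0 ≤ ⟪e, v⟫ generalizing v
  · obtain ⟨m, E, V, h1, h2, h3, h4, h5, h6⟩ := this (v := -v) (by rwa [norm_neg])
      (by rw [inner_neg_right]; linarith)
    exact ⟨m, E, -V, h1, h2, by rwa [← sub_eq_add_neg], by rwa [sub_neg_eq_add], h5, by
      have h7 : -V - v = -(V - -v) := by abel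
      rw [h7, norm_neg]; exact h6⟩
  have hne : e + v ≠ 0 := by
    intro h0
    have h1 : ⟪e, e + v⟫ = 0 := by rw [h0, inner_zero_right]
    rw [inner_add_right, inner_self_of_unit he] at h1
    linarith
  obtain ⟨f, hfdef⟩ : ∃ f : Eucl 2, f = ‖e + v‖⁻¹ • (e + v) := ⟨_, rfl⟩
  have hf : ‖f‖ = 1 := by
    rw [hfdef, norm_smul, norm_inv, norm_norm, inv_mul_cancel₀ (norm_ne_zero_iff.2 hne)]
  have hN : 0 < ‖e + v‖ := norm_pos_iff.2 hne
  have hev' : e + v = ‖e + v‖ • f := by rw [hfdef, smul_inv_smul₀ hN.ne']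
  obtain ⟨N, hNdef⟩ : ∃ N, N = ‖e + v‖ := ⟨_, rfl⟩
  rw [← hNdef] at hev' hN
  have hf2 := norm_sq_eucl_two f
  have he2 := norm_sq_eucl_two e
  have hv2 := norm_sq_eucl_two v
  rw [hf] at hf2; rw [he] at he2; rw [hv] at hv2
  have hv0 : v 0 = N * f 0 - e 0 := by
    have := congrArg (fun z : Eucl 2 => z 0) hev'; simp at this; linarith
  have hv1 : v 1 = N * f 1 - e 1 := by
    have := congrArg (fun z : Eucl 2 => z 1) hev'; simp at this; linarith
  -- The sign decides between a rotation and a reflection, so that e lands on the side c ≥ 0.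
  obtain ⟨τ, hτ, hτe⟩ : ∃ τ : ℝ, τ ^ 2 = 1 ∧ 0 ≤ τ * (f 1 * e 0 - f 0 * e 1) := by
    rcases le_total 0 (f 1 * e 0 - f 0 * e 1) with h0 | h0
    · exact ⟨1, by norm_num, by linarith⟩
    · exact ⟨-1, by norm_num, by linarith⟩
  have hfe : N * (f 0 * e 0 + f 1 * e 1) = 1 + ⟪e, v⟫ := by
    rw [inner_eucl_two, hv0, hv1]; linarith
  have hNfe : N = 2 * (f 0 * e 0 + f 1 * e 1) := by
    have : N * (N - 2 * (f 0 * e 0 + f 1 * e 1)) = 0 := by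
      rw [hv0, hv1] at hv2; nlinarith
    rcases mul_eq_zero.1 this with h0 | h0
    · linarith
    · linarith
  obtain ⟨c, hcdef⟩ : ∃ c, c = τ * (f 1 * e 0 - f 0 * e 1) := ⟨_, rfl⟩
  obtain ⟨s, hsdef⟩ : ∃ s, s = f 0 * e 0 + f 1 * e 1 := ⟨_, rfl⟩
  rw [← hcdef] at hτe
  have hcs : c ^ 2 + s ^ 2 = 1 := by
    have : c ^ 2 + s ^ 2 = τ ^ 2 * (f 1 * e 0 - f 0 * e 1) ^ 2 + (f 0 * e 0 + f 1 * e 1) ^ 2 := by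
      rw [hcdef, hsdef]; ring
    rw [this, hτ]
    calc _ = (f 0 ^ 2 + f 1 ^ 2) * (e 0 ^ 2 + e 1 ^ 2) := by ring
      _ = 1 := by rw [← hf2, ← he2]; norm_num
  have hs0 : 0 ≤ s := by rw [hsdef]; linarith
  -- Since 2s² = 1 + ⟪e, v⟫ ≥ 1, one has s² ≥ 1/2 ≥ c².
  have hsc : c ≤ s := by
    rw [← hsdef] at hfe hNfe
    rw [hNfe] at hfe
    nlinarith
  have hdet : τ * f 1 * f 1 - -(τ * f 0) * f 0 = τ := by
    have : τ * f 1 * f 1 - -(τ * f 0) * f 0 = τ * (f 0 ^ 2 + f 1 ^ 2) := by ring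
    rw [this, ← hf2]; ring
  have hτ0 : τ ≠ 0 := by rintro rfl; norm_num at hτ
  obtain ⟨T, hT⟩ : ∃ T, T = planeMap (τ * f 1) (-(τ * f 0)) (f 0) (f 1) (by rwa [hdet]) := ⟨_, rfl⟩
  have hTn : ∀ z, ‖T z‖ = ‖z‖ := by
    intro z
    rw [← sq_eq_sq₀ (norm_nonneg _) (norm_nonneg _), norm_sq_eucl_two, norm_sq_eucl_two, hT,
      planeMap_apply_zero, planeMap_apply_one]
    calc _ = τ ^ 2 * (f 1 * z 0 - f 0 * z 1) ^ 2 + (f 0 * z 0 + f 1 * z 1) ^ 2 := by ring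
      _ = (f 0 ^ 2 + f 1 ^ 2) * (z 0 ^ 2 + z 1 ^ 2) := by rw [hτ]; ring
      _ = z 0 ^ 2 + z 1 ^ 2 := by rw [← hf2]; ring
  have hTe : T e = !₂[c, s] := by
    refine eucl_two_ext ?_ ?_
    · simp [hT, hcdef]; ring
    · simp [hT, hsdef]
  have hTv : T v = !₂[-c, s] := by
    refine eucl_two_ext ?_ ?_
    · simp [hT, hcdef, hv0, hv1]; ring
    · simp only [hT, hsdef, hv0, hv1, planeMap_apply_one, Matrix.cons_val_one,
        Matrix.cons_val_zero]
      calc _ = N * (f 0 ^ 2 + f 1 ^ 2) - (f 0 * e 0 + f 1 * e 1) := by ring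
        _ = _ := by rw [← hf2, hNfe]; ring
  have hD1' : Metric.closedBall 0 1 ⊆
      (diffBody (linearImage (T : Eucl 2 →ₗ[ℝ] Eucl 2) Q) : Set (Eucl 2)) := by
    intro z hz
    rw [diffBody_linearImage]
    refine ⟨T.symm z, hD1 ?_, by simp⟩
    rw [mem_closedBall_zero_iff, ← hTn, T.apply_symm_apply]
    exact mem_closedBall_zero_iff.1 hz
  have hD2' : (diffBody (linearImage (T : Eucl 2 →ₗ[ℝ] Eucl 2) Q) : Set (Eucl 2)) ⊆
      Metric.closedBall 0 (1 + κ) := by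
    rw [diffBody_linearImage]
    rintro _ ⟨z, hz, rfl⟩
    rw [mem_closedBall_zero_iff, LinearEquiv.coe_coe, hTn]
    exact mem_closedBall_zero_iff.1 (hD2 hz)
  obtain ⟨m, E, V, h1, h2, h3, h4, h5, h6⟩ := (h.image T).exists_parallelogram_axis hk hk'
    hlam hD1' hD2' (interior_linearImage hQ T.surjective) hτe hsc hcs
  have hpull : ∀ z : Eucl 2, z ∈ linearImage (T : Eucl 2 →ₗ[ℝ] Eucl 2) Q → T.symm z ∈ Q := by
    rintro _ ⟨x, hx, rfl⟩
    simpa using hx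
  refine ⟨T.symm m, T.symm E, T.symm V, ?_, ?_, ?_, ?_, ?_, ?_⟩
  · rw [← map_add]; exact hpull _ h1
  · rw [← map_sub]; exact hpull _ h2
  · rw [← map_add]; exact hpull _ h3
  · rw [← map_sub]; exact hpull _ h4
  · rw [← hTn, map_sub, T.apply_symm_apply, hTe]; exact h5
  · rw [← hTn, map_sub, T.apply_symm_apply, hTv]; exact h6

end PlaneAsymmetry

/-! ### Near central symmetry in the plane. -/

section PlaneTheorem

open MeasureTheory

variable {lam κ : ℝ} {Q : ConvexBody (Eucl 2)}

/-- The midpoint of a nearly maximal chord in a given direction is almost unique. -/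
lemma norm_midpoint_sub_le (hk : 0 ≤ κ) (hk' : κ ≤ 1 / 100)
    (hD2 : (diffBody Q : Set (Eucl 2)) ⊆ Metric.closedBall 0 (1 + κ)) {e m m' E E' : Eucl 2}
    (he : ‖e‖ = 1) (hE : ‖E - e‖ ≤ 20 * κ) (hE' : ‖E' - e‖ ≤ 20 * κ) (h1 : m + E ∈ Q)
    (h2 : m - E ∈ Q) (h3 : m' + E' ∈ Q) (h4 : m' - E' ∈ Q) : ‖m - m'‖ ≤ 14 * √κ := by
  have hb : ∀ x ∈ Q, ∀ y ∈ Q, ‖x - y‖ ≤ 2 * (1 + κ) := by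
    intro x hx y hy
    have := hD2 (mem_diffBody.2 ⟨x, hx, y, hy, rfl⟩)
    rw [mem_closedBall_zero_iff, norm_smul] at this
    norm_num at this
    linarith
  have h5 := hb _ h1 _ h4
  have h6 := hb _ h3 _ h2
  have e5 : m + E - (m' - E') = (E + E') + (m - m') := by abel
  have e6 : m' + E' - (m - E) = (E + E') - (m - m') := by abel
  rw [e5] at h5; rw [e6] at h6
  -- The parallelogram law bounds ‖m - m'‖² by 4(1 + κ)² - (2 - 40κ)², which is of order κ; this is
  -- the origin of the square root.
  have hpar := parallelogram_law_with_norm ℝ (E + E') (m - m')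
  have hlow : 2 - 40 * κ ≤ ‖E + E'‖ := by
    have h7 : ‖(2 : ℝ) • e‖ ≤ ‖E + E'‖ + (‖E - e‖ + ‖E' - e‖) := by
      have : (2 : ℝ) • e = (E + E') - ((E - e) + (E' - e)) := by rw [two_smul]; abel
      rw [this]
      exact (norm_sub_le _ _).trans (add_le_add le_rfl (norm_add_le _ _))
    rw [norm_smul, he] at h7
    norm_num at h7
    linarith
  have e7 : ‖E + E' + (m - m')‖ * ‖E + E' + (m - m')‖ ≤ 2 * (1 + κ) * (2 * (1 + κ)) :=
    mul_le_mul h5 h5 (norm_nonneg _) (by linarith)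
  have e8 : ‖E + E' - (m - m')‖ * ‖E + E' - (m - m')‖ ≤ 2 * (1 + κ) * (2 * (1 + κ)) :=
    mul_le_mul h6 h6 (norm_nonneg _) (by linarith)
  have e9 : (2 - 40 * κ) * (2 - 40 * κ) ≤ ‖E + E'‖ * ‖E + E'‖ :=
    mul_le_mul hlow hlow (by linarith) (norm_nonneg _)
  have hs : √κ * √κ = κ := Real.mul_self_sqrt hk
  apply le_of_sq_le_sq _ (by positivity)
  have : (14 * √κ) ^ 2 = 196 * κ := by rw [mul_pow, sq (√κ), hs]; norm_num
  rw [this]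
  nlinarith

/-- The normalized case of the plane theorem: `Q` is nearly symmetric. -/
lemma AllNearEllipse.exists_center_of_round (h : AllNearEllipse lam Q) (hk : 0 ≤ κ)
    (hk' : κ ≤ 1 / 100) (hlam : lam ≤ 1 + κ)
    (hQ : (interior (Q : Set (Eucl 2))).Nonempty)
    (hD : ∀ u : Eucl 2, ‖u‖ ≤ suppFn (diffBody Q) u ∧ suppFn (diffBody Q) u ≤ (1 + κ) * ‖u‖) :
    ∃ m : Eucl 2, ∀ v : Eucl 2, |(suppFn Q v - suppFn Q (-v)) / 2 - ⟪v, m⟫| ≤ 40 * √κ * ‖v‖ := by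
  have hD1 : Metric.closedBall 0 1 ⊆ (diffBody Q : Set (Eucl 2)) := by
    intro z hz
    refine mem_of_forall_inner_le _ fun u => ?_
    rw [mem_closedBall_zero_iff] at hz
    calc ⟪u, z⟫ ≤ ‖u‖ * ‖z‖ := real_inner_le_norm u z
      _ ≤ ‖u‖ * 1 := by gcongr
      _ ≤ _ := by rw [mul_one]; exact (hD u).1
  have hD2 : (diffBody Q : Set (Eucl 2)) ⊆ Metric.closedBall 0 (1 + κ) := by
    intro z hz
    rw [mem_closedBall_zero_iff]
    by_contra! hcon
    have h1 := (inner_le_suppFn (diffBody Q) z hz).trans (hD z).2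
    rw [real_inner_self_eq_norm_sq] at h1
    have h2 : 0 < ‖z‖ := by linarith
    nlinarith
  have he := norm_stdVec (0 : Fin 2)
  -- The centre is fixed once, by a long chord in direction e₀. For each v a parallelogram with
  -- diagonals along e₀ and v has its centre within 14√κ of m; together with the error 20κ of the
  -- diagonal this gives 34√κ.
  obtain ⟨m, E, -, h1, h2, -, -, h3, -⟩ :=
    h.exists_parallelogram hk hk' hlam hD1 hD2 hQ he he
  have hκ1 : κ ≤ √κ := by
    nlinarith [Real.mul_self_sqrt hk, Real.sqrt_nonneg κ, Real.sqrt_le_one (x := κ)]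
  have hlow : ∀ v : Eucl 2, ‖v‖ = 1 →
      ⟪v, m⟫ + 1 - 34 * √κ ≤ suppFn Q v ∧ -⟪v, m⟫ + 1 - 34 * √κ ≤ suppFn Q (-v) := by
    intro v hv
    obtain ⟨m', E', V, h1', h2', h4, h5, h3', h6⟩ :=
      h.exists_parallelogram hk hk' hlam hD1 hD2 hQ he hv
    have hm := norm_midpoint_sub_le hk hk' hD2 he h3 h3' h1 h2 h1' h2'
    have h7 := inner_le_suppFn Q v h4
    have h8 := inner_le_suppFn Q (-v) h5
    have e1 : |⟪v, m - m'⟫| ≤ 14 * √κ := by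
      have := abs_real_inner_le_norm v (m - m')
      rw [hv, one_mul] at this
      exact this.trans hm
    have e2 : |⟪v, V - v⟫| ≤ 20 * κ := by
      have := abs_real_inner_le_norm v (V - v)
      rw [hv, one_mul] at this
      exact this.trans h6
    rw [inner_sub_right, inner_self_of_unit hv] at e2
    rw [inner_sub_right] at e1
    rw [inner_add_right] at h7
    rw [inner_neg_left, inner_sub_right] at h8
    obtain ⟨e3, e4⟩ := abs_le.1 e1
    obtain ⟨e5, e6⟩ := abs_le.1 e2
    constructor <;> linarith
  refine ⟨m, fun v => ?_⟩
  have hunit : ∀ v : Eucl 2, ‖v‖ = 1 →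
      |(suppFn Q v - suppFn Q (-v)) / 2 - ⟪v, m⟫| ≤ 40 * √κ := by
    intro v hv
    obtain ⟨h4, h5⟩ := hlow v hv
    have h6 := (hD v).2
    rw [suppFn_diffBody, hv] at h6
    rw [abs_le]
    constructor <;> linarith
  by_cases hv : v = 0
  · subst hv; simp
  have hN : 0 < ‖v‖ := norm_pos_iff.2 hv
  have hv' : v = ‖v‖ • (‖v‖⁻¹ • v) := by rw [smul_inv_smul₀ hN.ne']
  obtain ⟨w, hw⟩ : ∃ w, w = ‖v‖⁻¹ • v := ⟨_, rfl⟩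
  have hw1 : ‖w‖ = 1 := by rw [hw, norm_smul, norm_inv, norm_norm, inv_mul_cancel₀ hN.ne']
  obtain ⟨N, hNd⟩ : ∃ N, N = ‖v‖ := ⟨_, rfl⟩
  rw [← hw, ← hNd] at hv'
  rw [← hNd] at hN ⊢
  rw [hv', ← smul_neg, suppFn_smul _ hN.le, suppFn_smul _ hN.le, real_inner_smul_left]
  have : (N * suppFn Q w - N * suppFn Q (-w)) / 2 - N * ⟪w, m⟫ =
      N * ((suppFn Q w - suppFn Q (-w)) / 2 - ⟪w, m⟫) := by ring
  rw [this, abs_mul, abs_of_pos hN, mul_comm]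
  exact mul_le_mul_of_nonneg_right (hunit w hw1) hN.le

/-- A plane body whose linear images all have nearly elliptic double symmetrals is nearly
symmetric. -/
theorem exists_plane_center : ∃ C δ : ℝ, 0 < C ∧ 0 < δ ∧ ∀ (η : ℝ) (Q : ConvexBody (Eucl 2)),
    0 ≤ η → η ≤ δ → (interior (Q : Set (Eucl 2))).Nonempty → AllNearEllipse (1 + η) Q →
    ∃ m : Eucl 2, ∀ v : Eucl 2, |(suppFn Q v - suppFn Q (-v)) / 2 - ⟪v, m⟫| ≤
      C * √η * suppFn (diffBody Q) v := by
  obtain ⟨c, hc, hmain⟩ := exists_plane_norm_approx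
  -- Chosen so that (1 + η)⁶ + ((1 + η)² - 1)/c ≤ 1 + C₀η for 0 ≤ η ≤ 1.
  obtain ⟨C₀, hC₀⟩ : ∃ C₀ : ℝ, C₀ = 6 * 2 ^ 6 + 3 / c := ⟨_, rfl⟩
  have hC₀1 : 1 ≤ C₀ := by
    have : 0 < 3 / c := by positivity
    rw [hC₀]; norm_num; linarith
  refine ⟨40 * √C₀, 1 / (100 * C₀), by positivity, by positivity, fun η Q hη hηδ hQ h => ?_⟩
  have hη1 : C₀ * η ≤ 1 / 100 := by
    rw [le_div_iff₀ (by positivity)] at hηδ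
    linarith
  have hη2 : η ≤ 1 := by nlinarith
  obtain ⟨Ψ, a, b, ha, hab, hba, hΨ⟩ := hmain (1 + η) Q (by linarith) hQ h
  have hmu : b ≤ (1 + C₀ * η) * a := by
    rw [div_eq_iff ha.ne'] at hba
    rw [hba]
    refine mul_le_mul_of_nonneg_right ?_ ha.le
    have h1 := one_add_pow_le hη hη2 6
    have h2 : ((1 + η) ^ 2 - 1) / c ≤ 3 / c * η := by
      rw [div_mul_eq_mul_div]
      gcongr; nlinarith
    push_cast at h1
    rw [hC₀, add_mul]
    linarith
  -- The map T with adjoint Θ⁻¹ makes the half-difference body of the image nearly the unit disc,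
  -- with κ = C₀η.
  obtain ⟨Θ, hΘ⟩ : ∃ Θ : Eucl 2 ≃ₗ[ℝ] Eucl 2, ∀ u, Θ u = a • Ψ u :=
    ⟨Ψ.trans (LinearEquiv.smulOfNeZero ℝ _ a ha.ne'), fun u => rfl⟩
  have hΘn : ∀ u, ‖Θ u‖ = a * ‖Ψ u‖ := fun u => by
    rw [hΘ, norm_smul, Real.norm_of_nonneg ha.le]
  obtain ⟨T, hT⟩ := exists_adjoint Θ.symm
  have hT' : ∀ u x, ⟪u, (T : Eucl 2 →ₗ[ℝ] Eucl 2) x⟫ = ⟪Θ.symm u, x⟫ := fun u x => by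
    rw [LinearEquiv.coe_coe, real_inner_comm, ← hT, real_inner_comm]
  have hsupp : ∀ u, suppFn (linearImage (T : Eucl 2 →ₗ[ℝ] Eucl 2) Q) u = suppFn Q (Θ.symm u) :=
    fun u => suppFn_linearImage _ _ (hT' u)
  have hsuppD : ∀ u, suppFn (diffBody (linearImage (T : Eucl 2 →ₗ[ℝ] Eucl 2) Q)) u =
      suppFn (diffBody Q) (Θ.symm u) := fun u => by
    rw [diffBody_linearImage]
    exact suppFn_linearImage _ _ (hT' u)
  obtain ⟨m, hm⟩ := (h.image T).exists_center_of_round (κ := C₀ * η) (by positivity) hη1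
    (by nlinarith) (interior_linearImage hQ T.surjective) fun u => by
      rw [hsuppD]
      obtain ⟨h1, h2⟩ := hΨ (Θ.symm u)
      have h3 := hΘn (Θ.symm u)
      rw [Θ.apply_symm_apply] at h3
      rw [h3]
      exact ⟨h1, h2.trans (by nlinarith [norm_nonneg (Ψ (Θ.symm u))])⟩
  obtain ⟨Θ', hΘ'⟩ := exists_adjoint Θ
  refine ⟨Θ' m, fun v => ?_⟩
  have h1 := hm (Θ v)
  rw [hsupp, ← map_neg, hsupp, Θ.symm_apply_apply, Θ.symm_apply_apply, hΘn] at h1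
  have h2 : ⟪v, Θ' m⟫ = ⟪Θ v, m⟫ := by rw [real_inner_comm, ← hΘ', real_inner_comm]
  rw [h2]
  refine h1.trans ?_
  rw [Real.sqrt_mul (by linarith), ← mul_assoc 40]
  exact mul_le_mul_of_nonneg_left (hΨ v).1 (by positivity)

end PlaneTheorem

/-! ### Symmetrization along lists of coordinate directions. -/

section CoordinateSymmetrization

open MeasureTheory

variable {n : ℕ}

/-- Successive symmetrization along the coordinate directions of a list, the last one first. -/
noncomputable def symList (l : List (Fin n)) (K : ConvexBody (Eucl n)) : ConvexBody (Eucl n) :=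
  l.foldr (fun i L => steinerBody (stdVec i) (norm_stdVec i) L) K

@[simp] lemma symList_nil (K : ConvexBody (Eucl n)) : symList [] K = K := rfl

@[simp] lemma symList_cons (i : Fin n) (l : List (Fin n)) (K : ConvexBody (Eucl n)) :
    symList (i :: l) K = steinerBody (stdVec i) (norm_stdVec i) (symList l K) := rfl

lemma IsSteinerAffineLimit.of_symList {l : List (Fin n)} {K C : ConvexBody (Eucl n)}
    (h : IsSteinerAffineLimit (symList l K) C) : IsSteinerAffineLimit K C := by
  induction l with
  | nil => exact h
  | cons i l ih =>
    exact ih (IsSteinerAffineLimit.of_step (Or.inl (isSteinerStep_steinerBody _ (norm_stdVec i))) h)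

lemma inner_stdVec_of_ne {i j : Fin n} (h : i ≠ j) : ⟪(stdVec i : Eucl n), stdVec j⟫ = 0 := by
  rw [inner_stdVec]; simp [stdVec, h]

lemma hrefl_mem_symList {l : List (Fin n)} {K : ConvexBody (Eucl n)} {i : Fin n} (hi : i ∈ l) :
    ∀ z ∈ (symList l K : Set (Eucl n)), hrefl (stdVec i) z ∈ (symList l K : Set (Eucl n)) := by
  induction l with
  | nil => simp at hi
  | cons j l ih =>
    by_cases hij : i = j
    · subst hij
      exact fun z hz => hrefl_mem_steinerSet (norm_stdVec i) hz
    · exact hrefl_mem_steinerSet_of_orthogonal (inner_stdVec_of_ne (Ne.symm hij))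
        (ih ((List.mem_cons.1 hi).resolve_left hij))

lemma hrefl_stdVec_apply (i j : Fin n) (z : Eucl n) :
    hrefl (stdVec i) z j = if j = i then -z j else z j := by
  simp only [hrefl, inner_stdVec]
  simp only [stdVec]
  by_cases h : j = i
  · subst h; simp; ring
  · simp [h]

/-- Composition of coordinate reflections. -/
lemma flip_mem_of_hrefl {S : Set (Eucl n)} (s : Finset (Fin n))
    (h : ∀ i ∈ s, ∀ z ∈ S, hrefl (stdVec i) z ∈ S) :
    ∀ z ∈ S, ∀ w : Eucl n, (∀ j, w j = if j ∈ s then -z j else z j) → w ∈ S := by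
  induction s using Finset.induction_on with
  | empty =>
    intro z hz w hw
    have : w = z := by ext j; simpa using hw j
    rwa [this]
  | insert i s hi ih =>
    intro z hz w hw
    have h1 := ih (fun j hj => h j (Finset.mem_insert_of_mem hj)) (hrefl (stdVec i) z)
      (h i (Finset.mem_insert_self i s) z hz) w
    refine h1 fun j => ?_
    rw [hw j, hrefl_stdVec_apply]
    by_cases hj : j = i
    · subst hj; simp [hi]
    · simp [hj]

lemma neg_mem_of_hrefl {S : Set (Eucl n)} (h : ∀ i, ∀ z ∈ S, hrefl (stdVec i) z ∈ S) :
    ∀ z ∈ S, -z ∈ S := fun z hz =>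
  flip_mem_of_hrefl Finset.univ (fun i _ => h i) z hz (-z) (by simp)

/-- An `o`-symmetric set with all but one coordinate symmetries has the last one as well. -/
lemma hrefl_mem_of_neg {S : Set (Eucl n)} (hneg : ∀ z ∈ S, -z ∈ S) (i : Fin n)
    (h : ∀ j, j ≠ i → ∀ z ∈ S, hrefl (stdVec j) z ∈ S) : ∀ z ∈ S, hrefl (stdVec i) z ∈ S := by
  intro z hz
  refine flip_mem_of_hrefl (Finset.univ.erase i)
    (fun j hj => h j (Finset.ne_of_mem_erase hj)) (-z) (hneg z hz) _ fun j => ?_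
  rw [hrefl_stdVec_apply]
  by_cases hj : j = i <;> simp [hj]

lemma suppFn_symList {l : List (Fin n)} {K : ConvexBody (Eucl n)} {u : Eucl n}
    (h : ∀ i ∈ l, ⟪stdVec i, u⟫ = 0) : suppFn (symList l K) u = suppFn K u := by
  induction l with
  | nil => rfl
  | cons i l ih =>
    rw [symList_cons, coe_steinerBody, suppFn_steinerBody (norm_stdVec i) (h i (by simp)),
      ih fun j hj => h j (by simp [hj])]

lemma setIntegral_symList {l : List (Fin n)} {K : ConvexBody (Eucl n)} {φ : Eucl n → ℝ}
    (hφ : Continuous φ) (h : ∀ i ∈ l, ∀ x, φ (hproj (stdVec i) x) = φ x) :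
    ∫ x in (symList l K : Set (Eucl n)), φ x = ∫ x in (K : Set (Eucl n)), φ x := by
  induction l with
  | nil => rfl
  | cons i l ih =>
    rw [symList_cons, coe_steinerBody, setIntegral_steinerBody (norm_stdVec i) _ hφ
      (h i (by simp)), ih fun j hj => h j (by simp [hj])]

lemma symList_subset_smul (l : List (Fin n)) {c : ℝ} (hc : 0 < c) {K L : ConvexBody (Eucl n)}
    (h : (K : Set (Eucl n)) ⊆ c • (L : Set (Eucl n))) :
    (symList l K : Set (Eucl n)) ⊆ c • (symList l L : Set (Eucl n)) := by
  induction l with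
  | nil => exact h
  | cons i l ih => exact steinerSet_subset_smul _ hc ih

lemma neg_mem_symList (l : List (Fin n)) {K : ConvexBody (Eucl n)}
    (h : ∀ z ∈ (K : Set (Eucl n)), -z ∈ (K : Set (Eucl n))) :
    ∀ z ∈ (symList l K : Set (Eucl n)), -z ∈ (symList l K : Set (Eucl n)) := by
  induction l with
  | nil => exact h
  | cons i l ih => exact neg_mem_steinerSet ih

/-- The boundary of a convex set is null, so positive volume forces interior points. -/
lemma interior_nonempty_of_volume_ne_zero {K : ConvexBody (Eucl n)}
    (h : ∫ _x in (K : Set (Eucl n)), (1 : ℝ) ≠ 0) : (interior (K : Set (Eucl n))).Nonempty := by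
  rw [nonempty_iff_ne_empty]
  intro h0
  apply h
  have h1 : volume (K : Set (Eucl n)) = 0 := by
    refine measure_mono_null ?_ (K.convex.addHaar_frontier volume)
    rw [frontier, h0, sdiff_empty]
    exact subset_closure
  rw [volume_integral_eq, Measure.real, h1, ENNReal.toReal_zero]

lemma interior_symList (l : List (Fin n)) {K : ConvexBody (Eucl n)}
    (hK : (interior (K : Set (Eucl n))).Nonempty) :
    (interior (symList l K : Set (Eucl n))).Nonempty := by
  apply interior_nonempty_of_volume_ne_zero
  rw [setIntegral_symList continuous_const (by simp)]
  exact (volume_integral_pos hK).ne'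

lemma exists_mem_of_mem_symList {l : List (Fin n)} {K : ConvexBody (Eucl n)} {z : Eucl n}
    (hz : z ∈ symList l K) : ∃ x ∈ K, ∀ j ∉ l, x j = z j := by
  induction l generalizing z with
  | nil => exact ⟨z, hz, fun _ _ => rfl⟩
  | cons i l ih =>
    obtain ⟨s, -, hs, -, -⟩ := hz
    obtain ⟨x, hx, hxj⟩ := ih hs
    refine ⟨x, hx, fun j hj => ?_⟩
    rw [List.mem_cons, not_or] at hj
    rw [hxj j hj.2, hproj_stdVec_add, if_neg hj.1]

lemma exists_mem_symList {l : List (Fin n)} {K : ConvexBody (Eucl n)} {x : Eucl n} (hx : x ∈ K) :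
    ∃ z ∈ symList l K, ∀ j, z j = if j ∈ l then 0 else x j := by
  induction l with
  | nil => exact ⟨x, hx, by simp⟩
  | cons i l ih =>
    obtain ⟨z, hz, hzj⟩ := ih
    refine ⟨hproj (stdVec i) z, hproj_mem_steinerSet (norm_stdVec i) hz, fun j => ?_⟩
    have := hproj_stdVec_add i z 0 j
    rw [zero_smul, add_zero] at this
    rw [this]
    by_cases hj : j = i
    · simp [hj]
    · simp [hj, hzj]

/-- A linear map that sends u to v and preserves the corresponding coordinates maps chords to
chords; it is applied to the projection to a plane and to the inclusion of that plane. -/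
lemma map_mem_steinerSet_of_linear {k : ℕ} (f : Eucl n →ₗ[ℝ] Eucl k) {u : Eucl n} {v : Eucl k}
    (hf : f u = v) (hi : ∀ z, ⟪v, f z⟫ = ⟪u, z⟫) {K : Set (Eucl n)} {L : Set (Eucl k)}
    (hK : ∀ z ∈ K, f z ∈ L) : ∀ z ∈ steinerSet u K, f z ∈ steinerSet v L := by
  rintro z ⟨s, t, hs, ht, hst⟩
  have h : ∀ r : ℝ, hproj v (f z) + r • v = f (hproj u z + r • u) := fun r => by
    rw [hproj, hproj, hi, map_add, map_sub, map_smul, map_smul, hf]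
  refine ⟨s, t, ?_, ?_, by rwa [hi]⟩
  · rw [h]; exact hK _ hs
  · rw [h]; exact hK _ ht

end CoordinateSymmetrization

/-! ### The unconditional symmetral and its trace on the first coordinate plane. -/

section PlaneProjection

variable {m : ℕ}

/-- The projection to the plane of the first two coordinates. -/
noncomputable def planeProj (m : ℕ) : Eucl (m + 2) →ₗ[ℝ] Eucl 2 where
  toFun x := !₂[x 0, x 1]
  map_add' x y := by refine eucl_two_ext ?_ ?_ <;> simp
  map_smul' c x := by refine eucl_two_ext ?_ ?_ <;> simp

/-- The inclusion of the plane of the first two coordinates. -/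
noncomputable def planeIncl (m : ℕ) : Eucl 2 →ₗ[ℝ] Eucl (m + 2) where
  toFun z := z 0 • stdVec 0 + z 1 • stdVec 1
  map_add' x y := by simp only [PiLp.add_apply, add_smul]; abel
  map_smul' c x := by simp only [PiLp.smul_apply, smul_eq_mul, mul_smul, smul_add, RingHom.id_apply]

lemma planeProj_apply (x : Eucl (m + 2)) : planeProj m x = !₂[x 0, x 1] := rfl

lemma planeIncl_apply (z : Eucl 2) : planeIncl m z = z 0 • stdVec 0 + z 1 • stdVec 1 := rfl

lemma planeIncl_zero (z : Eucl 2) : planeIncl m z 0 = z 0 := by simp [planeIncl_apply, stdVec]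

lemma planeIncl_one (z : Eucl 2) : planeIncl m z 1 = z 1 := by simp [planeIncl_apply, stdVec]

lemma planeIncl_succ_succ (z : Eucl 2) (i : Fin m) : planeIncl m z i.succ.succ = 0 := by
  have h1 : i.succ.succ ≠ 1 := fun h => Fin.succ_ne_zero i (Fin.succ_injective _ h)
  simp [planeIncl_apply, stdVec, h1]

lemma planeProj_planeIncl (z : Eucl 2) : planeProj m (planeIncl m z) = z := by
  rw [planeProj_apply, planeIncl_zero, planeIncl_one]
  exact eucl_two_ext rfl rfl

/-- The directions of the coordinates beyond the second. -/
def tailList (m : ℕ) : List (Fin (m + 2)) := (List.finRange m).map fun i => i.succ.succ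

lemma finRange_eq_tailList (m : ℕ) : List.finRange (m + 2) = 0 :: 1 :: tailList m := by
  rw [List.finRange_succ, List.finRange_succ]
  simp [tailList, Function.comp_def]

lemma not_mem_tailList : (0 : Fin (m + 2)) ∉ tailList m ∧ (1 : Fin (m + 2)) ∉ tailList m := by
  have h1 : ∀ i : Fin m, i.succ.succ ≠ 1 := fun i h => Fin.succ_ne_zero i (Fin.succ_injective _ h)
  simp [tailList, h1]

/-- The list is processed from its end, so the coordinates 0 and 1 come last. The earlier
symmetrizations do not alter the shadow in this plane, and the last two commute with the projection.
-/
lemma planeProj_mem_doubleSym {K : ConvexBody (Eucl (m + 2))} {z : Eucl (m + 2)}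
    (hz : z ∈ symList (List.finRange (m + 2)) K) :
    planeProj m z ∈ doubleSym (linearImage (planeProj m) K) := by
  rw [finRange_eq_tailList] at hz
  refine map_mem_steinerSet_of_linear (planeProj m) (u := stdVec 0)
    (eucl_two_ext (by simp [planeProj_apply, stdVec]) (by simp [planeProj_apply, stdVec]))
    (fun w => by rw [inner_stdVec, inner_stdVec]; rfl)
    (map_mem_steinerSet_of_linear (planeProj m) (u := stdVec 1)
      (eucl_two_ext (by simp [planeProj_apply, stdVec]) (by simp [planeProj_apply, stdVec]))
      (fun w => by rw [inner_stdVec, inner_stdVec]; rfl)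
      (K := symList (tailList m) K) fun w hw => ?_) z hz
  obtain ⟨x, hx, hxj⟩ := exists_mem_of_mem_symList hw
  refine ⟨x, hx, ?_⟩
  rw [planeProj_apply, planeProj_apply, hxj 0 not_mem_tailList.1, hxj 1 not_mem_tailList.2]

/-- Symmetrization along the tail directions brings the shadow of every point of K into the body as
a point of the coordinate plane; the last two symmetrizations then act within the plane. -/
lemma planeIncl_mem_symList {K : ConvexBody (Eucl (m + 2))} {z : Eucl 2}
    (hz : z ∈ doubleSym (linearImage (planeProj m) K)) :
    planeIncl m z ∈ symList (List.finRange (m + 2)) K := by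
  rw [finRange_eq_tailList]
  refine map_mem_steinerSet_of_linear (planeIncl m) (u := stdVec 0)
    (by simp [planeIncl_apply, stdVec])
    (fun w => by rw [inner_stdVec, inner_stdVec, planeIncl_zero])
    (map_mem_steinerSet_of_linear (planeIncl m) (u := stdVec 1)
      (by simp [planeIncl_apply, stdVec])
      (fun w => by rw [inner_stdVec, inner_stdVec, planeIncl_one])
      (L := symList (tailList m) K) ?_) z hz
  rintro _ ⟨x, hx, rfl⟩
  obtain ⟨y, hy, hyj⟩ := exists_mem_symList (l := tailList m) hx
  have hxy : planeIncl m (planeProj m x) = y := ?_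
  · rw [hxy]; exact hy
  ext j
  rw [hyj]
  refine Fin.cases ?_ (fun j => Fin.cases ?_ (fun j => ?_) j) j
  · rw [planeIncl_zero, if_neg not_mem_tailList.1]; rfl
  · rw [Fin.succ_zero_eq_one, planeIncl_one, if_neg not_mem_tailList.2]; rfl
  · rw [planeIncl_succ_succ, if_pos (by simp [tailList])]

/-- If the unconditional symmetral of `K` is nearly an ellipsoid, then the projection of `K` to the
first coordinate plane has a nearly elliptic double symmetral. -/
lemma exists_isNearEllipse {K : ConvexBody (Eucl (m + 2))} {lam : ℝ} (hl : 1 ≤ lam)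
    {Φ : Eucl (m + 2) ≃ₗ[ℝ] Eucl (m + 2)}
    (h1 : (symList (List.finRange (m + 2)) K : Set (Eucl (m + 2))) ⊆ ellBody Φ)
    (h2 : (ellBody Φ : Set (Eucl (m + 2))) ⊆
      lam • (symList (List.finRange (m + 2)) K : Set (Eucl (m + 2)))) :
    ∃ a b, IsNearEllipse lam a b (linearImage (planeProj m) K) := by
  have hl0 : 0 < lam := by linarith
  have hne : ∀ i : Fin (m + 2), 0 < ‖Φ.symm (stdVec i)‖ := fun i => by
    rw [norm_pos_iff, ne_eq, LinearEquiv.map_eq_zero_iff, ← norm_eq_zero, norm_stdVec]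
    exact one_ne_zero
  obtain ⟨p, hp⟩ : ∃ p, p = Φ.symm (stdVec 0) := ⟨_, rfl⟩
  obtain ⟨q, hq⟩ : ∃ q, q = Φ.symm (stdVec 1) := ⟨_, rfl⟩
  have hp0 : 0 < ‖p‖ := hp ▸ hne 0
  have hq0 : 0 < ‖q‖ := hq ▸ hne 1
  obtain ⟨ρ, hρ⟩ : ∃ ρ : Eucl 2 → Eucl 2, ∀ z, ρ z = !₂[z 0, -z 1] := ⟨_, fun _ => rfl⟩
  have hnorm : ∀ z : Eucl 2, ‖Φ.symm (planeIncl m z)‖ ^ 2 =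
      z 0 ^ 2 * ‖p‖ ^ 2 + 2 * (z 0 * z 1 * ⟪p, q⟫) + z 1 ^ 2 * ‖q‖ ^ 2 := by
    intro z
    rw [planeIncl_apply, map_add, map_smul, map_smul, ← hp, ← hq, norm_add_sq_real,
      real_inner_smul_left, inner_smul_right, norm_smul, norm_smul, mul_pow, mul_pow,
      Real.norm_eq_abs, Real.norm_eq_abs, sq_abs, sq_abs]
    ring
  -- The trace of the ellipsoid may be oblique, but the double symmetral is invariant under `ρ`.
  -- Averaging the quadratic form over `ρ` removes the mixed term and yields an axis-parallel
  -- ellipse; if the average is at most 1, so is one of the two values.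
  have havg : ∀ z : Eucl 2, (z 0 / ‖p‖⁻¹) ^ 2 + (z 1 / ‖q‖⁻¹) ^ 2 =
      (‖Φ.symm (planeIncl m z)‖ ^ 2 + ‖Φ.symm (planeIncl m (ρ z))‖ ^ 2) / 2 := by
    intro z
    rw [hnorm, hnorm, hρ]
    simp only [Matrix.cons_val_zero, Matrix.cons_val_one, div_inv_eq_mul]
    ring
  have hρW : ∀ z ∈ doubleSym (linearImage (planeProj m) K),
      ρ z ∈ doubleSym (linearImage (planeProj m) K) := by
    intro z hz
    have h3 := hrefl_mem_steinerSet_of_orthogonal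
      (inner_stdVec_of_ne (show (0 : Fin 2) ≠ 1 by decide))
      (fun w hw => hrefl_mem_steinerSet (norm_stdVec 1) hw) z hz
    have h4 : ρ z = hrefl (stdVec 1) z := ?_
    · rw [h4]; exact h3
    refine eucl_two_ext ?_ ?_
    · rw [hrefl_stdVec_apply, hρ]; simp
    · rw [hrefl_stdVec_apply, hρ]; simp
  have hsub : ∀ z ∈ doubleSym (linearImage (planeProj m) K),
      ‖Φ.symm (planeIncl m z)‖ ^ 2 ≤ 1 := by
    intro z hz
    have := h1 (planeIncl_mem_symList hz)
    rw [SetLike.mem_coe, mem_ellBody] at this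
    exact pow_le_one₀ (norm_nonneg _) this
  have hsup : ∀ z : Eucl 2, ‖Φ.symm (planeIncl m z)‖ ^ 2 ≤ 1 →
      lam⁻¹ • z ∈ doubleSym (linearImage (planeProj m) K) := by
    intro z hz
    have h3 : planeIncl m z ∈ ellBody Φ := by
      rw [mem_ellBody]
      exact (sq_le_one_iff₀ (norm_nonneg _)).1 hz
    have h4 := (Set.mem_smul_set_iff_inv_smul_mem₀ hl0.ne' _ _).1 (h2 h3)
    have h5 := planeProj_mem_doubleSym h4
    rwa [← map_smul, planeProj_planeIncl] at h5
  refine ⟨‖p‖⁻¹, ‖q‖⁻¹, hl, by positivity, by positivity, fun z hz => ?_, fun z hz => ?_⟩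
  · rw [havg]
    linarith [hsub z hz, hsub _ (hρW z hz)]
  · rw [havg] at hz
    rcases le_total (‖Φ.symm (planeIncl m z)‖ ^ 2) (‖Φ.symm (planeIncl m (ρ z))‖ ^ 2) with h3 | h3
    · exact hsup z (by linarith)
    · have h4 := hρW _ (hsup (ρ z) (by linarith))
      convert h4 using 1
      refine eucl_two_ext ?_ ?_ <;> simp [hρ]

end PlaneProjection

/-! ### Any two surjections onto the same space differ by an automorphism of the source. -/

section SurjectivePlane

/-- Both maps split the source as kernel times W, and the kernels have equal dimension. -/
lemma exists_linearEquiv_comp_eq {V W : Type*} [AddCommGroup V] [Module ℝ V]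
    [FiniteDimensional ℝ V] [AddCommGroup W] [Module ℝ W] [FiniteDimensional ℝ W]
    {f g : V →ₗ[ℝ] W} (hf : Function.Surjective f) (hg : Function.Surjective g) :
    ∃ A : V ≃ₗ[ℝ] V, ∀ x, g (A x) = f x := by
  have key : ∀ f : V →ₗ[ℝ] W, Function.Surjective f →
      ∃ e : V ≃ₗ[ℝ] LinearMap.ker f × W, ∀ x, (e x).2 = f x := by
    intro f hf
    obtain ⟨p, hp⟩ := (LinearMap.ker f).exists_isCompl
    refine ⟨LinearMap.equivProdOfSurjectiveOfIsCompl
      (Submodule.projectionOnto _ _ hp) f ?_ (LinearMap.range_eq_top.2 hf) ?_, fun x => rfl⟩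
    · exact Submodule.range_projectionOnto hp
    · rw [Submodule.ker_projectionOnto]; exact hp.symm
  obtain ⟨e₁, h₁⟩ := key f hf
  obtain ⟨e₂, h₂⟩ := key g hg
  have hk : Module.finrank ℝ (LinearMap.ker f) = Module.finrank ℝ (LinearMap.ker g) := by
    have a := LinearMap.finrank_range_add_finrank_ker f
    have b := LinearMap.finrank_range_add_finrank_ker g
    rw [LinearMap.range_eq_top.2 hf] at a
    rw [LinearMap.range_eq_top.2 hg] at b
    omega
  refine ⟨e₁.trans (((LinearEquiv.ofFinrankEq _ _ hk).prodCongr (LinearEquiv.refl ℝ W)).trans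
    e₂.symm), fun x => ?_⟩
  rw [← h₂, ← h₁]
  simp

end SurjectivePlane

/-! ### From near symmetry of all plane projections to a near centre of the body. -/

section Center

variable {n m : ℕ} {lam : ℝ}

/-- The unconditional symmetrals of all affine images of `K` are nearly ellipsoids. -/
def AllNearEllipsoid (lam : ℝ) (K : ConvexBody (Eucl n)) : Prop :=
  ∀ (c : Eucl n) (A : Eucl n ≃ₗ[ℝ] Eucl n), ∃ Φ : Eucl n ≃ₗ[ℝ] Eucl n,
    (symList (List.finRange n) (linearImage (A : Eucl n →ₗ[ℝ] Eucl n) (translateBody c K)) :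
      Set (Eucl n)) ⊆ ellBody Φ ∧
    (ellBody Φ : Set (Eucl n)) ⊆ lam • (symList (List.finRange n)
      (linearImage (A : Eucl n →ₗ[ℝ] Eucl n) (translateBody c K)) : Set (Eucl n))

/-- The odd part of the support function. -/
noncomputable def asym (K : ConvexBody (Eucl n)) (u : Eucl n) : ℝ :=
  (suppFn K u - suppFn K (-u)) / 2

lemma asym_smul (K : ConvexBody (Eucl n)) (t : ℝ) (u : Eucl n) :
    asym K (t • u) = t * asym K u := by
  unfold asym
  rcases le_total 0 t with ht | ht
  · rw [← smul_neg, suppFn_smul _ ht, suppFn_smul _ ht]; ring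
  · have h : ∀ v : Eucl n, suppFn K (t • v) = -t * suppFn K (-v) := fun v => by
      rw [← suppFn_smul _ (neg_nonneg.2 ht), smul_neg, neg_smul, neg_neg]
    rw [← smul_neg, h, h, neg_neg]; ring

/-- The pair of functionals given by two vectors. -/
noncomputable def pairMap (x y : Eucl n) : Eucl n →ₗ[ℝ] Eucl 2 where
  toFun z := !₂[⟪x, z⟫, ⟪y, z⟫]
  map_add' u v := by refine eucl_two_ext ?_ ?_ <;> simp [inner_add_right]
  map_smul' c u := by refine eucl_two_ext ?_ ?_ <;> simp [inner_smul_right]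

lemma pairMap_apply (x y z : Eucl n) : pairMap x y z = !₂[⟪x, z⟫, ⟪y, z⟫] := rfl

lemma inner_pairMap (x y z : Eucl n) (v : Eucl 2) :
    ⟪v, pairMap x y z⟫ = ⟪v 0 • x + v 1 • y, z⟫ := by
  rw [inner_eucl_two, pairMap_apply, inner_add_left, real_inner_smul_left, real_inner_smul_left]
  simp

lemma asym_linearImage {k : ℕ} (T : Eucl n →ₗ[ℝ] Eucl k) (K : ConvexBody (Eucl n)) {u : Eucl k}
    {v : Eucl n} (h : ∀ x, ⟪u, T x⟫ = ⟪v, x⟫) : asym (linearImage T K) u = asym K v := by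
  have h' : ∀ x, ⟪-u, T x⟫ = ⟪-v, x⟫ := fun x => by rw [inner_neg_left, inner_neg_left, h]
  rw [asym, asym, suppFn_linearImage T K h, suppFn_linearImage T K h']

/-- Every surjection onto the plane, followed by any plane map, is the coordinate projection after
some linear automorphism, and the hypothesis covers all automorphisms. -/
lemma AllNearEllipsoid.allNearEllipse {K : ConvexBody (Eucl (m + 2))}
    (h : AllNearEllipsoid lam K) (hl : 1 ≤ lam) {L : Eucl (m + 2) →ₗ[ℝ] Eucl 2}
    (hL : Function.Surjective L) : AllNearEllipse lam (linearImage L K) := by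
  intro T
  obtain ⟨A, hA⟩ := exists_linearEquiv_comp_eq (f := (T : Eucl 2 →ₗ[ℝ] Eucl 2) ∘ₗ L)
    (g := planeProj m) (T.surjective.comp hL) (fun z => ⟨planeIncl m z, planeProj_planeIncl z⟩)
  obtain ⟨Φ, h1, h2⟩ := h 0 A
  rw [translateBody_zero] at h1 h2
  have h3 := exists_isNearEllipse hl h1 h2
  rw [linearImage_linearImage] at h3 ⊢
  have h4 : planeProj m ∘ₗ (A : Eucl (m + 2) →ₗ[ℝ] Eucl (m + 2)) =
      (T : Eucl 2 →ₗ[ℝ] Eucl 2) ∘ₗ L := LinearMap.ext hA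
  rwa [h4] at h3

/-- A function which is homogeneous and nearly additive on orthogonal pairs is nearly linear. -/
lemma exists_linear_approx {F : Eucl n → ℝ} (hsmul : ∀ (t : ℝ) (x : Eucl n), F (t • x) = t * F x)
    {D : ℝ} (hD : 0 ≤ D)
    (hadd : ∀ x y, ⟪x, y⟫ = 0 → |F (x + y) - F x - F y| ≤ D * (‖x + y‖ + ‖x‖ + ‖y‖)) :
    ∃ c : Eucl n, ∀ x : Eucl n, |F x - ⟪x, c⟫| ≤ 3 * n * D * ‖x‖ := by
  -- The coordinates of x are added one at a time; each new term is orthogonal to the partial sum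
  -- and costs at most 3D‖x‖.
  have key : ∀ (x : Eucl n) (s : Finset (Fin n)),
      |F (WithLp.toLp 2 fun i => if i ∈ s then x i else 0) - ∑ i ∈ s, x i * F (stdVec i)| ≤
        s.card * (3 * D * ‖x‖) := by
    intro x s
    have hle : ∀ t : Finset (Fin n),
        ‖(WithLp.toLp 2 fun i => if i ∈ t then x i else 0 : Eucl n)‖ ≤ ‖x‖ := by
      intro t
      rw [← sq_le_sq₀ (norm_nonneg _) (norm_nonneg _), EuclideanSpace.norm_sq_eq,
        EuclideanSpace.norm_sq_eq]
      refine Finset.sum_le_sum fun i _ => ?_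
      by_cases hi : i ∈ t <;> simp [hi, sq_nonneg]
    induction s using Finset.induction_on with
    | empty =>
      have h0 : F 0 = 0 := by have := hsmul 0 0; rwa [zero_smul, zero_mul] at this
      have h1 : (WithLp.toLp 2 fun i => if i ∈ (∅ : Finset (Fin n)) then x i else 0 : Eucl n) = 0 := by
        ext i; simp
      rw [h1, h0]; simp
    | insert i s hi ih =>
      obtain ⟨y, hy⟩ : ∃ y : Eucl n, y = WithLp.toLp 2 fun i => if i ∈ s then x i else 0 := ⟨_, rfl⟩
      have hsplit : (WithLp.toLp 2 fun j => if j ∈ insert i s then x j else 0 : Eucl n) =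
          y + x i • stdVec i := by
        ext j
        by_cases hj : j = i
        · subst hj; simp [hy, hi, stdVec]
        · simp [hy, hj, stdVec]
      have horth : ⟪y, x i • stdVec i⟫ = 0 := by
        rw [inner_smul_right, real_inner_comm, inner_stdVec, hy]; simp [hi]
      have h1 := hadd _ _ horth
      rw [← hsplit] at h1
      rw [← hy] at ih
      have h2 : ‖y‖ ≤ ‖x‖ := hy ▸ hle s
      have h3 : ‖x i • stdVec i‖ ≤ ‖x‖ := by
        rw [norm_smul, norm_stdVec, mul_one]; exact PiLp.norm_apply_le x i
      have h4 := hle (insert i s)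
      rw [hsmul] at h1
      rw [Finset.sum_insert hi, Finset.card_insert_of_notMem hi]
      have h5 : D * (‖(WithLp.toLp 2 fun j => if j ∈ insert i s then x j else 0 : Eucl n)‖ + ‖y‖ +
          ‖x i • stdVec i‖) ≤ 3 * D * ‖x‖ := by
        calc _ ≤ D * (‖x‖ + ‖x‖ + ‖x‖) := by gcongr
          _ = _ := by ring
      have h6 := h1.trans h5
      rw [abs_le] at h6 ih ⊢
      push_cast
      constructor <;> linarith
  refine ⟨WithLp.toLp 2 fun i => F (stdVec i), fun x => ?_⟩
  have h1 := key x Finset.univ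
  have h2 : (WithLp.toLp 2 fun i => if i ∈ (Finset.univ : Finset (Fin n)) then x i else 0 :
      Eucl n) = x := by ext i; simp
  rw [h2, Finset.card_univ, Fintype.card_fin] at h1
  have h3 : ⟪x, (WithLp.toLp 2 fun i => F (stdVec i) : Eucl n)⟫ = ∑ i, x i * F (stdVec i) := by
    rw [PiLp.inner_apply]; simp [mul_comm]
  rw [h3]
  refine h1.trans (le_of_eq (by ring))

lemma pairMap_surjective {x y : Eucl n} (Θ : Eucl n ≃ₗ[ℝ] Eucl n) {x' y' : Eucl n}
    (hx : ∀ z, ⟪x, z⟫ = ⟪x', Θ z⟫) (hy : ∀ z, ⟪y, z⟫ = ⟪y', Θ z⟫) (h : ⟪x', y'⟫ = 0)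
    (hx0 : x' ≠ 0) (hy0 : y' ≠ 0) : Function.Surjective (pairMap x y) := by
  intro v
  have h' : ⟪y', x'⟫ = 0 := by rw [real_inner_comm]; exact h
  have h1 : ⟪x', x'⟫ ≠ 0 := inner_self_ne_zero.2 hx0
  have h2 : ⟪y', y'⟫ ≠ 0 := inner_self_ne_zero.2 hy0
  refine ⟨Θ.symm ((v 0 / ⟪x', x'⟫) • x' + (v 1 / ⟪y', y'⟫) • y'), ?_⟩
  rw [pairMap_apply, hx, hy, Θ.apply_symm_apply, inner_add_right, inner_add_right,
    inner_smul_right, inner_smul_right, inner_smul_right, inner_smul_right, h, h',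
    div_mul_cancel₀ _ h1, div_mul_cancel₀ _ h2]
  refine eucl_two_ext ?_ ?_ <;> simp

/-- If all unconditional symmetrals of affine images of `K` are nearly ellipsoids, then `K` is
nearly symmetric with respect to a point. -/
theorem exists_center (m : ℕ) : ∃ C δ : ℝ, 0 < C ∧ 0 < δ ∧
    ∀ (η : ℝ) (K : ConvexBody (Eucl (m + 2))), 0 ≤ η → η ≤ δ →
    (interior (K : Set (Eucl (m + 2)))).Nonempty → AllNearEllipsoid (1 + η) K →
    ∃ c : Eucl (m + 2), ∀ u : Eucl (m + 2), |asym K u - ⟪u, c⟫| ≤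
      C * √η * suppFn (diffBody K) u := by
  obtain ⟨C, δ, hC, hδ, hmain⟩ := exists_plane_center
  obtain ⟨R, hRdef⟩ : ∃ R : ℝ, R = 2 ^ (m + 2 + 2) := ⟨_, rfl⟩
  obtain ⟨r, hrdef⟩ : ∃ r : ℝ, r = 2 ^ (m + 2 + 1) := ⟨_, rfl⟩
  have hR : 0 < R := by rw [hRdef]; positivity
  have hr : 0 < r := by rw [hrdef]; positivity
  refine ⟨3 * (m + 2 : ℕ) * (C * R) * r, δ, by positivity, hδ, fun η K hη hηδ hK h => ?_⟩
  obtain ⟨c₀, Ψ, hΨ⟩ := exists_rough_position hK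
  rw [← hRdef, ← hrdef] at hΨ
  have hD : ∀ u : Eucl (m + 2), suppFn (diffBody K) u =
      (suppFn (translateBody c₀ K) u + suppFn (translateBody c₀ K) (-u)) / 2 := fun u => by
    rw [suppFn_diffBody, suppFn_translateBody, suppFn_translateBody, inner_neg_left]; ring
  have hD1 : ∀ u : Eucl (m + 2), suppFn (diffBody K) u ≤ R * ‖Ψ u‖ := fun u => by
    have h1 := (hΨ u).2
    have h2 := (hΨ (-u)).2
    rw [map_neg, norm_neg] at h2
    rw [hD]; linarith
  have hD2 : ∀ u : Eucl (m + 2), ‖Ψ u‖ ≤ r * suppFn (diffBody K) u := fun u => by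
    have h1 := (hΨ u).1
    have h2 := (hΨ (-u)).1
    rw [map_neg, norm_neg] at h2
    rw [← inv_mul_le_iff₀ hr, hD]; linarith
  obtain ⟨Θ, hΘ⟩ := exists_adjoint Ψ.symm
  have hΘ' : ∀ x z : Eucl (m + 2), ⟪Ψ.symm x, z⟫ = ⟪x, Θ z⟫ := fun x z => by
    rw [real_inner_comm, hΘ, real_inner_comm]
  have hl : (1 : ℝ) ≤ 1 + η := by linarith
  -- In the coordinates of the rough position the support function of D is comparable to the
  -- Euclidean norm, so the plane errors become multiples of norms. Orthogonal nonzero pairs give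
  -- surjective maps to the plane.
  obtain ⟨c, hc⟩ := exists_linear_approx (F := fun x => asym K (Ψ.symm x)) (D := C * √η * R)
    (fun t x => by simp only [map_smul, asym_smul]) (by positivity) (fun x y hxy => by
      have h0 : asym K 0 = 0 := by simp [asym]
      by_cases hx : x = 0
      · subst hx; simp [h0]; positivity
      by_cases hy : y = 0
      · subst hy; simp [h0]; positivity
      have hsurj := pairMap_surjective Θ (hΘ' x) (hΘ' y) hxy hx hy
      obtain ⟨p, hp⟩ := hmain η _ hη hηδ (interior_linearImage hK hsurj)
        (h.allNearEllipse hl hsurj)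
      have hv : ∀ v : Eucl 2, |asym K (Ψ.symm (v 0 • x + v 1 • y)) - ⟪v, p⟫| ≤
          C * √η * (R * ‖v 0 • x + v 1 • y‖) := by
        intro v
        have h1 := hp v
        have h2 : (suppFn (linearImage (pairMap (Ψ.symm x) (Ψ.symm y)) K) v -
            suppFn (linearImage (pairMap (Ψ.symm x) (Ψ.symm y)) K) (-v)) / 2 =
            asym K (v 0 • Ψ.symm x + v 1 • Ψ.symm y) :=
          asym_linearImage _ K (fun z => inner_pairMap _ _ z v)
        rw [h2, diffBody_linearImage,
          suppFn_linearImage _ (diffBody K) (fun z => inner_pairMap _ _ z v)] at h1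
        rw [map_add, map_smul, map_smul]
        refine h1.trans (mul_le_mul_of_nonneg_left ?_ (by positivity))
        have h3 := hD1 (v 0 • Ψ.symm x + v 1 • Ψ.symm y)
        rwa [map_add Ψ, map_smul Ψ, map_smul Ψ, Ψ.apply_symm_apply, Ψ.apply_symm_apply] at h3
      -- The plane centre gives a linear function; testing it at x, y and x + y yields near
      -- additivity.
      have e1 := hv !₂[1, 0]
      have e2 := hv !₂[0, 1]
      have e3 := hv !₂[1, 1]
      simp only [inner_eucl_two, Matrix.cons_val_zero, Matrix.cons_val_one, one_smul, zero_smul,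
        add_zero, zero_add, one_mul, zero_mul] at e1 e2 e3
      have e4 : C * √η * R * (‖x + y‖ + ‖x‖ + ‖y‖) = C * √η * (R * ‖x + y‖) +
        C * √η * (R * ‖x‖) + C * √η * (R * ‖y‖) := by ring
      rw [e4]
      rw [abs_le] at e1 e2 e3 ⊢
      constructor <;> linarith)
  obtain ⟨Θ', hΘ''⟩ := exists_adjoint Ψ
  refine ⟨Θ' c, fun u => ?_⟩
  have h1 := hc (Ψ u)
  have h2 : ⟪u, Θ' c⟫ = ⟪Ψ u, c⟫ := by rw [real_inner_comm, ← hΘ'', real_inner_comm]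
  simp only [Ψ.symm_apply_apply] at h1
  rw [h2]
  refine h1.trans ?_
  calc _ ≤ 3 * ((m + 2 : ℕ) : ℝ) * (C * √η * R) * (r * suppFn (diffBody K) u) := by
        gcongr; exact hD2 u
    _ = _ := by ring

end Center

/-! ### A nearly symmetric body with nearly ellipsoidal symmetrals is nearly an ellipsoid. -/

section NearlySymmetric

variable {n m : ℕ} {lam : ℝ}

lemma subset_smul_of_suppFn_le {K L : ConvexBody (Eucl n)} {c : ℝ} (hc : 0 < c)
    (h : ∀ u : Eucl n, suppFn K u ≤ c * suppFn L u) :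
    (K : Set (Eucl n)) ⊆ c • (L : Set (Eucl n)) := by
  intro x hx
  rw [Set.mem_smul_set_iff_inv_smul_mem₀ hc.ne']
  refine mem_of_forall_inner_le L fun u => ?_
  rw [inner_smul_right, inv_mul_le_iff₀ hc]
  exact (inner_le_suppFn K u hx).trans (h u)

lemma linearImage_subset_smul {k : ℕ} (T : Eucl n →ₗ[ℝ] Eucl k) {K L : ConvexBody (Eucl n)} {c : ℝ}
    (h : (K : Set (Eucl n)) ⊆ c • (L : Set (Eucl n))) :
    (linearImage T K : Set (Eucl k)) ⊆ c • (linearImage T L : Set (Eucl k)) := by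
  rw [coe_linearImage, coe_linearImage, ← image_smul_set]
  exact image_mono h

lemma suppFn_translateBody_eq (K : ConvexBody (Eucl n)) (c u : Eucl n) :
    suppFn (translateBody c K) u = suppFn (diffBody K) u + (asym K u - ⟪u, c⟫) := by
  rw [suppFn_translateBody, suppFn_diffBody, asym]; ring

lemma exists_linearEquiv_inner_eq {u v : Eucl n} (hu : u ≠ 0) (hv : v ≠ 0) :
    ∃ A : Eucl n ≃ₗ[ℝ] Eucl n, ∀ x, ⟪v, A x⟫ = ⟪u, x⟫ := by
  have hsurj : ∀ w : Eucl n, w ≠ 0 →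
      Function.Surjective (innerSL ℝ w : Eucl n →L[ℝ] ℝ).toLinearMap := by
    intro w hw t
    refine ⟨(t / ⟪w, w⟫) • w, ?_⟩
    simp only [ContinuousLinearMap.coe_coe, innerSL_apply_apply, inner_smul_right]
    exact div_mul_cancel₀ _ (inner_self_ne_zero.2 hw)
  exact exists_linearEquiv_comp_eq (hsurj u hu) (hsurj v hv)

/-- The directions of all coordinates but the first. -/
lemma finRange_eq_cons_map (m : ℕ) :
    List.finRange (m + 1) = 0 :: (List.finRange m).map Fin.succ := List.finRange_succ

/-- For an `o`-symmetric body the last of the coordinate symmetrizations is superfluous. -/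
lemma symList_finRange_of_symmetric {D : ConvexBody (Eucl (m + 1))}
    (hD : ∀ z ∈ (D : Set (Eucl (m + 1))), -z ∈ (D : Set (Eucl (m + 1)))) :
    (symList (List.finRange (m + 1)) D : Set (Eucl (m + 1))) =
      symList ((List.finRange m).map Fin.succ) D := by
  rw [finRange_eq_cons_map, symList_cons, coe_steinerBody]
  refine steinerSet_eq_self (norm_stdVec 0) (ConvexBody.convex _)
    (hrefl_mem_of_neg (neg_mem_symList _ hD) 0 fun j hj => hrefl_mem_symList ?_)
  obtain ⟨i, rfl⟩ := Fin.exists_succ_eq.2 hj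
  simp

/-- Near an ellipsoid after unconditional symmetrization, a nearly symmetric body has a
half-difference body with nearly quadratic moments. -/
lemma AllNearEllipsoid.moment {K : ConvexBody (Eucl (m + 1))} (h : AllNearEllipsoid lam K)
    (hl : 1 ≤ lam) {c : ℝ} (hc0 : 0 < c)
    (hc : ∀ (Φ : Eucl (m + 1) ≃ₗ[ℝ] Eucl (m + 1)) (u : Eucl (m + 1)),
      ∫ x in (ellBody Φ : Set (Eucl (m + 1))), ⟪u, x⟫ ^ 2 =
        c * suppFn (ellBody Φ) u ^ 2 * ∫ _x in (ellBody Φ : Set (Eucl (m + 1))), (1 : ℝ))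
    {p : Eucl (m + 1)} {s t : ℝ} (hs : 0 < s) (ht : 0 < t) (hst : 1 ≤ s * t)
    (h1 : (diffBody K : Set (Eucl (m + 1))) ⊆ s • (translateBody p K : Set (Eucl (m + 1))))
    (h2 : (translateBody p K : Set (Eucl (m + 1))) ⊆ t • (diffBody K : Set (Eucl (m + 1))))
    {u : Eucl (m + 1)} (hu : u ≠ 0) :
    c * suppFn (diffBody K) u ^ 2 * (∫ _x in (diffBody K : Set (Eucl (m + 1))), (1 : ℝ)) ≤
      (s * lam * t) ^ (m + 3) * ∫ x in (diffBody K : Set (Eucl (m + 1))), ⟪u, x⟫ ^ 2 ∧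
    ∫ x in (diffBody K : Set (Eucl (m + 1))), ⟪u, x⟫ ^ 2 ≤ (s * lam * t) ^ (m + 3) *
      (c * suppFn (diffBody K) u ^ 2 *
        ∫ _x in (diffBody K : Set (Eucl (m + 1))), (1 : ℝ)) := by
  have he0 : (stdVec 0 : Eucl (m + 1)) ≠ 0 := by
    rw [← norm_pos_iff, norm_stdVec]; exact one_pos
  -- `A` turns the functional u into the first coordinate, so only direction e₀ has to be treated.
  obtain ⟨A, hA⟩ := exists_linearEquiv_inner_eq hu he0
  obtain ⟨Φ, hΦ1, hΦ2⟩ := h p A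
  obtain ⟨D, hD⟩ : ∃ D, D = linearImage (A : Eucl (m + 1) →ₗ[ℝ] Eucl (m + 1)) (diffBody K) :=
    ⟨_, rfl⟩
  obtain ⟨L, hL⟩ : ∃ L, L =
    linearImage (A : Eucl (m + 1) →ₗ[ℝ] Eucl (m + 1)) (translateBody p K) := ⟨_, rfl⟩
  rw [← hL] at hΦ1 hΦ2
  have g1 : (D : Set (Eucl (m + 1))) ⊆ s • (L : Set (Eucl (m + 1))) := by
    rw [hD, hL]; exact linearImage_subset_smul _ h1
  have g2 : (L : Set (Eucl (m + 1))) ⊆ t • (D : Set (Eucl (m + 1))) := by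
    rw [hD, hL]; exact linearImage_subset_smul _ h2
  have k1 := symList_subset_smul (List.finRange (m + 1)) hs g1
  have k2 := symList_subset_smul (List.finRange (m + 1)) ht g2
  -- With D', L' the symmetrals of D, L and E the ellipsoid of L', the chain is D' ⊆ sL' ⊆ sE ⊆
  -- s·lam·L' ⊆ s·lam·t·D'.
  obtain ⟨Φ', hΦ'⟩ : ∃ Φ' : Eucl (m + 1) ≃ₗ[ℝ] Eucl (m + 1), ∀ x, Φ' x = s • Φ x :=
    ⟨Φ.trans (LinearEquiv.smulOfNeZero ℝ _ s hs.ne'), fun x => rfl⟩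
  have hE : (ellBody Φ' : Set (Eucl (m + 1))) = s • (ellBody Φ : Set (Eucl (m + 1))) := by
    rw [coe_linearImage, coe_linearImage, ← image_smul, image_image]
    exact image_congr fun x _ => hΦ' x
  have hDneg : ∀ z ∈ (D : Set (Eucl (m + 1))), -z ∈ (D : Set (Eucl (m + 1))) := by
    rw [hD]
    rintro _ ⟨z, hz, rfl⟩
    exact ⟨-z, neg_mem_diffBody hz, map_neg _ _⟩
  have h0 : (0 : Eucl (m + 1)) ∈ symList (List.finRange (m + 1)) D :=
    ConvexBody.zero_mem_of_symmetric _ (neg_mem_symList _ hDneg)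
  have hlam : 1 ≤ s * lam * t := by nlinarith
  have key := moment_of_ellipsoid hc0 hc h0 hlam (Φ := Φ')
    (by rw [hE]; exact k1.trans (smul_set_mono hΦ1))
    (by
      rw [hE, mul_assoc, mul_smul, mul_smul]
      exact smul_set_mono (hΦ2.trans (smul_set_mono k2))) (stdVec 0)
  have horth : ∀ i ∈ (List.finRange m).map Fin.succ, ⟪(stdVec i : Eucl (m + 1)), stdVec 0⟫ = 0 := by
    intro i hi
    obtain ⟨j, -, rfl⟩ := List.mem_map.1 hi
    exact inner_stdVec_of_ne (Fin.succ_ne_zero j)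
  -- Without the superfluous direction e₀ all symmetrizations are orthogonal to e₀, so they preserve
  -- the support value, the volume and the moment in that direction.
  rw [symList_finRange_of_symmetric hDneg, suppFn_symList horth,
    setIntegral_symList continuous_const (by simp), setIntegral_symList (by fun_prop) (by
      intro i hi x
      have := horth i hi
      rw [real_inner_comm] at this
      rw [hproj, inner_sub_right, inner_smul_right, this]; simp), hD,
    suppFn_linearImage _ _ hA, integral_linearImage_one, coe_linearImage] at key
  have hI : ∫ x in (A : Eucl (m + 1) →ₗ[ℝ] Eucl (m + 1)) '' (diffBody K : Set (Eucl (m + 1))),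
      ⟪stdVec 0, x⟫ ^ 2 = |LinearMap.det (A : Eucl (m + 1) →ₗ[ℝ] Eucl (m + 1))| *
      ∫ x in (diffBody K : Set (Eucl (m + 1))), ⟪u, x⟫ ^ 2 := by
    refine (setIntegral_linearEquiv_image A (diffBody K).isCompact.measurableSet _).trans ?_
    simp only [hA]
  rw [hI] at key
  have hdet := linearEquiv_det_pos A
  obtain ⟨k3, k4⟩ := key
  constructor
  · refine le_of_mul_le_mul_left (le_trans (le_of_eq ?_) (k3.trans (le_of_eq ?_))) hdet
    · ring
    · ring
  · refine le_of_mul_le_mul_left (le_trans (le_of_eq ?_) (k4.trans (le_of_eq ?_))) hdet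
    · ring
    · ring

/-- The hypothesis places K - p between (1 - τ)D and (1 + τ)D. The power in the bound measures how
far D is from an ellipsoid, and the factor in front is the price for returning from D to K - p. -/
lemma bmDist_le_of_center {K : ConvexBody (Eucl (m + 1))} (h : AllNearEllipsoid lam K)
    (hl : 1 ≤ lam) (hK : (interior (K : Set (Eucl (m + 1)))).Nonempty) {τ : ℝ} (hτ0 : 0 ≤ τ)
    (hτ1 : τ < 1) {p : Eucl (m + 1)}
    (hp : ∀ u : Eucl (m + 1), |asym K u - ⟪u, p⟫| ≤ τ * suppFn (diffBody K) u) :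
    bmDist (K : Set (Eucl (m + 1))) (unitBall (m + 1)) ≤
      (1 + τ) / (1 - τ) * ((1 + τ) / (1 - τ) * lam) ^ (m + 3) := by
  obtain ⟨c, hc0, -, hc⟩ := exists_ellipsoid_moment (m + 1) (by omega)
  have h1 : ∀ u : Eucl (m + 1), (1 - τ) * suppFn (diffBody K) u ≤ suppFn (translateBody p K) u ∧
      suppFn (translateBody p K) u ≤ (1 + τ) * suppFn (diffBody K) u := by
    intro u
    have := abs_le.1 (hp u)
    rw [suppFn_translateBody_eq]
    constructor <;> linarith
  have hτ : 0 < 1 - τ := by linarith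
  have hτ' : 0 < 1 + τ := by linarith
  have hst : 1 ≤ (1 - τ)⁻¹ * (1 + τ) := by
    rw [inv_mul_eq_div, one_le_div hτ]; linarith
  have hs1 : (diffBody K : Set (Eucl (m + 1))) ⊆
      (1 - τ)⁻¹ • (translateBody p K : Set (Eucl (m + 1))) :=
    subset_smul_of_suppFn_le (by positivity) fun u => by
      rw [le_inv_mul_iff₀ hτ]; exact (h1 u).1
  have hs2 : (translateBody p K : Set (Eucl (m + 1))) ⊆
      (1 + τ) • (diffBody K : Set (Eucl (m + 1))) :=
    subset_smul_of_suppFn_le hτ' fun u => (h1 u).2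
  have key := fun (u : Eucl (m + 1)) (hu : ‖u‖ = 1) =>
    h.moment hl hc0 hc (inv_pos.2 hτ) hτ' hst hs1 hs2
      (show u ≠ 0 by rw [← norm_pos_iff, hu]; exact one_pos)
  have hmu : (1 - τ)⁻¹ * lam * (1 + τ) = (1 + τ) / (1 - τ) * lam := by
    rw [div_eq_mul_inv]; ring
  rw [hmu] at key
  have hmu1 : 1 ≤ ((1 + τ) / (1 - τ) * lam) ^ (m + 3) := by
    rw [inv_mul_eq_div] at hst
    exact one_le_pow₀ (one_le_mul_of_one_le_of_one_le hst hl)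
  obtain ⟨Ψ, a, b, ha, hab, hba, hΨ⟩ := bmDist_le_of_moment (interior_diffBody hK)
    (zero_mem_diffBody K) hc0 hmu1 (fun u hu => (key u hu).1) fun u hu => (key u hu).2
  have := bmDist_le_of_suppFn (K := K) p Ψ (a := (1 - τ) * a) (b := (1 + τ) * b) (by positivity)
    (by nlinarith)
    (fun u => by
      have := mul_le_mul_of_nonneg_left (hΨ u).1 hτ.le
      linarith [(h1 u).1])
    (fun u => by
      have := mul_le_mul_of_nonneg_left (hΨ u).2 hτ'.le
      linarith [(h1 u).2])
  rwa [mul_div_mul_comm, hba] at this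

theorem bmDist_le_of_allNearEllipsoid (m : ℕ) : ∃ C δ : ℝ, 0 < C ∧ 0 < δ ∧
    ∀ (η : ℝ) (K : ConvexBody (Eucl (m + 2))), 0 ≤ η → η ≤ δ →
    (interior (K : Set (Eucl (m + 2)))).Nonempty → AllNearEllipsoid (1 + η) K →
    bmDist (K : Set (Eucl (m + 2))) (unitBall (m + 2)) ≤ 1 + C * √η := by
  obtain ⟨C₀, δ₀, hC₀, hδ₀, hmain⟩ := exists_center m
  obtain ⟨C₁, hC₁⟩ : ∃ C₁ : ℝ, C₁ = C₀ + 1 := ⟨_, rfl⟩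
  have hC₁0 : 0 < C₁ := by linarith
  -- For 3τ ≤ 1 both (1 + τ)/(1 - τ) and 1 + η are at most 1 + 3τ. The dimension m + 2 gives the
  -- exponent m + 4 on a product of two such factors, and one more factor stands in front.
  obtain ⟨N, hN⟩ : ∃ N : ℕ, N = m + 4 + (m + 4) + 1 := ⟨_, rfl⟩
  refine ⟨N * 2 ^ N * (3 * C₁), min δ₀ ((3 * C₁)⁻¹ ^ 2),
    by rw [hN]; positivity, by positivity, fun η K hη hηδ hK h => ?_⟩
  obtain ⟨p, hp⟩ := hmain η K hη (hηδ.trans (min_le_left _ _)) hK h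
  have hs : 0 ≤ √η := Real.sqrt_nonneg η
  have hsq : √η ≤ (3 * C₁)⁻¹ := Real.sqrt_le_iff.2
    ⟨by positivity, hηδ.trans (min_le_right _ _)⟩
  obtain ⟨τ, hτ⟩ : ∃ τ, τ = C₁ * √η := ⟨_, rfl⟩
  have hτ0 : 0 ≤ τ := by rw [hτ]; positivity
  have hτ1 : 3 * τ ≤ 1 := by
    have : 3 * C₁ * √η ≤ 3 * C₁ * (3 * C₁)⁻¹ := by gcongr
    rw [mul_inv_cancel₀ (by positivity)] at this
    rw [hτ]; linarith
  have hητ : η ≤ 3 * τ := by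
    have h1 : √η ≤ τ := by rw [hτ, hC₁]; nlinarith
    have h2 : √η * √η = η := Real.mul_self_sqrt hη
    nlinarith
  have hbm := bmDist_le_of_center h (by linarith) hK hτ0 (by linarith) (p := p) fun u =>
    (hp u).trans (by
      rw [hτ, hC₁]
      have : 0 ≤ suppFn (diffBody K) u := suppFn_nonneg (zero_mem_diffBody K) u
      gcongr; linarith)
  have hq : (1 + τ) / (1 - τ) ≤ 1 + 3 * τ := by
    rw [div_le_iff₀ (by linarith)]; nlinarith
  have hq0 : 0 ≤ (1 + τ) / (1 - τ) := div_nonneg (by linarith) (by linarith)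
  calc _ ≤ _ := hbm
    _ ≤ (1 + 3 * τ) * ((1 + 3 * τ) * (1 + 3 * τ)) ^ (m + 4) := by gcongr
    _ = (1 + 3 * τ) ^ N := by rw [hN, mul_pow, ← pow_add, ← pow_succ']
    _ ≤ 1 + N * 2 ^ N * (3 * τ) := one_add_pow_le (by linarith) hτ1 N
    _ = _ := by rw [hτ]; ring

end NearlySymmetric

/-! ### The unconditional symmetral far from ellipsoids, and the theorem. -/

section Main

lemma isAffineStep_linearImage_translateBody {n : ℕ} (K : ConvexBody (Eucl n)) (c : Eucl n)
    (A : Eucl n ≃ₗ[ℝ] Eucl n) :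
    IsAffineStep K (linearImage (A : Eucl n →ₗ[ℝ] Eucl n) (translateBody c K)) := by
  refine ⟨(AffineEquiv.constVAdd ℝ (Eucl n) (-c)).trans A.toAffineEquiv, ?_⟩
  change A '' ((fun z => z - c) '' (K : Set (Eucl n))) = _
  rw [image_image]
  refine image_congr fun x _ => ?_
  simp [sub_eq_neg_add]

lemma interior_translateBody {n : ℕ} {K : ConvexBody (Eucl n)}
    (hK : (interior (K : Set (Eucl n))).Nonempty) (c : Eucl n) :
    (interior (translateBody c K : Set (Eucl n))).Nonempty := by
  apply interior_nonempty_of_volume_ne_zero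
  rw [setIntegral_translateBody]
  exact (volume_integral_pos hK).ne'

/-- A body far from ellipsoids has an affine image whose unconditional symmetral is far from
ellipsoids. -/
theorem exists_symmetral_bmDist (n : ℕ) (hn : 2 ≤ n) : ∃ a : ℝ, 0 < a ∧
    ∀ (ε : ℝ) (K : ConvexBody (Eucl n)), 0 < ε → HasInterior K →
      1 + ε < bmDist (K : Set (Eucl n)) (unitBall n) →
      ∃ U : ConvexBody (Eucl n), HasInterior U ∧ (∀ x ∈ U, -x ∈ U) ∧
        (∀ C, IsSteinerAffineLimit U C → IsSteinerAffineLimit K C) ∧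
        1 + a * ε ^ 2 < bmDist (U : Set (Eucl n)) (unitBall n) := by
  obtain ⟨m, rfl⟩ : ∃ m, n = m + 2 := ⟨n - 2, by omega⟩
  obtain ⟨C, δ, hC, hδ, hmain⟩ := bmDist_le_of_allNearEllipsoid m
  obtain ⟨M, hM⟩ : ∃ M : ℝ, M = 2 ^ (2 * (m + 2) + 3) := ⟨_, rfl⟩
  have hM0 : 0 < M := by rw [hM]; positivity
  -- The first term makes C√η ≤ ε for η = aε². The second keeps η ≤ δ, since ε ≤ M by the rough
  -- bound.
  obtain ⟨a, ha⟩ : ∃ a, a = min (C⁻¹ ^ 2) (δ / M ^ 2) := ⟨_, rfl⟩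
  have ha0 : 0 < a := by rw [ha]; positivity
  -- Half of a leaves the strict gap needed to pass from a distance at most 1 + (a/2)ε² to
  -- inclusions with ratio 1 + aε².
  refine ⟨a / 2, by positivity, fun ε K hε hK hbm => ?_⟩
  have hεM : ε ≤ M := by
    have := bmDist_le_rough hK
    rw [← hM] at this; linarith
  have hη0 : 0 < a * ε ^ 2 := by positivity
  have hηδ : a * ε ^ 2 ≤ δ := by
    calc a * ε ^ 2 ≤ δ / M ^ 2 * M ^ 2 := by
          gcongr; rw [ha]; exact min_le_right _ _
      _ = δ := by field_simp
  have hsq : C * √(a * ε ^ 2) ≤ ε := by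
    have h1 : √(a * ε ^ 2) ≤ C⁻¹ * ε := by
      refine Real.sqrt_le_iff.2 ⟨by positivity, ?_⟩
      rw [mul_pow]
      gcongr; rw [ha]; exact min_le_left _ _
    calc C * √(a * ε ^ 2) ≤ C * (C⁻¹ * ε) := by gcongr
      _ = ε := by field_simp
  have hnot : ¬ AllNearEllipsoid (1 + a * ε ^ 2) K := fun h => by
    have := hmain _ K hη0.le hηδ hK h
    linarith
  rw [AllNearEllipsoid] at hnot
  push Not at hnot
  obtain ⟨c, A, hcA⟩ := hnot
  have hUint : HasInterior (symList (List.finRange (m + 2))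
      (linearImage (A : Eucl (m + 2) →ₗ[ℝ] Eucl (m + 2)) (translateBody c K))) :=
    interior_symList _ (interior_linearImage (interior_translateBody hK c) A.surjective)
  have hUneg := neg_mem_of_hrefl fun i => hrefl_mem_symList (List.mem_finRange i)
    (K := linearImage (A : Eucl (m + 2) →ₗ[ℝ] Eucl (m + 2)) (translateBody c K))
  refine ⟨_, hUint, hUneg, fun C' hC' => IsSteinerAffineLimit.of_step
    (Or.inr (isAffineStep_linearImage_translateBody K c A)) hC'.of_symList, ?_⟩
  by_contra! hcon
  obtain ⟨-, Φ, h1, h2⟩ := exists_centred_ellipsoid hUint hUneg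
    (hcon.trans_lt (show 1 + a / 2 * ε ^ 2 < 1 + a * ε ^ 2 by linarith))
  exact hcA Φ h1 h2

theorem theorem1p4 (n : ℕ) (hn : 2 ≤ n) :
    ∃ γ : ℝ, 0 < γ ∧ ∀ (ε : ℝ) (K : ConvexBody (Eucl n)), 0 < ε → HasInterior K →
      1 + ε < bmDist (K : Set (Eucl n)) (unitBall n) →
      (∃ C : ConvexBody (Eucl n), HasInterior C ∧ OSymmetric (C : Set (Eucl n)) ∧
        AxialSymmetric (C : Set (Eucl n)) ∧ IsSteinerAffineLimit K C ∧
        1 + γ * ε ^ 2 < bmDist (C : Set (Eucl n)) (unitBall n)) ∧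
      (OSymmetric (K : Set (Eucl n)) →
        ∃ C : ConvexBody (Eucl n), HasInterior C ∧ OSymmetric (C : Set (Eucl n)) ∧
          AxialSymmetric (C : Set (Eucl n)) ∧ IsSteinerAffineLimit K C ∧
          1 + γ * ε < bmDist (C : Set (Eucl n)) (unitBall n)) := by
  obtain ⟨γ, hγ, hsymm⟩ := exists_axial_body_of_symmetric n hn
  obtain ⟨a, ha, hgen⟩ := exists_symmetral_bmDist n hn
  -- In the general case the symmetric result is applied to U with aε² in place of ε, hence the
  -- factor γa.
  refine ⟨min γ (γ * a), by positivity, fun ε K hε hK hbm => ⟨?_, fun hO => ?_⟩⟩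
  · obtain ⟨U, hU, hUneg, hUK, hUbm⟩ := hgen ε K hε hK hbm
    obtain ⟨C, h1, h2, h3, h4, h5⟩ := hsymm (a * ε ^ 2) U (by positivity) hU hUbm hUneg
    refine ⟨C, h1, h2, h3, hUK C h4, lt_of_le_of_lt ?_ h5⟩
    rw [← mul_assoc]
    gcongr
    exact min_le_right _ _
  · have hneg : ∀ x ∈ K, -x ∈ K := by
      intro x hx
      rw [← SetLike.mem_coe, ← hO]
      simpa using hx
    obtain ⟨C, h1, h2, h3, h4, h5⟩ := hsymm ε K hε hK hbm hneg
    refine ⟨C, h1, h2, h3, h4, lt_of_le_of_lt ?_ h5⟩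
    gcongr
    exact min_le_left _ _

end Main
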